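/- Let $p$ be an odd prime number and $n\ge 1$ an integer. Let $K$ be a number field, $E$ an elliptic curve over $K$, and $L/K$ a Galois extension with $\operatorname{Gal}(L/K)\cong \mathbb{Z}/p^n\mathbb{Z}$. For $F\in\{K,L\}$ let $$\operatorname{Sel}_p(E/F)=\ker\Big(H^1(F,E[p])\longrightarrow \prod_{v} H^1(F_v,E)[p]\Big)$$ be the $p$-Selmer group, where $v$ runs over the non-archimedean places of $F$, $F_v$ is the completion of $F$ at $v$, and the cohomology is the continuous cohomology of the absolute Galois groups of $F$ and $F_v$. Assume that (i) $\operatorname{Sel}_p(E/K)=0$; (ii) every prime of $K$ that lies above $p$ and every prime of $K$ at which $E$ has bad reduction splits completely in $L$; (iii) every prime $v$ of $K$ that ramifies in $L$ satisfies $\widetilde{E}(k_v)[p]=0$, where $k_v$ is the residue field at $v$ and $\widetilde{E}$ is the reduction at $v$ of a minimal Weierstrass model of $E$. Then $\operatorname{Sel}_p(E/L)=0$. -/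

import Mathlib

open NumberField IsDedekindDomain
open scoped Classical WeierstrassCurve

noncomputable section

/-! ### Continuous first cohomology of a topological group acting on a discrete module -/

section Cohomology

variable (G : Type*) [Group G] [TopologicalSpace G] (M : Type*) [AddCommGroup M]
  [DistribMulAction G M]

/-- The group `Z¹(G, M)` of continuous 1-cocycles of `G` with values in the module `M`, which
carries the discrete topology (a map to a discrete space is continuous iff it is locally
constant). -/
def contCocycles₁ : AddSubgroup (G → M) where
  carrier := {f | IsLocallyConstant f ∧ ∀ g h : G, f (g * h) = f g + g • f h}
  zero_mem' := ⟨IsLocallyConstant.const 0, fun g h => by simp⟩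
  add_mem' := by
    rintro f₁ f₂ ⟨hc₁, h₁⟩ ⟨hc₂, h₂⟩
    refine ⟨hc₁.add hc₂, fun g h => ?_⟩
    simp only [Pi.add_apply, h₁, h₂, smul_add]
    abel
  neg_mem' := by
    rintro f ⟨hc, h⟩
    refine ⟨hc.neg, fun g g' => ?_⟩
    simp only [Pi.neg_apply, h, smul_neg]
    abel

/-- The group `B¹(G, M)` of 1-coboundaries `g ↦ g • m - m`, as a subgroup of `Z¹(G, M)`. -/
def contCoboundaries₁ : AddSubgroup (contCocycles₁ G M) where
  carrier := {f | ∃ m : M, ∀ g : G, f.1 g = g • m - m}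
  zero_mem' := ⟨0, fun g => by simp⟩
  add_mem' := by
    rintro f₁ f₂ ⟨m₁, h₁⟩ ⟨m₂, h₂⟩
    refine ⟨m₁ + m₂, fun g => ?_⟩
    simp only [AddSubgroup.coe_add, Pi.add_apply, h₁, h₂, smul_add]
    abel
  neg_mem' := by
    rintro f ⟨m, h⟩
    refine ⟨-m, fun g => ?_⟩
    simp only [AddSubgroup.coe_neg, Pi.neg_apply, h, smul_neg]
    abel

/-- The continuous cohomology group `H¹(G, M) = Z¹(G, M) / B¹(G, M)`. -/
abbrev ContH1 : Type _ := contCocycles₁ G M ⧸ contCoboundaries₁ G M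

variable {G M} {H : Type*} [Group H] [TopologicalSpace H] {N : Type*} [AddCommGroup N]
  [DistribMulAction H N]

/-- Functoriality of continuous 1-cocycles for a continuous homomorphism `φ : H → G` and a
homomorphism `α : M → N` that is `H`-equivariant along `φ`: the cocycle `f` goes to
`α ∘ f ∘ φ`. -/
def contCocycles₁Map (φ : H →* G) (hφ : Continuous φ) (α : M →+ N)
    (hα : ∀ (h : H) (m : M), α (φ h • m) = h • α m) :
    contCocycles₁ G M →+ contCocycles₁ H N where
  toFun f := ⟨fun h => α (f.1 (φ h)),
    (f.2.1.comp_continuous hφ).comp α, fun h h' => by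
      show α (f.1 (φ (h * h'))) = α (f.1 (φ h)) + h • α (f.1 (φ h'))
      rw [map_mul, f.2.2, map_add, hα]⟩
  map_zero' := by ext h; simp
  map_add' f₁ f₂ := by ext h; simp

/-- Functoriality of `H¹`. -/
def ContH1.map (φ : H →* G) (hφ : Continuous φ) (α : M →+ N)
    (hα : ∀ (h : H) (m : M), α (φ h • m) = h • α m) :
    ContH1 G M →+ ContH1 H N :=
  QuotientAddGroup.map _ _ (contCocycles₁Map φ hφ α hα) (by
    rintro f ⟨m, hm⟩
    refine ⟨α m, fun h => ?_⟩
    change α (f.1 (φ h)) = _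
    rw [hm, map_sub, hα])

/-- An action on `M` by group automorphisms restricts to the torsion subgroup `M[n]`. -/
instance torsionByDistribMulAction (n : ℤ) :
    DistribMulAction G (AddSubgroup.torsionBy M n) where
  smul g m := ⟨g • m.1, by
    have h : n • m.1 = 0 := (Submodule.mem_torsionBy_iff n m.1).1 m.2
    refine (Submodule.mem_torsionBy_iff n (g • m.1)).2 ?_
    have h' : g • (n • m.1) = n • (g • m.1) :=
      map_zsmul (DistribSMul.toAddMonoidHom M g) n m.1
    rw [← h', h, smul_zero]⟩
  one_smul m := Subtype.ext (one_smul G m.1)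
  mul_smul g h m := Subtype.ext (mul_smul g h m.1)
  smul_zero g := Subtype.ext (smul_zero g)
  smul_add g m m' := Subtype.ext (smul_add g m.1 m'.1)

end Cohomology

/-! ### Galois action on the points of a curve, and restriction of Galois groups -/

section Galois

/-- `Gal(F/S)` acts on `E(F)` through the coordinates, for a curve `E` defined over `R ⊆ S`. -/
instance pointDistribMulAction {R S F : Type*} [CommRing R] [Field S] [Field F]
    [Algebra R S] [Algebra R F] [Algebra S F] [IsScalarTower R S F] (E : WeierstrassCurve R) :
    DistribMulAction Gal(F/S) (E⁄F).toAffine.Point where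
  smul σ P := WeierstrassCurve.Affine.Point.map (W' := E) (σ : F →ₐ[S] F) P
  one_smul P := by cases P <;> rfl
  mul_smul σ τ P := by cases P <;> rfl
  smul_zero σ := rfl
  smul_add σ P Q := map_add (WeierstrassCurve.Affine.Point.map (W' := E) (σ : F →ₐ[S] F)) P Q

variable (k k' : Type*) [Field k] [Field k'] [Algebra k k']

/-- A fixed (chosen) embedding over `k` of the algebraic closure of `k` into that of an extension `k'`. -/
def closureEmb : AlgebraicClosure k →ₐ[k] AlgebraicClosure k' := IsAlgClosed.lift

/-- The induced map of absolute Galois groups `Gal(k̄'/k') → Gal(k̄/k)`: the image of `σ` is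
the automorphism `τ` with `ι ∘ τ = σ ∘ ι` for the chosen embedding `ι`. -/
def galRes : Gal(AlgebraicClosure k'/k') →* Gal(AlgebraicClosure k/k) :=
  letI := (closureEmb k k').toRingHom.toAlgebra
  haveI : IsScalarTower k (AlgebraicClosure k) (AlgebraicClosure k') :=
    IsScalarTower.of_algebraMap_eq fun x => ((closureEmb k k').commutes x).symm
  (AlgEquiv.restrictNormalHom (F := k) (K₁ := AlgebraicClosure k') (AlgebraicClosure k)).comp
    (AlgEquiv.restrictScalarsHom k)

theorem closureEmb_galRes (σ : Gal(AlgebraicClosure k'/k')) (x : AlgebraicClosure k) :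
    closureEmb k k' (galRes k k' σ x) = σ (closureEmb k k' x) := by
  let := (closureEmb k k').toRingHom.toAlgebra
  have : IsScalarTower k (AlgebraicClosure k) (AlgebraicClosure k') :=
    IsScalarTower.of_algebraMap_eq fun x => ((closureEmb k k').commutes x).symm
  exact AlgEquiv.restrictNormal_commutes (σ.restrictScalars k) (AlgebraicClosure k) x

theorem continuous_galRes : Continuous (galRes k k') := by
  apply continuous_of_continuousAt_one _ (continuousAt_def.mpr _)
  intro s hs
  rw [map_one, krullTopology_mem_nhds_one_iff] at hs
  obtain ⟨F, hF, hFs⟩ := hs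
  let b := Module.finBasis k F
  have hopen : IsOpen (⋂ i, (MulAction.stabilizer Gal(AlgebraicClosure k'/k')
      (closureEmb k k' (b i : AlgebraicClosure k)) : Set Gal(AlgebraicClosure k'/k'))) :=
    isOpen_iInter_of_finite fun i => stabilizer_isOpen_of_isIntegral _
  refine Filter.mem_of_superset (hopen.mem_nhds (Set.mem_iInter.2 fun i => one_mem _)) ?_
  intro σ hσ
  refine hFs ((IntermediateField.mem_fixingSubgroup_iff F _).2 fun x hx => ?_)
  have hlin : (galRes k k' σ : AlgebraicClosure k →ₐ[k] AlgebraicClosure k).toLinearMap ∘ₗ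
      F.val.toLinearMap = F.val.toLinearMap := by
    refine b.ext fun i => ?_
    apply (closureEmb k k').injective
    exact (closureEmb_galRes k k' σ _).trans (Set.mem_iInter.1 hσ i)
  exact LinearMap.congr_fun hlin ⟨x, hx⟩

/-- The homomorphism `E(k̄)[n] → E(k̄')` induced by the chosen embedding, for `E` over `k`. -/
def torsionPointMap (E : WeierstrassCurve k) (n : ℤ) :
    AddSubgroup.torsionBy (E⁄(AlgebraicClosure k)).toAffine.Point n →+
      (E⁄(AlgebraicClosure k')).toAffine.Point :=
  (WeierstrassCurve.Affine.Point.map (W' := E) (closureEmb k k')).comp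
    (AddSubgroup.torsionBy (E⁄(AlgebraicClosure k)).toAffine.Point n).subtype

theorem torsionPointMap_smul (E : WeierstrassCurve k) (n : ℤ)
    (σ : Gal(AlgebraicClosure k'/k'))
    (P : AddSubgroup.torsionBy (E⁄(AlgebraicClosure k)).toAffine.Point n) :
    torsionPointMap k k' E n (galRes k k' σ • P) = σ • torsionPointMap k k' E n P := by
  obtain ⟨P, hP⟩ := P
  cases P with
  | zero => rfl
  | some x y h =>
    change WeierstrassCurve.Affine.Point.some _ _ _ = WeierstrassCurve.Affine.Point.some _ _ _
    rw [WeierstrassCurve.Affine.Point.some.injEq]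
    exact ⟨closureEmb_galRes k k' σ x, closureEmb_galRes k k' σ y⟩

end Galois

/-! ### Selmer groups -/

section Selmer

variable {K : Type*} [Field K] [NumberField K] (E : WeierstrassCurve K)

/-- The localisation map `H¹(K, E[n]) → H¹(K_v, E)` at a non-archimedean place `v`; its image
lies in `H¹(K_v, E)[n]`. -/
def selmerLoc (n : ℕ) (v : HeightOneSpectrum (𝓞 K)) :
    ContH1 Gal(AlgebraicClosure K/K)
        (AddSubgroup.torsionBy (E⁄(AlgebraicClosure K)).toAffine.Point (n : ℤ)) →+
      ContH1 Gal(AlgebraicClosure (v.adicCompletion K)/(v.adicCompletion K))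
        (E⁄(AlgebraicClosure (v.adicCompletion K))).toAffine.Point :=
  ContH1.map (galRes K (v.adicCompletion K)) (continuous_galRes K (v.adicCompletion K))
    (torsionPointMap K (v.adicCompletion K) E n)
    (torsionPointMap_smul K (v.adicCompletion K) E n)

/-- The `n`-Selmer group of `E` over the number field `K`: the kernel of
`H¹(K, E[n]) → ∏ᵥ H¹(K_v, E)[n]`, the product being over all non-archimedean places of `K`. -/
def ellipticSelmerGroup (n : ℕ) :
    AddSubgroup (ContH1 Gal(AlgebraicClosure K/K)
      (AddSubgroup.torsionBy (E⁄(AlgebraicClosure K)).toAffine.Point (n : ℤ))) :=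
  ⨅ v : HeightOneSpectrum (𝓞 K), (selmerLoc E n v).ker

end Selmer

/-! ### Reduction, ramification and splitting at the primes of a number field -/

section Local

variable {K : Type*} [Field K] [NumberField K]

/-- A minimal Weierstrass equation over `K_v` of the curve `E`. -/
def minimalAt (E : WeierstrassCurve K) (v : HeightOneSpectrum (𝓞 K)) :
    WeierstrassCurve (v.adicCompletion K) :=
  (E⁄(v.adicCompletion K)).minimal (v.adicCompletionIntegers K)

instance (E : WeierstrassCurve K) (v : HeightOneSpectrum (𝓞 K)) :
    (minimalAt E v).IsMinimal (v.adicCompletionIntegers K) :=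
  inferInstanceAs (((E⁄(v.adicCompletion K)).minimal
    (v.adicCompletionIntegers K)).IsMinimal (v.adicCompletionIntegers K))

/-- `E` has bad reduction at `v`. -/
def HasBadReductionAt (E : WeierstrassCurve K) (v : HeightOneSpectrum (𝓞 K)) : Prop :=
  ¬ (minimalAt E v).HasGoodReduction (v.adicCompletionIntegers K)

/-- The reduction `Ẽ` of `E` at `v`, a curve over the residue field `k_v`. -/
def reductionAt (E : WeierstrassCurve K) (v : HeightOneSpectrum (𝓞 K)) :
    WeierstrassCurve (IsLocalRing.ResidueField (v.adicCompletionIntegers K)) :=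
  (minimalAt E v).reduction (v.adicCompletionIntegers K)

variable (L : Type*) [Field L] [NumberField L] [Algebra K L]

/-- The prime `v` of `K` splits completely in `L`: every prime of `L` above `v` has
ramification index 1 and residue degree 1. -/
def SplitsCompletelyIn (v : HeightOneSpectrum (𝓞 K)) : Prop :=
  ∀ w ∈ v.asIdeal.primesOver (𝓞 L),
    w.ramificationIdx (𝓞 K) = 1 ∧ w.inertiaDeg (𝓞 K) = 1

/-- The prime `v` of `K` ramifies in `L`: some prime of `L` above `v` has ramification
index different from 1. -/
def RamifiesIn (v : HeightOneSpectrum (𝓞 K)) : Prop :=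
  ∃ w ∈ v.asIdeal.primesOver (𝓞 L), w.ramificationIdx (𝓞 K) ≠ 1

end Local

end

/-!
Write `D` for the absolute Galois group of `K` and `U` for its subgroup that fixes `L`; the quotient
`D / U` is cyclic of order `p ^ n`. Suppose that `Sel_p(E/L)` is nonzero. It is an `𝔽_p`-vector space
on which a cyclic `p`-group acts, so it contains a nonzero class that is invariant under `D / U`
(`exists_invariant_cocycle`). Such a class is shown to come from `Sel_p(E/K) = 0`, a contradiction.

*Extending the class to `D`.* The Kummer map embeds `E(K) / p` in `Sel_p(E/K) = 0`, so the `p`-primary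
part of `E(K)` is `p`-divisible. It is also finite, since it injects into the points of a reduction,
and hence it is zero (`eq_zero_of_fixed_of_selmer`). As `D / U` is a `p`-group, `E(L)[p] = 0` follows
(`eq_zero_of_fixed_of_isCyclic`). Therefore restriction identifies `H¹(K, E[p])` with the invariants
of `H¹(L, E[p])` (`exists_cocycle_extension`), and the class extends to a cocycle `F` of `D`.

*The local conditions for `F`.* At a place `v` that splits completely in `L` there is nothing to
show. At the other places `p` is a unit and `E` has good reduction, so that the reduction map is
injective on `p`-power torsion and inertia acts trivially on it; the cocycle vanishes on
inertia within the subgroup of `L`. There are two cases (`exists_local_coboundary`).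

* If `v` is unramified in `L`, then `F` is determined at `v` by its value at a Frobenius `φ`, and one
  has to solve `φ R - R = F(φ)`. The kernel of `φ - 1` on `E[p ^ N]` is bounded independently of `N`,
  since it injects into the rational points of the reduction; its cokernel has the same order and is
  killed by `p ^ (N - 1)` for large `N`. As `F(φ) ∈ E[p]` is divisible by `p ^ (N - 1)` in
  `E[p ^ N]`, a solution exists (`exists_map_sub_eq`, `exists_coboundary_of_unramified`).
* If `v` ramifies in `L`, then `Ẽ(k_v)[p] = 0`, and so `E[p]` has no invariants under the
  decomposition groups of `K` and of `L`. For a Frobenius `φ` of `L`, the map `φ - 1` is then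
  bijective on `E[p]`, so that `F` becomes a coboundary of `E[p]` over `L`; what remains takes
  values in the invariants and vanishes (`exists_coboundary_of_no_torsion`).

The geometric input is built from Weierstrass equations. Reduction at an arbitrary valuation ring is
shown to be a homomorphism without `n`-torsion in its kernel when `n` is a unit, by computing
in the parameter `x / y` at the origin (`CurveReducesTo.eq_zero_of_redHom_eq_zero`). The finiteness
of `E[p]` and the divisibility of `E(K̄)` come from writing multiplication by `p` on abscissas
as a rational function, which is read off at the generic point and specialised by means of the
same reduction map (`exists_ratFunc_of_nsmul`).
-/

/-! ### Reduction of points at a place -/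

section Place

variable {F κ : Type*} [Field F] [Field κ] {B : ValuationSubring F}

/-- `x` is integral at the place `π : B → κ` and specialises to `c`. -/
def ReducesTo (π : B →+* κ) (x : F) (c : κ) : Prop := ∃ h : x ∈ B, π ⟨x, h⟩ = c

namespace ReducesTo

variable {π : B →+* κ} {x y : F} {c d : κ}

theorem mem (h : ReducesTo π x c) : x ∈ B := h.1

theorem of_mem (π : B →+* κ) (h : x ∈ B) : ReducesTo π x (π ⟨x, h⟩) := ⟨h, rfl⟩

theorem unique (h : ReducesTo π x c) (h' : ReducesTo π x d) : c = d := h.2.symm.trans h'.2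

theorem congr (h : ReducesTo π x c) (hxy : x = y) (hcd : c = d) : ReducesTo π y d :=
  hxy ▸ hcd ▸ h

theorem zero : ReducesTo π 0 0 := ⟨B.zero_mem, map_zero π⟩

theorem one : ReducesTo π 1 1 := ⟨B.one_mem, map_one π⟩

theorem add (h : ReducesTo π x c) (h' : ReducesTo π y d) : ReducesTo π (x + y) (c + d) := by
  obtain ⟨hx, rfl⟩ := h
  obtain ⟨hy, rfl⟩ := h'
  exact ⟨B.add_mem _ _ hx hy, map_add π ⟨x, hx⟩ ⟨y, hy⟩⟩

theorem mul (h : ReducesTo π x c) (h' : ReducesTo π y d) : ReducesTo π (x * y) (c * d) := by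
  obtain ⟨hx, rfl⟩ := h
  obtain ⟨hy, rfl⟩ := h'
  exact ⟨B.mul_mem _ _ hx hy, map_mul π ⟨x, hx⟩ ⟨y, hy⟩⟩

theorem neg (h : ReducesTo π x c) : ReducesTo π (-x) (-c) := by
  obtain ⟨hx, rfl⟩ := h
  exact ⟨B.neg_mem _ hx, map_neg π ⟨x, hx⟩⟩

theorem sub (h : ReducesTo π x c) (h' : ReducesTo π y d) : ReducesTo π (x - y) (c - d) := by
  simpa only [sub_eq_add_neg] using h.add h'.neg

theorem pow (h : ReducesTo π x c) (n : ℕ) : ReducesTo π (x ^ n) (c ^ n) := by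
  obtain ⟨hx, rfl⟩ := h
  exact ⟨pow_mem hx n, map_pow π ⟨x, hx⟩ n⟩

theorem natCast (n : ℕ) : ReducesTo π (n : F) (n : κ) :=
  ⟨natCast_mem B n, map_natCast π n⟩

theorem ne_zero (h : ReducesTo π x c) (hc : c ≠ 0) : x ≠ 0 := by
  rintro rfl
  exact hc (h.unique zero)

variable [IsLocalHom π]

theorem inv (h : ReducesTo π x c) (hc : c ≠ 0) : ReducesTo π x⁻¹ c⁻¹ := by
  have hx0 := h.ne_zero hc
  obtain ⟨hx, rfl⟩ := h
  have hu : IsUnit (⟨x, hx⟩ : B) := (isUnit_iff_ne_zero.2 hc).of_map π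
  obtain ⟨u, hu⟩ := hu
  have hinv : ((u⁻¹ : Bˣ) : B).1 = x⁻¹ := by
    apply eq_inv_of_mul_eq_one_left
    have := congrArg Subtype.val (Units.inv_mul u)
    rwa [hu] at this
  have hm : x⁻¹ ∈ B := hinv ▸ ((u⁻¹ : Bˣ) : B).2
  refine ⟨hm, eq_inv_of_mul_eq_one_left ?_⟩
  rw [← map_mul, ← map_one π]
  congr 1
  exact Subtype.ext (inv_mul_cancel₀ hx0)

theorem div (h : ReducesTo π x c) (h' : ReducesTo π y d) (hd : d ≠ 0) :
    ReducesTo π (x / y) (c / d) := by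
  simpa only [div_eq_mul_inv] using h.mul (h'.inv hd)

theorem inv_of_notMem (h : x ∉ B) : ReducesTo π x⁻¹ 0 := by
  have hm : x⁻¹ ∈ B := (B.mem_or_inv_mem x).resolve_left h
  refine ⟨hm, ?_⟩
  by_contra hc
  exact h (by simpa using ((of_mem π hm).inv hc).mem)

end ReducesTo

/-- A valuation ring is integrally closed: the case of a monic quadratic equation. -/
theorem ValuationSubring.mem_of_mul_add_mem {ℓ a : F} (ha : a ∈ B) (h : ℓ * (ℓ + a) ∈ B) :
    ℓ ∈ B := by
  by_contra hℓ
  have hi : ℓ⁻¹ ∈ B := (B.mem_or_inv_mem ℓ).resolve_left hℓ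
  have h0 : ℓ ≠ 0 := by rintro rfl; exact hℓ B.zero_mem
  have : ℓ⁻¹ * (ℓ * (ℓ + a)) - a ∈ B := sub_mem (B.mul_mem _ _ hi h) ha
  rw [inv_mul_cancel_left₀ h0, add_sub_cancel_right] at this
  exact hℓ this

/-- The coefficients of `W` are integral at `π` and reduce to those of `W'`. -/
structure CurveReducesTo (π : B →+* κ) (W : WeierstrassCurve F) (W' : WeierstrassCurve κ) :
    Prop where
  a₁ : ReducesTo π W.a₁ W'.a₁
  a₂ : ReducesTo π W.a₂ W'.a₂
  a₃ : ReducesTo π W.a₃ W'.a₃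
  a₄ : ReducesTo π W.a₄ W'.a₄
  a₆ : ReducesTo π W.a₆ W'.a₆

open WeierstrassCurve WeierstrassCurve.Affine

/-- The slope of the chord or tangent through two points that are not opposite satisfies both of the
usual formulas in denominator-free form: this one, and `slope_mul_sub_negY`. Multiplied out, they
specialise even where the denominator reduces to zero. -/
theorem WeierstrassCurve.Affine.slope_mul_sub {W : Affine F} {x₁ x₂ y₁ y₂ : F}
    (h₁ : W.Equation x₁ y₁) (h₂ : W.Equation x₂ y₂) (h : ¬(x₁ = x₂ ∧ y₁ = W.negY x₂ y₂)) :
    W.slope x₁ x₂ y₁ y₂ * (x₁ - x₂) = y₁ - y₂ := by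
  by_cases hx : x₁ = x₂
  · have hy := Y_eq_of_Y_ne h₁ h₂ hx fun hy => h ⟨hx, hy⟩
    simp [hx, hy]
  · rw [slope_of_X_ne hx, div_mul_cancel₀ _ (sub_ne_zero.2 hx)]

theorem WeierstrassCurve.Affine.slope_mul_sub_negY {W : Affine F} {x₁ x₂ y₁ y₂ : F}
    (h₁ : W.Equation x₁ y₁) (h₂ : W.Equation x₂ y₂) (h : ¬(x₁ = x₂ ∧ y₁ = W.negY x₂ y₂)) :
    W.slope x₁ x₂ y₁ y₂ * (y₁ - W.negY x₂ y₂) =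
      x₁ ^ 2 + x₁ * x₂ + x₂ ^ 2 + W.a₂ * (x₁ + x₂) + W.a₄ - W.a₁ * y₁ := by
  by_cases hx : x₁ = x₂
  · have hy' : y₁ ≠ W.negY x₂ y₂ := fun hy => h ⟨hx, hy⟩
    have hy := Y_eq_of_Y_ne h₁ h₂ hx hy'
    subst hx hy
    rw [slope_of_Y_ne rfl hy', div_mul_cancel₀ _ (sub_ne_zero.2 hy')]
    ring
  · apply mul_right_cancel₀ (sub_ne_zero.2 hx)
    have hs := slope_mul_sub h₁ h₂ h
    rw [equation_iff] at h₁ h₂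
    rw [negY]
    linear_combination (y₁ - (-y₂ - W.a₁ * x₂ - W.a₃)) * hs + h₁ - h₂

/-- The reduction relation between points: points with non-integral `x`-coordinate, as well as
the origin, reduce to the origin. -/
inductive PointReducesTo (π : B →+* κ) {W : Affine F} {W' : Affine κ} :
    W.Point → W'.Point → Prop
  | zero : PointReducesTo π 0 0
  | infty {x y : F} (h : W.Nonsingular x y) (hx : x ∉ B) : PointReducesTo π (.some x y h) 0
  | some {x y : F} {x' y' : κ} (h : W.Nonsingular x y) (h' : W'.Nonsingular x' y')
      (hx : ReducesTo π x x') (hy : ReducesTo π y y') :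
      PointReducesTo π (.some x y h) (.some x' y' h')

variable {π : B →+* κ} {W : Affine F} {W' : Affine κ}

namespace CurveReducesTo

theorem mem_of_equation (H : CurveReducesTo π W W') {x y : F} (h : W.Equation x y) (hx : x ∈ B) :
    y ∈ B := by
  rw [equation_iff] at h
  refine ValuationSubring.mem_of_mul_add_mem (a := W.a₁ * x + W.a₃)
    (add_mem (mul_mem H.a₁.mem hx) H.a₃.mem) ?_
  have : y * (y + (W.a₁ * x + W.a₃)) = x ^ 3 + W.a₂ * x ^ 2 + W.a₄ * x + W.a₆ := by
    linear_combination h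
  rw [this]
  exact add_mem (add_mem (add_mem (pow_mem hx 3) (mul_mem H.a₂.mem (pow_mem hx 2)))
    (mul_mem H.a₄.mem hx)) H.a₆.mem

theorem equation (H : CurveReducesTo π W W') {x y : F} {x' y' : κ} (h : W.Equation x y)
    (hx : ReducesTo π x x') (hy : ReducesTo π y y') : W'.Equation x' y' := by
  rw [equation_iff'] at h ⊢
  refine ReducesTo.unique ?_ ReducesTo.zero (π := π)
  refine ReducesTo.congr (((hy.pow 2).add ((H.a₁.mul hx).mul hy)).add (H.a₃.mul hy) |>.sub
    ((((hx.pow 3).add (H.a₂.mul (hx.pow 2))).add (H.a₄.mul hx)).add H.a₆)) h rfl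

theorem negY (H : CurveReducesTo π W W') {x y : F} {x' y' : κ}
    (hx : ReducesTo π x x') (hy : ReducesTo π y y') :
    ReducesTo π (W.negY x y) (W'.negY x' y') :=
  (hy.neg.sub (H.a₁.mul hx)).sub H.a₃

theorem addX (H : CurveReducesTo π W W') {x₁ x₂ ℓ : F} {x₁' x₂' ℓ' : κ}
    (hx₁ : ReducesTo π x₁ x₁') (hx₂ : ReducesTo π x₂ x₂') (hℓ : ReducesTo π ℓ ℓ') :
    ReducesTo π (W.addX x₁ x₂ ℓ) (W'.addX x₁' x₂' ℓ') :=
  ((((hℓ.pow 2).add (H.a₁.mul hℓ)).sub H.a₂).sub hx₁).sub hx₂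

theorem addY (H : CurveReducesTo π W W') {x₁ x₂ y₁ ℓ : F} {x₁' x₂' y₁' ℓ' : κ}
    (hx₁ : ReducesTo π x₁ x₁') (hx₂ : ReducesTo π x₂ x₂') (hy₁ : ReducesTo π y₁ y₁')
    (hℓ : ReducesTo π ℓ ℓ') :
    ReducesTo π (W.addY x₁ x₂ y₁ ℓ) (W'.addY x₁' x₂' y₁' ℓ') :=
  H.negY (H.addX hx₁ hx₂ hℓ) ((hℓ.mul ((H.addX hx₁ hx₂ hℓ).sub hx₁)).add hy₁)

theorem exists_reducesTo [W'.IsElliptic] (H : CurveReducesTo π W W') (P : W.Point) :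
    ∃ P' : W'.Point, PointReducesTo π P P' := by
  cases P with
  | zero => exact ⟨0, .zero⟩
  | some x y h =>
    by_cases hx : x ∈ B
    · have hy := H.mem_of_equation h.1 hx
      have he := H.equation h.1 (.of_mem π hx) (.of_mem π hy)
      exact ⟨_, .some h (W'.equation_iff_nonsingular.1 he) (.of_mem π hx) (.of_mem π hy)⟩
    · exact ⟨0, .infty h hx⟩

end CurveReducesTo

namespace PointReducesTo

theorem unique {P : W.Point} {P₁ P₂ : W'.Point} (h₁ : PointReducesTo π P P₁)
    (h₂ : PointReducesTo π P P₂) : P₁ = P₂ := by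
  cases h₁ with
  | zero => cases h₂; rfl
  | infty h hx =>
    cases h₂ with
    | infty _ _ => rfl
    | some _ _ hx' _ => exact absurd hx'.mem hx
  | some h h' hx hy =>
    cases h₂ with
    | infty _ hx' => exact absurd hx.mem hx'
    | some _ _ hx' hy' =>
      obtain rfl := hx.unique hx'
      obtain rfl := hy.unique hy'
      rfl

theorem neg (H : CurveReducesTo π W W') {P : W.Point} {P' : W'.Point}
    (h : PointReducesTo π P P') : PointReducesTo π (-P) (-P') := by
  cases h with
  | zero => exact .zero
  | infty h hx => exact .infty _ hx
  | some h h' hx hy => exact .some _ _ hx (H.negY hx hy)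

variable [IsLocalHom π]

/-- Additivity of reduction for two integral points. The delicate case is that of points whose
reductions are opposite while they are not. -/
theorem add_some (H : CurveReducesTo π W W') {x₁ y₁ x₂ y₂ : F} {x₁' y₁' x₂' y₂' : κ}
    (h₁ : W.Nonsingular x₁ y₁) (h₂ : W.Nonsingular x₂ y₂)
    (h₁' : W'.Nonsingular x₁' y₁') (h₂' : W'.Nonsingular x₂' y₂')
    (hx₁ : ReducesTo π x₁ x₁') (hy₁ : ReducesTo π y₁ y₁')
    (hx₂ : ReducesTo π x₂ x₂') (hy₂ : ReducesTo π y₂ y₂') :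
    PointReducesTo π (Point.some x₁ y₁ h₁ + Point.some x₂ y₂ h₂)
      (Point.some x₁' y₁' h₁' + Point.some x₂' y₂' h₂') := by
  have hD := hy₁.sub (H.negY hx₂ hy₂)
  have hN := (((((hx₁.pow 2).add (hx₁.mul hx₂)).add (hx₂.pow 2)).add
    (H.a₂.mul (hx₁.add hx₂))).add H.a₄).sub (H.a₁.mul hy₁)
  by_cases h' : x₁' = x₂' ∧ y₁' = W'.negY x₂' y₂'
  · rw [Point.add_of_Y_eq h'.1 h'.2]
    by_cases h : x₁ = x₂ ∧ y₁ = W.negY x₂ y₂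
    · rw [Point.add_of_Y_eq h.1 h.2]
      exact .zero
    · rw [Point.add_some h]
      refine .infty _ fun hx₃ => ?_
      -- if the sum were integral then so would be the slope, which forces both partial
      -- derivatives of the reduced curve to vanish at the reduced point
      have hℓ : W.slope x₁ x₂ y₁ y₂ ∈ B := by
        refine ValuationSubring.mem_of_mul_add_mem H.a₁.mem ?_
        have := add_mem (add_mem (add_mem hx₃ H.a₂.mem) hx₁.mem) hx₂.mem
        rw [WeierstrassCurve.Affine.addX] at this
        convert this using 1
        ring
      have hℓ := ReducesTo.of_mem π hℓ
      have e₁ := (hℓ.mul (hx₁.sub hx₂)).unique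
        ((hy₁.sub hy₂).congr (slope_mul_sub h₁.1 h₂.1 h).symm rfl)
      have e₂ := (hℓ.mul hD).unique (hN.congr (slope_mul_sub_negY h₁.1 h₂.1 h).symm rfl)
      rw [h'.1, sub_self, mul_zero] at e₁
      have hy : y₁' = y₂' := (sub_eq_zero.1 e₁.symm)
      have hx := h'.1
      have hyn := h'.2
      rw [hyn, sub_self, mul_zero, ← hyn] at e₂
      subst hx hy
      have := ((nonsingular_iff' _ _).1 h₁').2
      rw [WeierstrassCurve.Affine.negY] at hyn
      rcases this with h | h
      · exact h (by linear_combination e₂)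
      · exact h (by linear_combination hyn)
  · have h : ¬(x₁ = x₂ ∧ y₁ = W.negY x₂ y₂) := by
      rintro ⟨rfl, rfl⟩
      exact h' ⟨hx₁.unique hx₂, hy₁.unique (H.negY hx₂ hy₂)⟩
    have hℓ : ReducesTo π (W.slope x₁ x₂ y₁ y₂) (W'.slope x₁' x₂' y₁' y₂') := by
      by_cases hx' : x₁' = x₂'
      · have hd : y₁' - W'.negY x₂' y₂' ≠ 0 := sub_ne_zero.2 fun e => h' ⟨hx', e⟩
        refine (hN.div hD hd).congr ?_ ?_
        · rw [← slope_mul_sub_negY h₁.1 h₂.1 h, mul_div_cancel_right₀ _ (hD.ne_zero hd)]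
        · rw [← slope_mul_sub_negY h₁'.1 h₂'.1 h', mul_div_cancel_right₀ _ hd]
      · have hd := sub_ne_zero.2 hx'
        refine ((hy₁.sub hy₂).div (hx₁.sub hx₂) hd).congr ?_ ?_
        · rw [← slope_mul_sub h₁.1 h₂.1 h, mul_div_cancel_right₀ _ ((hx₁.sub hx₂).ne_zero hd)]
        · rw [← slope_mul_sub h₁'.1 h₂'.1 h', mul_div_cancel_right₀ _ hd]
    rw [Point.add_some h, Point.add_some h']
    exact .some _ _ (H.addX hx₁ hx₂ hℓ) (H.addY hx₁ hx₂ hy₁ hℓ)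

end PointReducesTo

end Place

/-! ### The kernel of reduction -/

section FormalGroup

open WeierstrassCurve WeierstrassCurve.Affine

variable {F κ : Type*} [Field F] [Field κ] {B : ValuationSubring F}
variable {π : B →+* κ} {W : Affine F} {W' : Affine κ}

/-- Vieta's formulas for the intersection of a Weierstrass curve with the line of slope `ℓ`
through two points. -/
theorem WeierstrassCurve.Affine.vieta_slope {x₁ x₂ y₁ y₂ : F}
    (h₁ : W.Equation x₁ y₁) (h₂ : W.Equation x₂ y₂) (h : ¬(x₁ = x₂ ∧ y₁ = W.negY x₂ y₂))
    {ℓ μ x₃ : F} (hℓ : ℓ = W.slope x₁ x₂ y₁ y₂) (hμ : μ = y₁ - ℓ * x₁)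
    (hx₃ : x₃ = W.addX x₁ x₂ ℓ) :
    x₁ + x₂ + x₃ = ℓ ^ 2 + W.a₁ * ℓ - W.a₂ ∧
    x₁ * x₂ + x₁ * x₃ + x₂ * x₃ = W.a₄ - 2 * ℓ * μ - W.a₁ * μ - W.a₃ * ℓ ∧
    x₁ * x₂ * x₃ = μ ^ 2 + W.a₃ * μ - W.a₆ := by
  have key := addPolynomial_slope h₁ h₂ h
  rw [← hℓ, ← hx₃, addPolynomial_eq] at key
  have e0 := congrArg (Polynomial.eval 0) key
  have e1 := congrArg (fun q => Polynomial.eval 0 (Polynomial.derivative q)) key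
  simp [Cubic.toPoly, Polynomial.derivative_pow] at e0 e1
  refine ⟨?_, ?_, ?_⟩
  · rw [hx₃, addX]; ring
  · rw [hμ]; linear_combination e1
  · rw [hμ]; linear_combination -e0

/-- The Weierstrass equation in the coordinates `z = x / y`, `w = 1 / y` at the origin. -/
theorem WeierstrassCurve.Affine.equation_at_infty {x y z w : F} (h : W.Equation x y)
    (hz : x * w = z) (hw : y * w = 1) :
    w + W.a₁ * z * w + W.a₃ * w ^ 2 =
      z ^ 3 + W.a₂ * z ^ 2 * w + W.a₄ * z * w ^ 2 + W.a₆ * w ^ 3 := by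
  subst hz
  rw [equation_iff] at h
  linear_combination w ^ 3 * h - (w * (1 + y * w) + W.a₁ * x * w ^ 2 + W.a₃ * w ^ 2) * hw

/-- `InFormal B W s α P` says that the parameter `x / y` of the point `P` equals `s * α` with `α`
integral, while `1 / y` is divisible by `s ^ 3`. When `s` is in the maximal ideal this puts `P` in
the kernel of reduction. Fixing a scale `s` replaces the filtration of the formal group, so that
valuations that are not discrete can be treated. -/
inductive InFormal (B : ValuationSubring F) (W : Affine F) (s : F) : F → W.Point → Prop
  | zero : InFormal B W s 0 0
  | some {x y α β : F} (h : W.Nonsingular x y) (hα : α ∈ B) (hβ : β ∈ B)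
      (hz : x * (s ^ 3 * β) = s * α) (hw : y * (s ^ 3 * β) = 1) :
      InFormal B W s α (.some x y h)

namespace CurveReducesTo

variable [IsLocalHom π]

/-- The addition law in the coordinates `z = x / y`, `w = 1 / y` near the origin: the parameters add
up to terms of higher order. -/
theorem formal_add (H : CurveReducesTo π W W') {s : F} (hs : ReducesTo π s 0)
    {x₁ y₁ x₂ y₂ α₁ β₁ α₂ β₂ : F} (h₁ : W.Nonsingular x₁ y₁) (h₂ : W.Nonsingular x₂ y₂)
    (h : ¬(x₁ = x₂ ∧ y₁ = W.negY x₂ y₂))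
    (hα₁ : α₁ ∈ B) (hβ₁ : β₁ ∈ B) (hz₁ : x₁ * (s ^ 3 * β₁) = s * α₁) (hw₁ : y₁ * (s ^ 3 * β₁) = 1)
    (hα₂ : α₂ ∈ B) (hβ₂ : β₂ ∈ B) (hz₂ : x₂ * (s ^ 3 * β₂) = s * α₂)
    (hw₂ : y₂ * (s ^ 3 * β₂) = 1) :
    ∃ γ ∈ B, InFormal B W s (α₁ + α₂ + s * γ)
      (Point.some x₁ y₁ h₁ + Point.some x₂ y₂ h₂) := by
  have ha₁ := H.a₁.mem
  have ha₂ := H.a₂.mem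
  have ha₃ := H.a₃.mem
  have ha₄ := H.a₄.mem
  have ha₆ := H.a₆.mem
  have hsB := hs.mem
  have hunit : ∀ u ∈ B, (1 + s * u ≠ 0) ∧ (1 + s * u)⁻¹ ∈ B := fun u hu => by
    have : ReducesTo π (1 + s * u) 1 :=
      (ReducesTo.one.add (hs.mul (.of_mem π hu))).congr rfl (by simp)
    exact ⟨this.ne_zero one_ne_zero, (this.inv one_ne_zero).mem⟩
  have two : (2 : F) ∈ B := natCast_mem B 2
  have three : (3 : F) ∈ B := natCast_mem B 3
  have c₁ := equation_at_infty h₁.1 hz₁ hw₁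
  have c₂ := equation_at_infty h₂.1 hz₂ hw₂
  have hs0 : s ≠ 0 := by rintro rfl; simp at hw₁
  obtain ⟨ℓ, hℓ⟩ : ∃ ℓ, ℓ = W.slope x₁ x₂ y₁ y₂ := ⟨_, rfl⟩
  obtain ⟨μ, hμ⟩ : ∃ μ, μ = y₁ - ℓ * x₁ := ⟨_, rfl⟩
  obtain ⟨x₃, hx₃⟩ : ∃ x₃, x₃ = W.addX x₁ x₂ ℓ := ⟨_, rfl⟩
  obtain ⟨y₃, hy₃⟩ : ∃ y₃, y₃ = ℓ * x₃ + μ := ⟨_, rfl⟩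
  obtain ⟨v₁, v₂, v₃⟩ := vieta_slope h₁.1 h₂.1 h hℓ hμ hx₃
  have hsub := slope_mul_sub h₁.1 h₂.1 h
  have hsubY := slope_mul_sub_negY h₁.1 h₂.1 h
  rw [← hℓ] at hsub hsubY
  have hy₁ : y₁ = ℓ * x₁ + μ := by rw [hμ]; ring
  have hy₂ : y₂ = ℓ * x₂ + μ := by linear_combination hy₁ + hsub
  -- the slope of the line in the coordinates `z, w` is `V / U = s ^ 2 * V' / (1 + s * U')`
  obtain ⟨U', hU', hU'e⟩ : ∃ U' ∈ B, U' = W.a₁ * α₁ + W.a₃ * s ^ 2 * (β₁ + β₂)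
      - W.a₂ * s * α₁ ^ 2 - W.a₄ * s ^ 3 * α₁ * (β₁ + β₂)
      - W.a₆ * s ^ 5 * (β₁ ^ 2 + β₁ * β₂ + β₂ ^ 2) := by
    refine ⟨_, ?_, rfl⟩
    repeat' first | assumption | apply sub_mem | apply add_mem | apply mul_mem | apply pow_mem
  obtain ⟨V', hV', hV'e⟩ : ∃ V' ∈ B, V' = α₁ ^ 2 + α₁ * α₂ + α₂ ^ 2
      + W.a₂ * s ^ 2 * β₂ * (α₁ + α₂) + W.a₄ * s ^ 4 * β₂ ^ 2 - W.a₁ * s * β₂ := by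
    refine ⟨_, ?_, rfl⟩
    repeat' first | assumption | apply sub_mem | apply add_mem | apply mul_mem | apply pow_mem
  obtain ⟨hU0, hUinv⟩ := hunit U' hU'
  have hUV : (s ^ 3 * β₁ - s ^ 3 * β₂) * (1 + s * U') = (s * α₁ - s * α₂) * (s ^ 2 * V') := by
    rw [hU'e, hV'e]
    linear_combination c₁ - c₂
  have hline₁ : ℓ * (s * α₁) + μ * (s ^ 3 * β₁) = 1 := by
    linear_combination hw₁ - ℓ * hz₁ - (s ^ 3 * β₁) * hy₁
  have hline₂ : ℓ * (s * α₂) + μ * (s ^ 3 * β₂) = 1 := by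
    linear_combination hw₂ - ℓ * hz₂ - (s ^ 3 * β₂) * hy₂
  have hℓμ : ℓ * (1 + s * U') + μ * (s ^ 2 * V') = 0 := by
    by_cases hz : s * α₁ = s * α₂
    · have hw : s ^ 3 * β₁ = s ^ 3 * β₂ := by
        rw [hz, sub_self, zero_mul] at hUV
        exact sub_eq_zero.1 ((mul_eq_zero.1 hUV).resolve_right hU0)
      have hα : α₁ = α₂ := mul_left_cancel₀ hs0 hz
      have hβ : β₁ = β₂ := mul_left_cancel₀ (pow_ne_zero 3 hs0) hw
      subst hα hβ
      have hw0 : s ^ 3 * β₁ ≠ 0 := right_ne_zero_of_mul_eq_one hw₁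
      have hyy : y₁ = y₂ := mul_right_cancel₀ hw0 (hw₁.trans hw₂.symm)
      have hxx : x₁ = x₂ := mul_right_cancel₀ hw0 (hz₁.trans hz₂.symm)
      subst hyy hxx
      rw [Affine.negY] at hsubY
      -- tangent line: rewrite the affine tangent slope in terms of `z, w`
      have t : ℓ * (s ^ 3 * β₁) * (2 + W.a₁ * (s * α₁) + W.a₃ * (s ^ 3 * β₁)) =
          3 * (s * α₁) ^ 2 + 2 * W.a₂ * (s * α₁) * (s ^ 3 * β₁) + W.a₄ * (s ^ 3 * β₁) ^ 2
            - W.a₁ * (s ^ 3 * β₁) := by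
        rw [← hz₁]
        generalize s ^ 3 * β₁ = w at *
        linear_combination w ^ 2 * hsubY + (-2 * ℓ * w - W.a₁ * w) * hw₁
      have hfin : (s ^ 3 * β₁) * (ℓ * (1 + s * U') + μ * (s ^ 2 * V')) = 0 := by
        have hμw : μ * (s ^ 3 * β₁) = 1 - ℓ * (s * α₁) := by linear_combination hline₁
        rw [hU'e, hV'e]
        linear_combination (3 * (s * α₁) ^ 2 + 2 * W.a₂ * (s * α₁) * (s ^ 3 * β₁)
          + W.a₄ * (s ^ 3 * β₁) ^ 2 - W.a₁ * (s ^ 3 * β₁)) * hμw - t + 3 * ℓ * c₁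
      exact (mul_eq_zero.1 hfin).resolve_left hw0
    · apply (mul_eq_zero.1 (?_ : (s * α₁ - s * α₂) * _ = 0)).resolve_left (sub_ne_zero.2 hz)
      linear_combination (1 + s * U') * (hline₁ - hline₂) - μ * hUV
  -- `w = λ z + ν` with `λ = s ^ 2 * lam` and `ν = s ^ 3 * ν'`
  obtain ⟨lam, hlam, hlame⟩ : ∃ lam ∈ B, lam * (1 + s * U') = V' :=
    ⟨V' * (1 + s * U')⁻¹, mul_mem hV' hUinv, inv_mul_cancel_right₀ hU0 _⟩
  obtain ⟨ν, hν, hνe⟩ : ∃ ν ∈ B, ν = β₁ - lam * α₁ := ⟨_, sub_mem hβ₁ (mul_mem hlam hα₁), rfl⟩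
  have hℓe : ℓ = -μ * (s ^ 2 * lam) := by
    apply mul_right_cancel₀ hU0
    linear_combination hℓμ + μ * s ^ 2 * hlame
  have hμν : μ * (s ^ 3 * ν) = 1 := by
    rw [hνe]
    linear_combination hline₁ - s * α₁ * hℓe
  have hμ0 : μ ≠ 0 := left_ne_zero_of_mul_eq_one hμν
  obtain ⟨C, hC, hCe⟩ : ∃ C ∈ B, C = W.a₂ * s * lam + W.a₄ * s ^ 3 * lam ^ 2
      + W.a₆ * s ^ 5 * lam ^ 3 := by
    refine ⟨_, ?_, rfl⟩
    repeat' first | assumption | apply sub_mem | apply add_mem | apply mul_mem | apply pow_mem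
  obtain ⟨D, hD, hDe⟩ : ∃ D ∈ B, D = W.a₂ * s * ν + 2 * W.a₄ * s ^ 3 * lam * ν
      + 3 * W.a₆ * s ^ 5 * lam ^ 2 * ν - W.a₁ * lam - W.a₃ * s ^ 2 * lam ^ 2 := by
    refine ⟨_, ?_, rfl⟩
    repeat' first | assumption | apply sub_mem | apply add_mem | apply mul_mem | apply pow_mem
  obtain ⟨hC0, hCinv⟩ := hunit C hC
  have p₁ : y₁ * y₂ * y₃ = μ ^ 3 * (1 + s * C) := by
    have : y₁ * y₂ * y₃ = ℓ ^ 3 * (x₁ * x₂ * x₃) + ℓ ^ 2 * μ * (x₁ * x₂ + x₁ * x₃ + x₂ * x₃)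
        + ℓ * μ ^ 2 * (x₁ + x₂ + x₃) + μ ^ 3 := by
      rw [hy₁, hy₂, hy₃]; ring
    rw [this, v₁, v₂, v₃, hCe, hℓe]
    ring
  have p₂ : x₁ * y₂ * y₃ + y₁ * x₂ * y₃ + y₁ * y₂ * x₃ = -μ ^ 3 * (s ^ 2 * D) := by
    have : x₁ * y₂ * y₃ + y₁ * x₂ * y₃ + y₁ * y₂ * x₃ = 3 * ℓ ^ 2 * (x₁ * x₂ * x₃)
        + 2 * ℓ * μ * (x₁ * x₂ + x₁ * x₃ + x₂ * x₃) + μ ^ 2 * (x₁ + x₂ + x₃) := by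
      rw [hy₁, hy₂, hy₃]; ring
    rw [this, v₁, v₂, v₃, hDe, hℓe]
    linear_combination (2 * μ ^ 2 * s ^ 2 * lam * W.a₄
      + 3 * W.a₆ * μ ^ 2 * s ^ 4 * lam ^ 2 + μ ^ 2 * W.a₂) * hμν
  obtain ⟨α₃, hα₃, hα₃e⟩ : ∃ α₃ ∈ B, α₃ = -(s * D * (1 + s * C)⁻¹) - α₁ - α₂ :=
    ⟨_, sub_mem (sub_mem (neg_mem (mul_mem (mul_mem hsB hD) hCinv)) hα₁) hα₂, rfl⟩
  obtain ⟨β₃, hβ₃, hβ₃e⟩ : ∃ β₃ ∈ B, β₃ = lam * α₃ + ν :=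
    ⟨_, add_mem (mul_mem hlam hα₃) hν, rfl⟩
  have q₁ : y₃ = μ ^ 3 * (1 + s * C) * (s ^ 3 * β₁) * (s ^ 3 * β₂) := by
    rw [← p₁]
    linear_combination -(y₃ * y₂ * (s ^ 3 * β₂)) * hw₁ - y₃ * hw₂
  have q₂ : x₃ = y₃ * (s * α₃) := by
    have : s * α₁ * y₃ + s * α₂ * y₃ + x₃ =
        -μ ^ 3 * (s ^ 2 * D) * (s ^ 3 * β₁) * (s ^ 3 * β₂) := by
      rw [← p₂]
      linear_combination -(y₂ * (s ^ 3 * β₂) * y₃) * hz₁ - s * α₁ * y₃ * hw₂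
        - (y₁ * (s ^ 3 * β₁) * y₃) * hz₂ - s * α₂ * y₃ * hw₁
        - (x₃ * y₂ * (s ^ 3 * β₂)) * hw₁ - x₃ * hw₂
    have hC' : (1 + s * C) * (1 + s * C)⁻¹ = 1 := mul_inv_cancel₀ hC0
    rw [hα₃e]
    linear_combination this + s ^ 2 * D * (1 + s * C)⁻¹ * q₁
      + μ ^ 3 * (s ^ 2 * D) * (s ^ 3 * β₁) * (s ^ 3 * β₂) * hC'
  have q₃ : y₃ * (s ^ 3 * β₃) = 1 := by
    rw [hβ₃e]
    linear_combination (s ^ 3 * ν) * hy₃ + hμν + s ^ 3 * ν * x₃ * hℓe - s ^ 2 * lam * x₃ * hμν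
      - s ^ 2 * lam * q₂
  have q₄ : x₃ * (s ^ 3 * β₃) = s * α₃ := by
    rw [q₂]; linear_combination (s * α₃) * q₃
  -- pass to the opposite point
  obtain ⟨G, hG, hGe⟩ : ∃ G ∈ B, G = W.a₁ * α₃ + W.a₃ * s ^ 2 * β₃ := by
    refine ⟨_, ?_, rfl⟩
    repeat' first | assumption | apply sub_mem | apply add_mem | apply mul_mem | apply pow_mem
  obtain ⟨hG0, hGinv⟩ := hunit G hG
  have hG' : (1 + s * G) * (1 + s * G)⁻¹ = 1 := mul_inv_cancel₀ hG0
  refine ⟨D * (1 + s * C)⁻¹ + α₃ * G * (1 + s * G)⁻¹,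
    add_mem (mul_mem hD hCinv) (mul_mem (mul_mem hα₃ hG) hGinv), ?_⟩
  have hα : α₁ + α₂ + s * (D * (1 + s * C)⁻¹ + α₃ * G * (1 + s * G)⁻¹) =
      -(α₃ * (1 + s * G)⁻¹) := by
    linear_combination hα₃e + α₃ * hG'
  rw [Point.add_some h, hα]
  have hX : W.addX x₁ x₂ (W.slope x₁ x₂ y₁ y₂) = x₃ := by rw [hx₃, hℓ]
  have hY : W.addY x₁ x₂ y₁ (W.slope x₁ x₂ y₁ y₂) = -y₃ - W.a₁ * x₃ - W.a₃ := by
    rw [Affine.addY, negAddY, hX, Affine.negY, ← hℓ, hy₃, hμ]; ring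
  refine .some (β := -(β₃ * (1 + s * G)⁻¹)) _ (neg_mem (mul_mem hα₃ hGinv))
    (neg_mem (mul_mem hβ₃ hGinv)) ?_ ?_
  · rw [hX]; linear_combination -(1 + s * G)⁻¹ * q₄
  · rw [hY]
    linear_combination (1 + s * G)⁻¹ * q₃ + W.a₁ * (1 + s * G)⁻¹ * q₄ + hG'
      - s * (1 + s * G)⁻¹ * hGe

/-- A point with non-integral abscissa is `InFormal` for the scale `s = x / y` of its own parameter. -/
theorem exists_inFormal (H : CurveReducesTo π W W') {x y : F} (h : W.Nonsingular x y)
    (hx : x ∉ B) : ∃ s, s ≠ 0 ∧ ReducesTo π s 0 ∧ InFormal B W s 1 (.some x y h) := by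
  have hu : ReducesTo π x⁻¹ 0 := .inv_of_notMem hx
  have hx0 : x ≠ 0 := by rintro rfl; exact hx B.zero_mem
  have ht : y / x ∉ B := by
    intro ht
    have ht := ReducesTo.of_mem π ht
    have e := (equation_iff x y).1 h.1
    have e' : x⁻¹ * ((y / x) ^ 2 + W.a₁ * (y / x) + W.a₃ * (y / x) * x⁻¹) =
        1 + W.a₂ * x⁻¹ + W.a₄ * x⁻¹ ^ 2 + W.a₆ * x⁻¹ ^ 3 := by
      field_simp
      linear_combination e
    have := (hu.mul (((ht.pow 2).add (H.a₁.mul ht)).add ((H.a₃.mul ht).mul hu))).unique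
      (((((ReducesTo.one.add (H.a₂.mul hu)).add (H.a₄.mul (hu.pow 2)))).add
        (H.a₆.mul (hu.pow 3))).congr e'.symm rfl)
    simp at this
  have hy0 : y ≠ 0 := by rintro rfl; simp [B.zero_mem] at ht
  have hz : ReducesTo π (x / y) 0 := by simpa using ReducesTo.inv_of_notMem (π := π) ht
  have hw : ReducesTo π y⁻¹ 0 := (hz.mul hu).congr (by field_simp) (by simp)
  have hc := equation_at_infty h.1 (z := x / y) (w := y⁻¹) (div_eq_mul_inv _ _).symm
    (mul_inv_cancel₀ hy0)
  have hU : ReducesTo π (1 + W.a₁ * (x / y) + W.a₃ * y⁻¹ - W.a₂ * (x / y) ^ 2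
      - W.a₄ * (x / y) * y⁻¹ - W.a₆ * y⁻¹ ^ 2) 1 :=
    (((((ReducesTo.one.add (H.a₁.mul hz)).add (H.a₃.mul hw)).sub (H.a₂.mul (hz.pow 2))).sub
      ((H.a₄.mul hz).mul hw)).sub (H.a₆.mul (hw.pow 2))).congr rfl (by simp)
  have hU0 := hU.ne_zero one_ne_zero
  have hUm := (hU.inv one_ne_zero).mem
  generalize hUe : (1 + W.a₁ * (x / y) + W.a₃ * y⁻¹ - W.a₂ * (x / y) ^ 2
      - W.a₄ * (x / y) * y⁻¹ - W.a₆ * y⁻¹ ^ 2) = U at *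
  have hw' : (x / y) ^ 3 * U⁻¹ = y⁻¹ := by
    rw [mul_inv_eq_iff_eq_mul₀ hU0, ← hUe]
    linear_combination -hc
  refine ⟨x / y, div_ne_zero hx0 hy0, hz, .some h B.one_mem hUm ?_ ?_⟩
  · rw [hw', mul_one, div_eq_mul_inv]
  · rw [hw', mul_inv_cancel₀ hy0]

end CurveReducesTo

namespace InFormal

/-- Passage to a coarser scale. -/
theorem mono {s t c α : F} {P : W.Point} (h : InFormal B W s α P) (hc : c ∈ B) (hs : s = t * c) :
    InFormal B W t (c * α) P := by
  cases h with
  | zero => simpa using InFormal.zero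
  | @some x y _ β h hα hβ hz hw =>
    subst hs
    refine .some (β := c ^ 3 * β) h (mul_mem hc hα) (mul_mem (pow_mem hc 3) hβ) ?_ ?_
    · linear_combination hz
    · linear_combination hw

theorem pointReducesTo_zero (H : CurveReducesTo π W W') {s α : F} {P : W.Point}
    (h : InFormal B W s α P) (hs : ReducesTo π s 0) :
    PointReducesTo π P (0 : W'.Point) := by
  cases h with
  | zero => exact .zero
  | @some x y _ β h hα hβ hz hw =>
    refine .infty h fun hx => ?_
    have hy := ReducesTo.of_mem π (H.mem_of_equation h.1 hx)
    have := ((hy.mul ((hs.pow 3).mul (.of_mem π hβ))).congr hw rfl).unique ReducesTo.one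
    simp at this

variable [IsLocalHom π]

theorem add (H : CurveReducesTo π W W') {s : F} (hs : ReducesTo π s 0) {α₁ α₂ : F}
    {P Q : W.Point} (hP : InFormal B W s α₁ P) (hQ : InFormal B W s α₂ Q) :
    ∃ γ ∈ B, InFormal B W s (α₁ + α₂ + s * γ) (P + Q) := by
  cases hP with
  | zero => exact ⟨0, B.zero_mem, by simpa using hQ⟩
  | @some x₁ y₁ _ β₁ h₁ hα₁ hβ₁ hz₁ hw₁ =>
    cases hQ with
    | zero => exact ⟨0, B.zero_mem, by simpa using InFormal.some h₁ hα₁ hβ₁ hz₁ hw₁⟩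
    | @some x₂ y₂ _ β₂ h₂ hα₂ hβ₂ hz₂ hw₂ =>
      by_cases h : x₁ = x₂ ∧ y₁ = W.negY x₂ y₂
      · rw [Point.add_of_Y_eq h.1 h.2]
        refine ⟨α₁ * (W.a₁ * α₂ + W.a₃ * s ^ 2 * β₂), mul_mem hα₁ (add_mem
          (mul_mem H.a₁.mem hα₂) (mul_mem (mul_mem H.a₃.mem (pow_mem hs.mem 2)) hβ₂)), ?_⟩
        have hs0 : s ≠ 0 := by rintro rfl; simp at hw₁
        have e : α₁ + α₂ + s * (α₁ * (W.a₁ * α₂ + W.a₃ * s ^ 2 * β₂)) = 0 := by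
          apply mul_left_cancel₀ hs0
          have h2 := h.2
          rw [negY] at h2
          rw [h.1] at hz₁
          linear_combination (-1 - W.a₁ * (s * α₂) - W.a₃ * (s ^ 3 * β₂)) * hz₁ - hz₂
            - (x₂ * (s ^ 3 * β₁) * W.a₁) * hz₂
            + x₂ * (s ^ 3 * β₂) * (s ^ 3 * β₁) * h2 - x₂ * (s ^ 3 * β₂) * hw₁
            - x₂ * (s ^ 3 * β₁) * hw₂
        rw [e]
        exact .zero
      · exact H.formal_add hs h₁ h₂ h hα₁ hβ₁ hz₁ hw₁ hα₂ hβ₂ hz₂ hw₂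

/-- Multiplication by `n` multiplies the parameter by `n` up to terms of higher order. -/
theorem nsmul (H : CurveReducesTo π W W') {s : F} (hs : ReducesTo π s 0) {α : F}
    {P : W.Point} (hP : InFormal B W s α P) (n : ℕ) :
    ∃ γ ∈ B, InFormal B W s (n * α + s * γ) (n • P) := by
  induction n with
  | zero => exact ⟨0, B.zero_mem, by simpa using InFormal.zero⟩
  | succ n ih =>
    obtain ⟨γ, hγ, h⟩ := ih
    obtain ⟨γ', hγ', h'⟩ := h.add H hs hP
    refine ⟨γ + γ', add_mem hγ hγ', ?_⟩
    rw [succ_nsmul]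
    convert h' using 1
    push_cast
    ring

end InFormal

namespace PointReducesTo

variable [IsLocalHom π]

theorem add_zero_zero (H : CurveReducesTo π W W') {P Q : W.Point}
    (hP : PointReducesTo π P (0 : W'.Point)) (hQ : PointReducesTo π Q (0 : W'.Point)) :
    PointReducesTo π (P + Q) (0 : W'.Point) := by
  cases hP with
  | zero => simpa using hQ
  | infty h₁ hx₁ =>
    cases hQ with
    | zero => simpa using PointReducesTo.infty h₁ hx₁
    | infty h₂ hx₂ =>
      obtain ⟨s, hs0, hs, hP⟩ := H.exists_inFormal h₁ hx₁
      obtain ⟨t, ht0, ht, hQ⟩ := H.exists_inFormal h₂ hx₂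
      -- use the coarser of the two parameters
      rcases B.mem_or_inv_mem (s / t) with hc | hc
      · obtain ⟨_, _, h⟩ := (hP.mono hc (by field_simp)).add H ht hQ
        exact h.pointReducesTo_zero H ht
      · rw [inv_div] at hc
        obtain ⟨_, _, h⟩ := hP.add H hs (hQ.mono hc (by field_simp))
        exact h.pointReducesTo_zero H hs

theorem zero_add (H : CurveReducesTo π W W') [W'.IsElliptic] {P Q : W.Point} {Q' : W'.Point}
    (hP : PointReducesTo π P (0 : W'.Point)) (hQ : PointReducesTo π Q Q') :
    PointReducesTo π (P + Q) Q' := by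
  obtain ⟨R', hR⟩ := H.exists_reducesTo (P + Q)
  cases hQ with
  | zero => simpa using hP
  | infty h hx => exact hP.add_zero_zero H (.infty h hx)
  | @some x₂ y₂ x₂' y₂' h₂ h₂' hx₂ hy₂ =>
    -- subtracting `Q` from `P + Q` must land in the kernel, which forces equal reductions
    rcases hPQ : P + Point.some x₂ y₂ h₂ with _ | ⟨x₃, y₃, h₃⟩
    · have : P = -Point.some x₂ y₂ h₂ := eq_neg_of_add_eq_zero_left hPQ
      subst this
      have := hP.unique (PointReducesTo.some h₂ h₂' hx₂ hy₂ |>.neg H)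
      rw [Point.neg_some] at this
      exact absurd this.symm (Point.some_ne_zero _)
    · rw [hPQ] at hR
      have hQn := PointReducesTo.some h₂ h₂' hx₂ hy₂ |>.neg H
      have hPe : Point.some x₃ y₃ h₃ + -Point.some x₂ y₂ h₂ = P := by
        rw [← hPQ, add_neg_cancel_right]
      cases hR with
      | infty _ hx₃ =>
        have : PointReducesTo π (-P + Point.some x₃ y₃ h₃) (0 : W'.Point) := by
          have hn := hP.neg H
          rw [neg_zero] at hn
          exact hn.add_zero_zero H (.infty h₃ hx₃)
        rw [← hPQ, neg_add_cancel_left] at this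
        exact absurd (this.unique (.some h₂ h₂' hx₂ hy₂)).symm (Point.some_ne_zero _)
      | @some _ _ x₃' y₃' _ h₃' hx₃ hy₃ =>
        rw [Point.neg_some] at hPe
        have := add_some H h₃ ((nonsingular_neg x₂ y₂).2 h₂) h₃'
          ((nonsingular_neg x₂' y₂').2 h₂') hx₃ hy₃ hx₂ (H.negY hx₂ hy₂)
        rw [hPe] at this
        have := this.unique hP
        rw [← Point.neg_some h₂', ← sub_eq_add_neg, sub_eq_zero] at this
        rw [← this]
        exact .some h₃ h₃' hx₃ hy₃

theorem add (H : CurveReducesTo π W W') [W'.IsElliptic] {P Q : W.Point} {P' Q' : W'.Point}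
    (hP : PointReducesTo π P P') (hQ : PointReducesTo π Q Q') :
    PointReducesTo π (P + Q) (P' + Q') := by
  cases hP with
  | zero => simpa using hQ
  | infty h hx => simpa using zero_add H (.infty h hx) hQ
  | some h₁ h₁' hx₁ hy₁ =>
    cases hQ with
    | zero => simpa using PointReducesTo.some h₁ h₁' hx₁ hy₁
    | infty h hx =>
      rw [add_comm]
      simpa using zero_add H (.infty h hx) (.some h₁ h₁' hx₁ hy₁)
    | some h₂ h₂' hx₂ hy₂ => exact add_some H h₁ h₂ h₁' h₂' hx₁ hy₁ hx₂ hy₂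

end PointReducesTo

/-- The reduction homomorphism of a Weierstrass curve with good reduction at a place. -/
noncomputable def CurveReducesTo.redHom [IsLocalHom π] [W'.IsElliptic] (H : CurveReducesTo π W W') :
    W.Point →+ W'.Point where
  toFun P := (H.exists_reducesTo P).choose
  map_zero' := (H.exists_reducesTo 0).choose_spec.unique .zero
  map_add' P Q := (H.exists_reducesTo (P + Q)).choose_spec.unique
    ((H.exists_reducesTo P).choose_spec.add H (H.exists_reducesTo Q).choose_spec)

theorem CurveReducesTo.redHom_spec [IsLocalHom π] [W'.IsElliptic] (H : CurveReducesTo π W W')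
    (P : W.Point) : PointReducesTo π P (H.redHom P) :=
  (H.exists_reducesTo P).choose_spec

/-- The kernel of reduction has no `n`-torsion when `n` is a unit at the place. -/
theorem CurveReducesTo.eq_zero_of_redHom_eq_zero [IsLocalHom π] [W'.IsElliptic]
    (H : CurveReducesTo π W W') {n : ℕ} (hn : (n : κ) ≠ 0) {P : W.Point}
    (hP : H.redHom P = 0) (hnP : n • P = 0) : P = 0 := by
  have hr := H.redHom_spec P
  rw [hP] at hr
  cases hr with
  | zero => rfl
  | infty h hx =>
    obtain ⟨s, hs0, hs, hI⟩ := H.exists_inFormal h hx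
    obtain ⟨γ, hγ, hn'⟩ := hI.nsmul H hs n
    rw [hnP] at hn'
    have h1 : ReducesTo π ((n : F) * 1 + s * γ) n :=
      (((ReducesTo.natCast n).mul .one).add (hs.mul (.of_mem π hγ))).congr rfl (by simp)
    refine absurd ?_ (h1.ne_zero hn)
    generalize (n : F) * 1 + s * γ = α at hn'
    clear h1 hnP hI
    generalize hQ : (0 : W.Point) = Q at hn'
    cases hn' with
    | zero => rfl
    | some h => exact absurd hQ.symm (Point.some_ne_zero h)

end FormalGroup

/-! ### Homomorphisms induced by field embeddings and changes of variables -/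

section PointMap

open WeierstrassCurve WeierstrassCurve.Affine

variable {F K : Type*} [Field F] [Field K]

/-- The homomorphism `W(F) → W'(K)` induced by a field embedding `φ : F → K` that carries the
coefficients of `W` to those of `W'`. -/
def pointMap (φ : F →+* K) {W : Affine F} {W' : Affine K} (h : W.map φ = W') :
    W.Point →+ W'.Point where
  toFun P := match P with
    | .zero => 0
    | .some _ _ hP => .some _ _ (by rw [← h]; exact (map_nonsingular W φ.injective _ _).2 hP)
  map_zero' := rfl
  map_add' := by
    subst h
    rintro (_ | ⟨x₁, y₁, h₁⟩) (_ | ⟨x₂, y₂, h₂⟩)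
    any_goals rfl
    by_cases hxy : x₁ = x₂ ∧ y₁ = W.negY x₂ y₂
    · rw [Point.add_of_Y_eq hxy.left hxy.right,
        Point.add_of_Y_eq (congr_arg _ hxy.left) <| by rw [hxy.right, map_negY]]
    · simpa only [Point.add_some hxy, ← map_addX, ← map_addY, ← map_slope] using!
        (Point.add_some fun h ↦ hxy ⟨φ.injective h.1, φ.injective (map_negY (W' := W) φ .. ▸ h).2⟩).symm

@[simp]
theorem pointMap_some (φ : F →+* K) {W : Affine F} {W' : Affine K} (h : W.map φ = W') {x y : F}
    (hP : W.Nonsingular x y) : pointMap φ h (.some x y hP) =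
      .some (φ x) (φ y) (by rw [← h]; exact (map_nonsingular W φ.injective _ _).2 hP) := rfl

theorem pointMap_injective (φ : F →+* K) {W : Affine F} {W' : Affine K} (h : W.map φ = W') :
    Function.Injective (pointMap φ h) := by
  rintro (_ | _) (_ | _) e
  any_goals contradiction
  · rfl
  · simpa only [Point.some.injEq] using ⟨φ.injective (Point.some.inj e).1,
      φ.injective (Point.some.inj e).2⟩

/-- The homomorphism from the points of `W` to those of the isomorphic curve `C • W`. -/
def variableChangePoint (C : VariableChange F) (W : WeierstrassCurve F) [W.IsElliptic] :
    W.toAffine.Point →+ (C • W).toAffine.Point where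
  toFun P := match P with
    | .zero => 0
    | .some x y hP => .some ((C.u⁻¹ : Fˣ) ^ 2 * (x - C.r))
        ((C.u⁻¹ : Fˣ) ^ 3 * (y - C.s * (x - C.r) - C.t)) (by
        rw [← equation_iff_nonsingular, equation_iff]
        have e := (equation_iff _ _).1 hP.1
        simp only [variableChange_a₁, variableChange_a₂, variableChange_a₃, variableChange_a₄,
          variableChange_a₆]
        linear_combination ((C.u⁻¹ : Fˣ) : F) ^ 6 * e)
  map_zero' := rfl
  map_add' := by
    have hu : ((C.u⁻¹ : Fˣ) : F) ≠ 0 := Units.ne_zero _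
    rintro (_ | ⟨x₁, y₁, h₁⟩) (_ | ⟨x₂, y₂, h₂⟩)
    any_goals rfl
    have hnegY : (C • W).toAffine.negY ((C.u⁻¹ : Fˣ) ^ 2 * (x₂ - C.r))
        ((C.u⁻¹ : Fˣ) ^ 3 * (y₂ - C.s * (x₂ - C.r) - C.t)) =
        (C.u⁻¹ : Fˣ) ^ 3 * (W.toAffine.negY x₂ y₂ - C.s * (x₂ - C.r) - C.t) := by
      simp only [negY, variableChange_a₁, variableChange_a₃]
      ring
    by_cases hxy : x₁ = x₂ ∧ y₁ = W.toAffine.negY x₂ y₂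
    · have e := Point.add_of_Y_eq (h₁ := h₁) (h₂ := h₂) hxy.1 hxy.2
      rw [e]
      refine (Point.add_of_Y_eq ?_ ?_).symm
      · rw [hxy.1]
      · rw [hnegY, hxy.1, hxy.2]
    · have hx : x₁ ≠ x₂ → (C.u⁻¹ : Fˣ) ^ 2 * (x₁ - C.r) ≠ (C.u⁻¹ : Fˣ) ^ 2 * (x₂ - C.r) :=
        fun hx e => hx (sub_left_injective (mul_left_cancel₀ (pow_ne_zero 2 hu) e))
      have hxy' : ¬((C.u⁻¹ : Fˣ) ^ 2 * (x₁ - C.r) = (C.u⁻¹ : Fˣ) ^ 2 * (x₂ - C.r) ∧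
          (C.u⁻¹ : Fˣ) ^ 3 * (y₁ - C.s * (x₁ - C.r) - C.t) = (C • W).toAffine.negY
            ((C.u⁻¹ : Fˣ) ^ 2 * (x₂ - C.r))
            ((C.u⁻¹ : Fˣ) ^ 3 * (y₂ - C.s * (x₂ - C.r) - C.t))) := by
        rintro ⟨e₁, e₂⟩
        rw [hnegY] at e₂
        have hx : x₁ = x₂ := by_contra fun h => hx h e₁
        subst hx
        exact hxy ⟨rfl, sub_left_injective (sub_left_injective
          (mul_left_cancel₀ (pow_ne_zero 3 hu) e₂))⟩
      have hs : (C • W).toAffine.slope ((C.u⁻¹ : Fˣ) ^ 2 * (x₁ - C.r))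
          ((C.u⁻¹ : Fˣ) ^ 2 * (x₂ - C.r)) ((C.u⁻¹ : Fˣ) ^ 3 * (y₁ - C.s * (x₁ - C.r) - C.t))
          ((C.u⁻¹ : Fˣ) ^ 3 * (y₂ - C.s * (x₂ - C.r) - C.t)) =
          (C.u⁻¹ : Fˣ) * (W.toAffine.slope x₁ x₂ y₁ y₂ - C.s) := by
        by_cases hx' : x₁ = x₂
        · subst hx'
          have hy : y₁ ≠ W.toAffine.negY x₁ y₂ := fun e => hxy ⟨rfl, e⟩
          have hy' : (C.u⁻¹ : Fˣ) ^ 3 * (y₁ - C.s * (x₁ - C.r) - C.t) ≠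
              (C • W).toAffine.negY ((C.u⁻¹ : Fˣ) ^ 2 * (x₁ - C.r))
                ((C.u⁻¹ : Fˣ) ^ 3 * (y₂ - C.s * (x₁ - C.r) - C.t)) := fun e => hxy' ⟨rfl, e⟩
          have hyy := Y_eq_of_Y_ne h₁.1 h₂.1 rfl hy
          subst hyy
          rw [slope_of_Y_ne rfl hy, slope_of_Y_ne rfl hy', div_eq_iff (sub_ne_zero.2 hy'), hnegY]
          have hd : y₁ - W.toAffine.negY x₁ y₁ ≠ 0 := sub_ne_zero.2 hy
          simp only [variableChange_a₁, variableChange_a₂, variableChange_a₄]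
          field_simp
          rw [negY]
          ring
        · rw [slope_of_X_ne hx', slope_of_X_ne (hx hx')]
          have hd := sub_ne_zero.2 hx'
          have hd' := sub_ne_zero.2 (hx hx')
          rw [div_eq_iff hd']
          field_simp
          ring
      have e := Point.add_some (h₁ := h₁) (h₂ := h₂) hxy
      rw [e]
      refine Eq.trans ?_ (Point.add_some hxy').symm
      simp only [Point.some.injEq]
      rw [hs]
      simp only [addX, addY, negAddY, negY, variableChange_a₁, variableChange_a₂,
        variableChange_a₃]
      constructor <;> ring

end PointMap

/-! ### Multiplication by `n` as a rational function of the abscissa -/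

section Division

open WeierstrassCurve WeierstrassCurve.Affine Polynomial

variable {k : Type*} [Field k]

theorem exists_equation [IsAlgClosed k] (W : Affine k) (x : k) : ∃ y, W.Equation x y := by
  obtain ⟨y, hy⟩ := IsAlgClosed.exists_root (X ^ 2 + C (W.a₁ * x + W.a₃) * X
    - C (x ^ 3 + W.a₂ * x ^ 2 + W.a₄ * x + W.a₆)) (by
      have : (X ^ 2 + C (W.a₁ * x + W.a₃) * X
        - C (x ^ 3 + W.a₂ * x ^ 2 + W.a₄ * x + W.a₆)).natDegree = 2 := by compute_degree!
      exact degree_ne_of_natDegree_ne (n := 0) (by rw [this]; exact two_ne_zero))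
  refine ⟨y, (equation_iff _ _).2 ?_⟩
  simp at hy
  linear_combination hy

theorem ReducesTo.of_mem_nonunits {F : Type*} [Field F] {B : ValuationSubring F} {x : F}
    (hx : x ∈ B.nonunits) : ReducesTo (IsLocalRing.residue B) x 0 := by
  have hB : x ∈ B := B.nonunits_subset hx
  exact ⟨hB, (IsLocalRing.residue_eq_zero_iff _).2
    ((ValuationSubring.coe_mem_nonunits_iff (a := ⟨x, hB⟩)).1 hx)⟩

/-- Evaluation of polynomials at `x₀` extends to a place of any field containing `k[X]`. -/
theorem exists_place_extending_eval (F : Type*) [Field F] [Algebra k[X] F] [FaithfulSMul k[X] F]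
    (x₀ : k) : ∃ (B : ValuationSubring F) (φ : k →+* IsLocalRing.ResidueField B),
      ∀ f : k[X], ReducesTo (IsLocalRing.residue B) (algebraMap k[X] F f) (φ (f.eval x₀)) := by
  let A : Subring F := (algebraMap k[X] F).range
  let a : A := ⟨algebraMap k[X] F (X - C x₀), _, rfl⟩
  have hI : Ideal.span {a} ≠ ⊤ := by
    rw [Ne, Ideal.span_singleton_eq_top, isUnit_iff_exists_inv]
    rintro ⟨⟨_, f, rfl⟩, hb⟩
    have hb := congrArg Subtype.val hb
    have h1 : algebraMap k[X] F ((X - C x₀) * f) = algebraMap k[X] F 1 := by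
      rw [map_mul, map_one]; exact hb
    have := congrArg (eval x₀) (FaithfulSMul.algebraMap_injective k[X] F h1)
    simp at this
  obtain ⟨B, hAB, hB⟩ := Ideal.image_subset_nonunits_valuationSubring (Ideal.span {a}) hI
  have hmem : ∀ f : k[X], algebraMap k[X] F f ∈ B := fun f => hAB ⟨f, rfl⟩
  refine ⟨B, (IsLocalRing.residue B).comp
    (((algebraMap k[X] F).comp C).codRestrict B.toSubring fun c => hmem (C c)), fun f => ?_⟩
  have h0 := ReducesTo.of_mem_nonunits (hB ⟨a, Ideal.mem_span_singleton_self a, rfl⟩)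
  have hc : ∀ c : k, ReducesTo (IsLocalRing.residue B) (algebraMap k[X] F (C c))
      ((IsLocalRing.residue B).comp (((algebraMap k[X] F).comp C).codRestrict B.toSubring
        fun c => hmem (C c)) c) := fun c => ⟨hmem _, rfl⟩
  obtain ⟨q, hq⟩ := X_sub_C_dvd_sub_C_eval (a := x₀) (p := f)
  refine ((hc (f.eval x₀)).add (h0.mul (.of_mem _ (hmem q)))).congr ?_ (by simp)
  change algebraMap k[X] F (C (f.eval x₀)) + algebraMap k[X] F (X - C x₀) * algebraMap k[X] F q = _
  rw [← map_mul, ← hq, ← map_add, add_sub_cancel]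

/-- The abscissa of `n • P` lies in the ground field if that of `P` does, because an automorphism
moves `P` to `± P`. -/
theorem mem_range_of_nsmul_eq {k₀ F : Type*} [Field k₀] [Field F] [Algebra k₀ F] [IsGalois k₀ F]
    {WF : Affine F} (hW : ∀ σ : Gal(F/k₀), WF.map (σ : F →+* F) = WF) {t y : F}
    (ht : t ∈ Set.range (algebraMap k₀ F)) (h : WF.Nonsingular t y) {n : ℕ} {ξ υ : F}
    {h' : WF.Nonsingular ξ υ} (hn : n • Point.some t y h = .some ξ υ h') :
    ξ ∈ Set.range (algebraMap k₀ F) := by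
  rw [InfiniteGalois.mem_range_algebraMap_iff_fixed]
  intro σ
  obtain ⟨t, rfl⟩ := ht
  have e := congrArg (pointMap (σ : F →+* F) (hW σ)) hn
  rw [map_nsmul] at e
  have hσ : pointMap (σ : F →+* F) (hW σ) (.some _ y h) = .some _ y h ∨
      pointMap (σ : F →+* F) (hW σ) (.some _ y h) = -.some _ y h :=
    Point.X_eq_iff.1 (σ.commutes t)
  have h'' : WF.Nonsingular (σ ξ) (σ υ) := by
    have := (map_nonsingular WF (σ : F →+* F).injective ξ υ).2 h'
    rw [hW σ] at this
    exact this
  refine (Point.X_eq_iff (h₁ := h'') (h₂ := h')).2 ?_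
  rcases hσ with hσ | hσ <;> rw [hσ] at e
  · left; rw [← hn, e]; rfl
  · right; rw [← hn, ← smul_neg, e]; rfl

/-- The abscissa of `n • P` is a rational function `f / g` of that of `P`, whose poles are points of
the `n`-torsion, unless `n` kills all points. It is found at the generic point, over the algebraic
closure of `k(t)`, and specialised to every other point by reduction. -/
theorem exists_ratFunc_of_nsmul [IsAlgClosed k] [CharZero k] (W : Affine k) [W.IsElliptic] (n : ℕ) :
    (∀ P : W.Point, n • P = 0) ∨ ∃ f g : k[X], IsCoprime f g ∧ g ≠ 0 ∧
      ∀ (x y : k) (h : W.Nonsingular x y),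
        (g.eval x = 0 → n • Point.some x y h = 0) ∧
        (g.eval x ≠ 0 → ∃ (y' : k) (h' : W.Nonsingular (f.eval x / g.eval x) y'),
          n • Point.some x y h = .some _ y' h') := by
  let F := AlgebraicClosure (RatFunc k)
  let WF : Affine F := W.map (algebraMap k F)
  have hWF : WF.IsElliptic := inferInstanceAs (W.map (algebraMap k F)).IsElliptic
  let t : F := algebraMap k[X] F X
  obtain ⟨y, hy⟩ := exists_equation WF t
  have hη : WF.Nonsingular t y := WF.equation_iff_nonsingular.1 hy
  have hC : ∀ c : k, algebraMap k F c = algebraMap k[X] F (C c) := fun c =>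
    IsScalarTower.algebraMap_apply k k[X] F c
  have : FaithfulSMul k[X] F := by
    rw [faithfulSMul_iff_algebraMap_injective, IsScalarTower.algebraMap_eq k[X] (RatFunc k) F]
    exact (algebraMap (RatFunc k) F).injective.comp (RatFunc.algebraMap_injective k)
  -- reduction at a place above `t = x₀` maps the universal point to a given point, up to sign
  have key : ∀ (x₀ y₀ : k) (h₀ : W.Nonsingular x₀ y₀), ∃ (B : ValuationSubring F)
      (φ : k →+* IsLocalRing.ResidueField B), (∀ f : k[X],
        ReducesTo (IsLocalRing.residue B) (algebraMap k[X] F f) (φ (f.eval x₀))) ∧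
      ∃ ε : ℤ, PointReducesTo (IsLocalRing.residue B) (n • Point.some t y hη)
        (pointMap φ rfl (ε • n • Point.some x₀ y₀ h₀)) ∧ (ε = 1 ∨ ε = -1) := by
    intro x₀ y₀ h₀
    obtain ⟨B, φ, hφ⟩ := exists_place_extending_eval F x₀
    have hW' : (W.map φ).IsElliptic := inferInstance
    have hc : ∀ c : k, ReducesTo (IsLocalRing.residue B) (algebraMap k F c) (φ c) := fun c =>
      (hφ (C c)).congr (hC c).symm (by simp)
    have H : CurveReducesTo (IsLocalRing.residue B) WF (W.map φ) :=
      ⟨hc _, hc _, hc _, hc _, hc _⟩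
    refine ⟨B, φ, hφ, ?_⟩
    have hr := H.redHom_spec (.some t y hη)
    have : H.redHom (.some t y hη) = pointMap φ rfl (.some x₀ y₀ h₀) ∨
        H.redHom (.some t y hη) = -pointMap φ rfl (.some x₀ y₀ h₀) := by
      generalize H.redHom (.some t y hη) = Q at hr
      cases hr with
      | infty _ hx => exact absurd (hφ X).mem hx
      | some _ h' hx hy' =>
        refine Point.X_eq_iff.1 ?_
        rw [hx.unique (hφ X), eval_X]
    have hn := H.redHom_spec (n • .some t y hη)
    rw [map_nsmul] at hn
    rcases this with e | e
    · refine ⟨1, ?_, .inl rfl⟩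
      rw [e, ← map_nsmul] at hn
      simpa using hn
    · refine ⟨-1, ?_, .inr rfl⟩
      rw [e, smul_neg, ← map_nsmul, ← map_neg] at hn
      simpa using hn
  have hε : ∀ {ε : ℤ} {P : W.Point}, (ε = 1 ∨ ε = -1) → ε • P = 0 → P = 0 := by
    rintro ε P (rfl | rfl) h <;> simpa using h
  rcases hnη : n • Point.some t y hη with _ | ⟨ξ, υ, hξ⟩
  · left
    rintro (_ | ⟨x₀, y₀, h₀⟩)
    · exact smul_zero n
    obtain ⟨B, φ, hφ, ε, hP, he⟩ := key x₀ y₀ h₀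
    rw [hnη] at hP
    refine hε he (pointMap_injective φ rfl ?_)
    rw [map_zero]
    exact hP.unique .zero
  · right
    obtain ⟨r, hr⟩ : ξ ∈ Set.range (algebraMap (RatFunc k) F) := by
      refine mem_range_of_nsmul_eq (fun σ => ?_) ⟨RatFunc.X, ?_⟩ hη hnη
      · change (W.map _).map _ = W.map _
        refine (WeierstrassCurve.map_map _ _ _).trans (congrArg W.map ?_)
        ext c
        exact σ.commutes (algebraMap k (RatFunc k) c)
      · rw [← RatFunc.algebraMap_X]
        exact (IsScalarTower.algebraMap_apply k[X] (RatFunc k) F X).symm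
    have hξr : ξ = algebraMap k[X] F r.num / algebraMap k[X] F r.denom := by
      rw [← hr, ← RatFunc.num_div_denom r, map_div₀, RatFunc.num_div_denom,
        IsScalarTower.algebraMap_apply k[X] (RatFunc k) F,
        IsScalarTower.algebraMap_apply k[X] (RatFunc k) F]
    refine ⟨r.num, r.denom, r.isCoprime_num_denom, r.denom_ne_zero, fun x₀ y₀ h₀ => ?_⟩
    obtain ⟨B, φ, hφ, ε, hP, he⟩ := key x₀ y₀ h₀
    rw [hnη] at hP
    have hnum := hφ r.num
    have hden := hφ r.denom
    constructor
    · intro h0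
      rw [h0, map_zero] at hden
      have hf : r.num.eval x₀ ≠ 0 := by
        intro hf
        obtain ⟨a, b, hab⟩ := r.isCoprime_num_denom
        have := congrArg (eval x₀) hab
        simp [h0, hf] at this
      have hinv := hden.div hnum ((map_ne_zero φ).2 hf)
      rw [← inv_div, ← hξr, zero_div] at hinv
      refine hε he (pointMap_injective φ rfl ?_)
      rw [map_zero]
      refine hP.unique (.infty _ fun hξB => ?_)
      have hξ0 : ξ ≠ 0 := by
        rw [hξr]
        exact div_ne_zero (hnum.ne_zero ((map_ne_zero φ).2 hf)) (by simp [r.denom_ne_zero])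
      have := ((ReducesTo.of_mem _ hξB).mul hinv).unique
        (ReducesTo.one.congr (mul_inv_cancel₀ hξ0).symm rfl)
      simp at this
    · intro h0
      have hx := hnum.div hden ((map_ne_zero φ).2 h0)
      rw [← hξr, ← map_div₀] at hx
      rcases hnP : n • Point.some x₀ y₀ h₀ with _ | ⟨x₁, y₁, h₁⟩
      · rw [hnP] at hP
        change PointReducesTo _ _ (pointMap φ rfl (ε • 0)) at hP
        rw [smul_zero, map_zero] at hP
        cases hP with
        | infty _ hx' => exact absurd hx.mem hx'
      · have hx₁ : x₁ = r.num.eval x₀ / r.denom.eval x₀ := by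
          apply φ.injective
          rw [hnP] at hP
          rcases he with rfl | rfl
          · rw [one_smul, pointMap_some] at hP
            cases hP with
            | some _ _ hx' _ => exact hx'.unique hx
          · rw [neg_smul, one_smul, Point.neg_some, pointMap_some] at hP
            cases hP with
            | some _ _ hx' _ => exact hx'.unique hx
        subst hx₁
        exact ⟨y₁, h₁, rfl⟩

end Division

/-! ### Divisibility and torsion over an algebraically closed field -/

section Torsion

open WeierstrassCurve WeierstrassCurve.Affine Polynomial

variable {k : Type*} [Field k] [IsAlgClosed k] [CharZero k]

/-- An elliptic curve over an algebraically closed field has two distinct points of order two. -/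
theorem exists_two_torsion_ne (W : Affine k) [W.IsElliptic] :
    ∃ (x₁ y₁ : k) (h₁ : W.Nonsingular x₁ y₁) (x₂ y₂ : k) (h₂ : W.Nonsingular x₂ y₂), x₁ ≠ x₂ ∧
      2 • Point.some x₁ y₁ h₁ = 0 ∧ 2 • Point.some x₂ y₂ h₂ = 0 := by
  have key : ∀ x : k, 4 * x ^ 3 + W.b₂ * x ^ 2 + 2 * W.b₄ * x + W.b₆ = 0 →
      ∃ (y : k) (h : W.Nonsingular x y), 2 • Point.some x y h = 0 := by
    intro x hx
    have heq : W.Equation x (-(W.a₁ * x + W.a₃) / 2) := by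
      rw [equation_iff]
      simp only [b₂, b₄, b₆] at hx
      linear_combination (-1 / 4 : k) * hx
    refine ⟨_, W.equation_iff_nonsingular.1 heq, ?_⟩
    rw [two_nsmul, Point.add_of_Y_eq rfl]
    rw [negY]
    ring
  have ha : W.twoTorsionPolynomial.a ≠ 0 := by
    change (4 : k) ≠ 0
    norm_num
  obtain ⟨x, y, z, h⟩ := (Cubic.splits_iff_roots_eq_three (φ := RingHom.id k) ha).1
    (IsAlgClosed.splits _)
  have hd := W.twoTorsionPolynomial_discr_ne_zero (isUnit_iff_ne_zero.2 two_ne_zero)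
    W.isUnit_Δ
  have hne := (Cubic.discr_ne_zero_iff_roots_ne (φ := RingHom.id k) ha h).1 hd
  have hroot : ∀ t ∈ (Cubic.map (RingHom.id k) W.twoTorsionPolynomial).roots,
      4 * t ^ 3 + W.b₂ * t ^ 2 + 2 * W.b₄ * t + W.b₆ = 0 := by
    intro t ht
    have := (mem_roots'.1 ht).2
    simpa [Cubic.toPoly, Cubic.map, twoTorsionPolynomial] using this
  obtain ⟨y₁, h₁, e₁⟩ := key x (hroot x (by rw [h]; simp))
  obtain ⟨y₂, h₂, e₂⟩ := key y (hroot y (by rw [h]; simp))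
  exact ⟨x, y₁, h₁, y, y₂, h₂, hne.1, e₁, e₂⟩

theorem nsmul_eq_self_of_two_nsmul {A : Type*} [AddCommGroup A] {a : A} (h : 2 • a = 0) {p : ℕ}
    (hp : Odd p) : p • a = a := by
  obtain ⟨m, rfl⟩ := hp
  rw [add_smul, mul_comm, mul_smul, h, smul_zero, zero_add, one_smul]

/-- Multiplication by an odd `p` is surjective on points. A point `P` can only be missed if `f - c g`
is a nonzero constant for its abscissa `c`, where `f / g` describes multiplication by `p`. This
happens for at most one `c`, as `f` and `g` would otherwise take equal values at
the distinct abscissas of two points `T₁`, `T₂` of order two, where `f (x) = x g (x)`. If `P` is missed, then so are `P + T₁` and `P + T₂`, which would then be equal to `- P`. -/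
theorem exists_nsmul_eq_point (W : Affine k) [W.IsElliptic] {p : ℕ} (hp : Odd p) (P : W.Point) :
    ∃ Q : W.Point, p • Q = P := by
  obtain ⟨x₁, y₁, h₁, x₂, y₂, h₂, hx, e₁, e₂⟩ := exists_two_torsion_ne W
  have hT₁ := nsmul_eq_self_of_two_nsmul e₁ hp
  have hT₂ := nsmul_eq_self_of_two_nsmul e₂ hp
  rcases exists_ratFunc_of_nsmul W p with h | ⟨f, g, hfg, hg, H⟩
  · have := h (.some x₁ y₁ h₁)
    rw [hT₁] at this
    cases this
  have hfx : ∀ {x y : k} {h : W.Nonsingular x y}, p • Point.some x y h = .some x y h →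
      f.eval x = x * g.eval x := by
    intro x y h e
    obtain ⟨H0, H1⟩ := H x y h
    by_cases hgx : g.eval x = 0
    · have := H0 hgx
      rw [e] at this
      cases this
    · obtain ⟨y', h', e'⟩ := H1 hgx
      rw [e] at e'
      rw [Point.some.injEq] at e'
      field_simp at e'
      exact e'.1.symm
  have hgx : ∀ {x y : k} {h : W.Nonsingular x y}, p • Point.some x y h = .some x y h →
      g.eval x ≠ 0 := by
    intro x y h e hgx
    have := (H x y h).1 hgx
    rw [e] at this
    cases this
  -- points whose abscissa is not exceptional are divisible by `p`
  have hdiv : ∀ (c y : k) (h : W.Nonsingular c y), (f - C c * g).degree ≠ 0 →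
      ∃ Q : W.Point, p • Q = .some c y h := by
    intro c y h hc
    obtain ⟨x, hxr⟩ := IsAlgClosed.exists_root _ hc
    have hxr : f.eval x = c * g.eval x := by
      simpa [sub_eq_zero] using hxr
    have hgx0 : g.eval x ≠ 0 := by
      intro h0
      rw [h0, mul_zero] at hxr
      obtain ⟨a, b, hab⟩ := hfg
      have := congrArg (eval x) hab
      simp [h0, hxr] at this
    obtain ⟨y₀, hy₀⟩ := exists_equation W x
    obtain ⟨y', h', e'⟩ := (H x y₀ (W.equation_iff_nonsingular.1 hy₀)).2 hgx0
    have hcx : f.eval x / g.eval x = c := by rw [hxr]; field_simp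
    rcases Point.X_eq_iff (h₁ := h') (h₂ := h) |>.1 hcx with e | e
    · exact ⟨_, e'.trans e⟩
    · exact ⟨-_, by rw [smul_neg, e', e, neg_neg]⟩
  -- there is at most one exceptional abscissa
  have huniq : ∀ c d : k, (f - C c * g).degree = 0 → (f - C d * g).degree = 0 → c = d := by
    intro c d hc hd
    by_contra hcd
    obtain ⟨a, ha⟩ : ∃ a, f - C c * g = C a := ⟨_, eq_C_of_degree_eq_zero hc⟩
    obtain ⟨b, hb⟩ : ∃ b, f - C d * g = C b := ⟨_, eq_C_of_degree_eq_zero hd⟩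
    have E : ∀ x, f.eval x - c * g.eval x = a ∧ f.eval x - d * g.eval x = b := fun x =>
      ⟨by simpa using congrArg (eval x) ha, by simpa using congrArg (eval x) hb⟩
    have hdc : d - c ≠ 0 := sub_ne_zero.2 (Ne.symm hcd)
    have hgg : g.eval x₁ = g.eval x₂ := by
      apply mul_left_cancel₀ hdc
      linear_combination (E x₁).1 - (E x₁).2 - (E x₂).1 + (E x₂).2
    have hff : f.eval x₁ = f.eval x₂ := by
      linear_combination (E x₁).1 - (E x₂).1 + c * hgg
    rw [hfx hT₁, hfx hT₂, ← hgg] at hff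
    exact hx (mul_right_cancel₀ (hgx hT₁) hff)
  by_contra hP
  rcases P with _ | ⟨c, y, h⟩
  · exact hP ⟨0, smul_zero p⟩
  have hc : (f - C c * g).degree = 0 := by
    by_contra hc
    exact hP (hdiv c y h hc)
  have hR : ∀ R : W.Point, p • R = R → R = 0 ∨ R = -(2 • Point.some c y h) := by
    intro R hR
    have hPR : ¬∃ Q, p • Q = Point.some c y h + R := by
      rintro ⟨Q, hQ⟩
      exact hP ⟨Q - R, by rw [smul_sub, hQ, hR, add_sub_cancel_right]⟩
    generalize hS : Point.some c y h + R = S at hPR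
    rcases S with _ | ⟨c', y', h'⟩
    · exact absurd ⟨0, smul_zero p⟩ hPR
    have hc' : (f - C c' * g).degree = 0 := by
      by_contra hc
      exact hPR (hdiv c' y' h' hc)
    rcases Point.X_eq_iff (h₁ := h') (h₂ := h) |>.1 (huniq _ _ hc' hc) with e | e
    · left
      rw [e] at hS
      simpa using hS
    · right
      rw [e, ← eq_sub_iff_add_eq'] at hS
      rw [hS, two_nsmul]
      abel
  rcases hR _ hT₁ with h0 | hR₁
  · cases h0
  rcases hR _ hT₂ with h0 | hR₂
  · cases h0
  rw [← hR₂, Point.some.injEq] at hR₁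
  exact hx hR₁.1

/-- For odd `p`, a point of order two is fixed by multiplication by `p`, which is therefore not zero;
the abscissas of the `p`-torsion are zeros of the denominator in `exists_ratFunc_of_nsmul`. -/
theorem finite_odd_torsion (W : Affine k) [W.IsElliptic] {p : ℕ} (hp : Odd p) :
    {P : W.Point | p • P = 0}.Finite := by
  obtain ⟨x₁, y₁, h₁, -, -, -, -, e₁, -⟩ := exists_two_torsion_ne W
  have hT₁ := nsmul_eq_self_of_two_nsmul e₁ hp
  rcases exists_ratFunc_of_nsmul W p with h | ⟨f, g, -, hg, H⟩
  · have := h (.some x₁ y₁ h₁)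
    rw [hT₁] at this
    cases this
  have hfin : ∀ x : k, {P : W.Point | ∃ (y : k) (h : W.Nonsingular x y), P = .some x y h}.Finite := by
    intro x
    obtain ⟨y₀, hy₀⟩ := exists_equation W x
    refine Set.Finite.subset (Set.toFinite {Point.some x y₀ (W.equation_iff_nonsingular.1 hy₀),
      -Point.some x y₀ (W.equation_iff_nonsingular.1 hy₀)}) ?_
    rintro _ ⟨y, h, rfl⟩
    exact Point.X_eq_iff.1 rfl
  refine ((Set.finite_singleton (0 : W.Point)).union
    (g.roots.toFinset.finite_toSet.biUnion fun x _ => hfin x)).subset ?_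
  rintro (_ | ⟨x, y, h⟩) hP
  · exact Or.inl rfl
  · right
    have hx : g.eval x = 0 := by
      by_contra hx
      obtain ⟨y', h', e⟩ := (H x y h).2 hx
      change p • Point.some x y h = 0 at hP
      rw [e] at hP
      cases hP
    simp only [Set.mem_iUnion]
    exact ⟨x, by simpa [hg] using hx, y, h, rfl⟩

theorem finite_torsion_pow {A : Type*} [AddCommGroup A] {p : ℕ} (h : {a : A | p • a = 0}.Finite)
    (m : ℕ) : {a : A | p ^ m • a = 0}.Finite := by
  induction m with
  | zero => simp
  | succ m ih =>
    have : {a : A | p ^ (m + 1) • a = 0} = (fun a => p • a) ⁻¹' {a : A | p ^ m • a = 0} := by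
      ext a
      simp [pow_succ, mul_smul]
    rw [this]
    refine ih.preimage' fun b _ => ?_
    by_cases hb : ∃ a : A, p • a = b
    · obtain ⟨a, ha⟩ := hb
      refine (h.image fun t => a + t).subset fun t ht => ⟨t - a, ?_, by simp⟩
      simp only [Set.mem_preimage, Set.mem_singleton_iff] at ht
      simp [smul_sub, ht, ha]
    · refine Set.Finite.subset Set.finite_empty fun a ha => hb ⟨a, ha⟩

end Torsion

/-! ### Endomorphisms of torsion groups -/

section FixedVectors

variable {A : Type*} [AddCommGroup A] {p : ℕ}

/-- An endomorphism of order a power of `p` of a group of exponent `p` is unipotent, hence fixes a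
nonzero element of each nonzero stable subgroup. -/
theorem exists_fixed_ne_zero (hp : p.Prime) (hA : ∀ a : A, p • a = 0) (T : AddMonoid.End A)
    {n : ℕ} (hT : T ^ p ^ n = 1) (S : AddSubgroup A) (hS : ∀ a ∈ S, T a ∈ S) {a : A} (ha : a ∈ S)
    (ha0 : a ≠ 0) : ∃ b ∈ S, b ≠ 0 ∧ T b = b := by
  have hnil : ∃ i : ℕ, ((T - 1) ^ i) a = 0 := by
    refine ⟨p ^ n, ?_⟩
    have h := (Commute.one_right (T - 1)).add_pow_prime_pow_eq hp n
    rw [sub_add_cancel, hT, one_pow] at h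
    rw [mul_assoc, mul_assoc] at h
    have h' := DFunLike.congr_fun h a
    -- the mixed binomial terms carry a factor `p`
    generalize (T - 1) * (1 * ∑ k ∈ Finset.Ioo 0 (p ^ n), (T - 1) ^ (k - 1) *
      1 ^ (p ^ n - k - 1) * (((p ^ n).choose k / p : ℕ) : AddMonoid.End A)) = r at h'
    change a = ((T - 1) ^ p ^ n) a + a + p • r a at h'
    rw [hA, add_zero] at h'
    exact (right_eq_add.1 h')
  have hmem : ∀ i : ℕ, ((T - 1) ^ i) a ∈ S := by
    intro i
    induction i with
    | zero => simpa
    | succ i ih =>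
      rw [pow_succ', AddMonoid.End.coe_mul, Function.comp_apply]
      exact S.sub_mem (hS _ ih) ih
  obtain ⟨i, hi⟩ : ∃ i, Nat.find hnil = i + 1 := by
    refine Nat.exists_eq_succ_of_ne_zero fun h0 => ha0 ?_
    have := Nat.find_spec hnil
    rw [h0] at this
    simpa using this
  refine ⟨((T - 1) ^ i) a, hmem i, Nat.find_min hnil (by omega), ?_⟩
  have := Nat.find_spec hnil
  rw [hi, pow_succ', AddMonoid.End.coe_mul, Function.comp_apply] at this
  exact sub_eq_zero.1 this

theorem exists_pow_nsmul_eq (hdiv : ∀ a : A, ∃ b, p • b = a) (s : ℕ) (a : A) :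
    ∃ b, p ^ s • b = a := by
  induction s generalizing a with
  | zero => exact ⟨a, by simp⟩
  | succ s ih =>
    obtain ⟨b, rfl⟩ := hdiv a
    obtain ⟨c, rfl⟩ := ih b
    exact ⟨c, by rw [pow_succ', mul_smul]⟩

/-- A variant of Lang's theorem for torsion points: if an endomorphism `F` has few fixed points on
the `p ^ N`-torsion of a `p`-divisible group, then `F - 1` hits all of the `p`-torsion. The cokernel
of `F - 1` on the `p ^ N`-torsion has as many elements as its kernel, so that it is killed by
`p ^ (N - 1)`. -/
theorem exists_map_sub_eq (hp : p.Prime) (hdiv : ∀ a : A, ∃ b, p • b = a) (F : A →+ A) {S : Set A}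
    (hS : S.Finite) {N : ℕ} (hfin : {a : A | p ^ N • a = 0}.Finite) (hN : S.ncard < p ^ N)
    (hF : ∀ a, p ^ N • a = 0 → F a = a → a ∈ S) {a : A} (ha : p • a = 0) :
    ∃ b, p ^ N • b = 0 ∧ F b - b = a := by
  let G : AddSubgroup A := (nsmulAddMonoidHom (α := A) (p ^ N)).ker
  have hG : ∀ a, a ∈ G ↔ p ^ N • a = 0 := fun a => AddMonoidHom.mem_ker
  have : Finite G := hfin.subset fun a ha => (hG a).1 ha
  let D : G →+ G := ((F - AddMonoidHom.id A).comp G.subtype).codRestrict G fun g => by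
    have := (hG _).1 g.2
    rw [hG, AddMonoidHom.comp_apply, ← map_nsmul]
    change (F - AddMonoidHom.id A) (p ^ N • (g : A)) = 0
    rw [this, map_zero]
  have hD : ∀ g : G, (D g : A) = F g - g := fun g => rfl
  have hker : Nat.card D.ker ≤ S.ncard := by
    rw [← Nat.card_coe_set_eq]
    have : Finite S := hS
    refine Nat.card_le_card_of_injective
      (fun g : D.ker => (⟨g.1.1, hF _ ((hG _).1 g.1.2) ?_⟩ : S)) ?_
    · have := congrArg Subtype.val (AddMonoidHom.mem_ker.1 g.2)
      rw [hD] at this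
      exact sub_eq_zero.1 this
    · intro g g' e
      exact Subtype.ext (Subtype.ext (congrArg (fun x : S => (x : A)) e))
  have hindex : D.range.index = Nat.card D.ker := by
    have h1 := D.ker.card_mul_index
    rw [AddSubgroup.index_ker] at h1
    have h2 := D.range.card_mul_index
    have : 0 < Nat.card D.range := Nat.card_pos
    have : Nat.card D.range * D.range.index = Nat.card D.range * Nat.card D.ker := by
      rw [h2, ← h1, mul_comm]
    exact Nat.eq_of_mul_eq_mul_left ‹_› this
  obtain ⟨s, -, hs⟩ := (Nat.dvd_prime_pow hp).1 (Nat.gcd_dvd_right D.range.index (p ^ N))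
  have hsN : s < N := by
    refine (Nat.pow_lt_pow_iff_right hp.one_lt).1 ?_
    rw [← hs]
    refine lt_of_le_of_lt (Nat.gcd_le_left _ ?_) (hindex.trans_le hker |>.trans_lt hN)
    rw [hindex]
    exact Nat.card_pos
  have hmem : ∀ g : G, p ^ s • g ∈ D.range := by
    intro g
    have h1 : D.range.index • g ∈ D.range := D.range.nsmul_index_mem g
    have h2 : p ^ N • g = 0 := Subtype.ext ((hG _).1 g.2)
    have := Nat.gcd_eq_gcd_ab D.range.index (p ^ N)
    rw [← natCast_zsmul, ← hs, this, add_smul, mul_comm, mul_smul, mul_comm, mul_smul,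
      natCast_zsmul, natCast_zsmul, h2, smul_zero, add_zero]
    exact D.range.zsmul_mem h1 _
  -- `p ^ s` kills the cokernel with `s < N`, and `a` is `p ^ s` times an element of `G`
  obtain ⟨b, hb⟩ := exists_pow_nsmul_eq hdiv s a
  have hbG : b ∈ G := by
    rw [hG, show N = (N - s - 1) + 1 + s by omega, pow_add, mul_smul, hb, pow_succ, mul_smul, ha,
      smul_zero]
  obtain ⟨c, hc⟩ := hmem ⟨b, hbG⟩
  refine ⟨c, (hG _).1 c.2, ?_⟩
  rw [← hD, hc]
  exact hb

end FixedVectors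

/-! ### Local triviality of cocycles -/

section LocalTriviality

variable {Γ A A' : Type*} [Group Γ] [AddCommGroup A] [AddCommGroup A'] [DistribMulAction Γ A]
  {p : ℕ}

theorem cocycle_one {c : Γ → A} (hc : ∀ g h, c (g * h) = c g + g • c h) : c 1 = 0 := by
  simpa using hc 1 1

theorem cocycle_inv {c : Γ → A} (hc : ∀ g h, c (g * h) = c g + g • c h) (g : Γ) :
    c g⁻¹ = -(g⁻¹ • c g) := by
  have := hc g⁻¹ g
  rw [inv_mul_cancel, cocycle_one hc] at this
  exact (neg_eq_of_add_eq_zero_left this.symm).symm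

/-- The elements at which a cocycle vanishes. -/
def cocycleKer (c : Γ → A) (hc : ∀ g h, c (g * h) = c g + g • c h) : Subgroup Γ where
  carrier := {g | c g = 0}
  mul_mem' {g h} hg hh := by
    change c (g * h) = 0
    rw [hc, show c g = 0 from hg, show c h = 0 from hh, smul_zero, add_zero]
  one_mem' := cocycle_one hc
  inv_mem' {g} hg := by
    change c g⁻¹ = 0
    rw [cocycle_inv hc, show c g = 0 from hg, smul_zero, neg_zero]

theorem cocycle_sub_coboundary {c : Γ → A} (hc : ∀ g h, c (g * h) = c g + g • c h) (T : A)
    (g h : Γ) : c (g * h) - ((g * h) • T - T) = c g - (g • T - T) + g • (c h - (h • T - T)) := by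
  rw [hc, mul_smul, smul_sub, smul_sub]
  abel

theorem exists_zpow_mul_of_isCyclic (I : Subgroup Γ) [I.Normal] [IsCyclic (Γ ⧸ I)] :
    ∃ F : Γ, ∀ γ, ∃ i : ℤ, ∃ τ ∈ I, γ = F ^ i * τ := by
  obtain ⟨F, hF⟩ := IsCyclic.exists_generator (α := Γ ⧸ I)
  obtain ⟨F, rfl⟩ := QuotientGroup.mk_surjective F
  refine ⟨F, fun γ => ?_⟩
  obtain ⟨i, hi⟩ := hF γ
  refine ⟨i, (F ^ i)⁻¹ * γ, ?_, by group⟩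
  rw [← QuotientGroup.eq]
  exact hi

theorem eq_zero_of_pow_nsmul {ρ : A →+ A'} (hρ : ∀ a, p • a = 0 → ρ a = 0 → a = 0) {m : ℕ} {a : A}
    (ha : p ^ m • a = 0) (h : ρ a = 0) : a = 0 := by
  induction m with
  | zero => simpa using ha
  | succ m ih =>
    refine ih (hρ _ ?_ ?_)
    · rw [← mul_smul, ← pow_succ', ha]
    · rw [map_nsmul, h, smul_zero]

/-- Invariance under `I` and a generator of the quotient is invariance under the whole group. -/
theorem smul_eq_of_smul_generator_eq {I : Subgroup Γ} {F : Γ}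
    (hF : ∀ γ, ∃ i : ℤ, ∃ τ ∈ I, γ = F ^ i * τ) {a : A} (hI : ∀ τ ∈ I, τ • a = a)
    (hFa : F • a = a) (γ : Γ) : γ • a = a := by
  obtain ⟨i, τ, hτ, rfl⟩ := hF γ
  rw [mul_smul, hI τ hτ]
  exact (MulAction.stabilizer Γ a).zpow_mem hFa i

/-- Local triviality at a place of good reduction where the cyclic extension is unramified: here
`ρ` is the reduction map, `U` the subgroup of the extension, and `I` an inertia group at
a suitable finite level. -/
theorem exists_coboundary_of_unramified (hp : p.Prime) (hdiv : ∀ a : A, ∃ b, p • b = a)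
    (hfin : {a : A | p • a = 0}.Finite) (ρ : A →+ A') (hρ : ∀ a, p • a = 0 → ρ a = 0 → a = 0)
    (hfix : {a : A | (∀ γ : Γ, γ • a = a) ∧ ∃ m, p ^ m • a = 0}.Finite) (U : Subgroup Γ)
    (hI : ∀ s : Set A, s.Finite → ∃ (I : Subgroup Γ) (_ : I.Normal), IsCyclic (Γ ⧸ I) ∧ I ≤ U ∧
      ∀ τ ∈ I, ∀ Q ∈ s, ρ (τ • Q) = ρ Q)
    {c : Γ → A} (hc : ∀ g h, c (g * h) = c g + g • c h) (hcp : ∀ g, p • c g = 0) {Q₀ : A}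
    (hQ₀ : ∀ h ∈ U, c h = h • Q₀ - Q₀) : ∃ T : A, ∀ γ, c γ = γ • T - T := by
  obtain ⟨N, hN⟩ : ∃ N, {a : A | (∀ γ : Γ, γ • a = a) ∧ ∃ m, p ^ m • a = 0}.ncard < p ^ N :=
    ⟨_, Nat.lt_pow_self hp.one_lt⟩
  have hfinN := finite_torsion_pow hfin N
  obtain ⟨I, hIn, hIc, hIU, hIρ⟩ := hI _ (hfinN.insert Q₀)
  obtain ⟨F, hF⟩ := exists_zpow_mul_of_isCyclic I
  have hIN : ∀ τ ∈ I, ∀ a : A, p ^ N • a = 0 → τ • a = a := by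
    intro τ hτ a ha
    refine sub_eq_zero.1 (eq_zero_of_pow_nsmul hρ (m := N) ?_ ?_)
    · rw [smul_sub, ha, smul_comm, ha, smul_zero, sub_zero]
    · rw [map_sub, hIρ τ hτ a (.inr ha), sub_self]
  have hIc0 : ∀ τ ∈ I, c τ = 0 := by
    intro τ hτ
    refine hρ _ (hcp τ) ?_
    rw [hQ₀ τ (hIU hτ), map_sub, hIρ τ hτ Q₀ (.inl rfl), sub_self]
  obtain ⟨R, hRN, hR⟩ := exists_map_sub_eq hp hdiv (DistribSMul.toAddMonoidHom A F) hfix hfinN hN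
    (fun a ha hFa => ⟨fun γ =>
      smul_eq_of_smul_generator_eq hF (fun τ hτ => hIN τ hτ a ha) hFa γ, N, ha⟩) (hcp F)
  refine ⟨R, fun γ => sub_eq_zero.1 ?_⟩
  let Z := cocycleKer (fun γ => c γ - (γ • R - R)) (cocycle_sub_coboundary hc R)
  have hZI : I ≤ Z := fun τ hτ => by
    change c τ - (τ • R - R) = 0
    rw [hIc0 τ hτ, hIN τ hτ R hRN, sub_self, sub_zero]
  have hZF : F ∈ Z := sub_eq_zero.2 hR.symm
  obtain ⟨i, τ, hτ, rfl⟩ := hF γ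
  exact Z.mul_mem (Z.zpow_mem hZF i) (hZI hτ)

/-- If a group acts on `M` and `U` is the kernel of a homomorphism to a cyclic `p`-group, then the
`p`-torsion of `M` has no `U`-invariants when it has no invariants under the whole group. -/
theorem eq_zero_of_fixed_of_isCyclic (hp : p.Prime) {C : Type*} [Group C] [Finite C] [IsCyclic C]
    {n : ℕ} (hC : Nat.card C = p ^ n) (θ : Γ →* C)
    (hfix : ∀ a : A, p • a = 0 → (∀ γ : Γ, γ • a = a) → a = 0) {a : A} (hpa : p • a = 0)
    (ha : ∀ h ∈ θ.ker, h • a = a) : a = 0 := by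
  by_contra ha0
  obtain ⟨⟨_, γ₀, rfl⟩, hγ₀⟩ := IsCyclic.exists_generator (α := θ.range)
  let M : AddSubgroup A :=
    { carrier := {a | p • a = 0 ∧ ∀ h ∈ θ.ker, h • a = a}
      zero_mem' := ⟨smul_zero _, fun _ _ => smul_zero _⟩
      add_mem' := fun {a b} ha hb => ⟨by rw [smul_add, ha.1, hb.1, add_zero], fun h hh => by
        rw [smul_add, ha.2 h hh, hb.2 h hh]⟩
      neg_mem' := fun {a} ha => ⟨by rw [smul_neg, ha.1, neg_zero], fun h hh => by
        rw [smul_neg, ha.2 h hh]⟩ }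
  have hM : ∀ (γ : Γ), ∀ a ∈ M, γ • a ∈ M := by
    rintro γ a ⟨h1, h2⟩
    refine ⟨by rw [smul_comm, h1, smul_zero], fun h hh => ?_⟩
    have : h • γ • a = γ • (γ⁻¹ * h * γ) • a := by
      rw [← mul_smul, ← mul_smul]
      congr 1
      group
    rw [this, h2]
    simpa using (inferInstance : θ.ker.Normal).conj_mem h hh γ⁻¹
  let T : AddMonoid.End M := ((DistribSMul.toAddMonoidHom A γ₀).comp M.subtype).codRestrict M
    fun m => hM γ₀ m m.2
  have hT : ∀ (i : ℕ) (m : M), ((T ^ i) m : A) = γ₀ ^ i • (m : A) := by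
    intro i m
    induction i with
    | zero => simp
    | succ i ih =>
      rw [pow_succ', pow_succ', AddMonoid.End.coe_mul, Function.comp_apply, mul_smul, ← ih]
      rfl
  have hT1 : T ^ p ^ n = 1 := by
    ext m
    rw [hT]
    refine m.2.2 _ ?_
    rw [MonoidHom.mem_ker, map_pow, ← hC, pow_card_eq_one']
  obtain ⟨⟨b, hb⟩, -, hb0, hTb⟩ := exists_fixed_ne_zero hp (fun m : M => Subtype.ext m.2.1) T hT1 ⊤
    (fun _ _ => trivial) (a := ⟨a, hpa, ha⟩) trivial (fun h => ha0 (congrArg Subtype.val h))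
  refine hb0 (Subtype.ext (hfix b hb.1 fun γ => ?_))
  have hTb : γ₀ • b = b := congrArg Subtype.val hTb
  obtain ⟨i, hi⟩ := hγ₀ ⟨θ γ, γ, rfl⟩
  have hi : θ (γ₀ ^ i) = θ γ := by
    rw [map_zpow]
    exact congrArg Subtype.val hi
  have : γ = γ₀ ^ i * ((γ₀ ^ i)⁻¹ * γ) := by group
  rw [this, mul_smul, hb.2 ((γ₀ ^ i)⁻¹ * γ) (by rw [MonoidHom.mem_ker, map_mul, map_inv, hi,
    inv_mul_cancel])]
  exact (MulAction.stabilizer Γ b).zpow_mem hTb i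

/-- Local triviality at a place of good reduction without rational `p`-torsion: here
`ρ` is the reduction map, `θ.ker` the subgroup of the cyclic extension, and `I` an inertia group at
a suitable finite level. -/
theorem exists_coboundary_of_no_torsion (hp : p.Prime)
    (hfin : {a : A | p • a = 0}.Finite) (ρ : A →+ A') (hρ : ∀ a, p • a = 0 → ρ a = 0 → a = 0)
    {C : Type*} [Group C] [Finite C] [IsCyclic C] {n : ℕ} (hC : Nat.card C = p ^ n) (θ : Γ →* C)
    (hfix : ∀ a : A, p • a = 0 → (∀ γ : Γ, γ • a = a) → a = 0)
    (hI : ∀ s : Set A, s.Finite → ∃ (I : Subgroup Γ) (_ : I.Normal), IsCyclic (Γ ⧸ I) ∧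
      ∀ τ ∈ I, ∀ Q ∈ s, ρ (τ • Q) = ρ Q)
    {c : Γ → A} (hc : ∀ g h, c (g * h) = c g + g • c h) (hcp : ∀ g, p • c g = 0) {Q₀ : A}
    (hQ₀ : ∀ h ∈ θ.ker, c h = h • Q₀ - Q₀) : ∃ T : A, ∀ γ, c γ = γ • T - T := by
  have hU : ∀ a : A, p • a = 0 → (∀ h ∈ θ.ker, h • a = a) → a = 0 := fun a hpa ha =>
    eq_zero_of_fixed_of_isCyclic hp hC θ hfix hpa ha
  obtain ⟨I, hIn, hIc, hIρ⟩ := hI _ (hfin.insert Q₀)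
  have hIp : ∀ τ ∈ I, ∀ a : A, p • a = 0 → τ • a = a := by
    intro τ hτ a ha
    refine sub_eq_zero.1 (hρ _ ?_ ?_)
    · rw [smul_sub, ha, smul_comm, ha, smul_zero, sub_zero]
    · rw [map_sub, hIρ τ hτ a (.inr ha), sub_self]
  have hIc0 : ∀ τ ∈ I, τ ∈ θ.ker → c τ = 0 := by
    intro τ hτ hτU
    refine hρ _ (hcp τ) ?_
    rw [hQ₀ τ hτU, map_sub, hIρ τ hτ Q₀ (.inl rfl), sub_self]
  -- a Frobenius element of `θ.ker` modulo inertia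
  obtain ⟨F, hFU, hF⟩ : ∃ F ∈ θ.ker, ∀ γ ∈ θ.ker, ∃ i : ℤ, ∃ τ ∈ I, τ ∈ θ.ker ∧ γ = F ^ i * τ := by
    obtain ⟨⟨_, F, hFU, rfl⟩, hF⟩ := IsCyclic.exists_generator
      (α := θ.ker.map (QuotientGroup.mk' I))
    refine ⟨F, hFU, fun γ hγ => ?_⟩
    obtain ⟨i, hi⟩ := hF ⟨_, γ, hγ, rfl⟩
    refine ⟨i, (F ^ i)⁻¹ * γ, ?_,
      θ.ker.mul_mem (θ.ker.inv_mem (θ.ker.zpow_mem hFU i)) hγ, by group⟩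
    rw [← QuotientGroup.eq]
    exact congrArg Subtype.val hi
  obtain ⟨R, hRp, hR⟩ : ∃ R, p • R = 0 ∧ F • R - R = c F := by
    let G : AddSubgroup A := (nsmulAddMonoidHom (α := A) p).ker
    have hG : ∀ a, a ∈ G ↔ p • a = 0 := fun a => AddMonoidHom.mem_ker
    have : Finite G := hfin.subset fun a ha => (hG a).1 ha
    let D : G →+ G := ((DistribSMul.toAddMonoidHom A F - AddMonoidHom.id A).comp
      G.subtype).codRestrict G fun g => by
        have := (hG _).1 g.2
        rw [hG, AddMonoidHom.comp_apply, ← map_nsmul]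
        change (DistribSMul.toAddMonoidHom A F - AddMonoidHom.id A) (p • (g : A)) = 0
        rw [this, map_zero]
    have hD : ∀ g : G, (D g : A) = F • (g : A) - g := fun g => rfl
    have hinj : Function.Injective D := by
      rw [injective_iff_map_eq_zero]
      intro g hg
      have hg : F • (g : A) = g := sub_eq_zero.1 (congrArg Subtype.val hg)
      refine Subtype.ext (hU _ ((hG _).1 g.2) fun γ hγ => ?_)
      obtain ⟨i, τ, hτ, -, rfl⟩ := hF γ hγ
      rw [mul_smul, hIp τ hτ _ ((hG _).1 g.2)]
      exact (MulAction.stabilizer Γ (g : A)).zpow_mem hg i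
    obtain ⟨R, hR⟩ := Finite.surjective_of_injective hinj ⟨c F, (hG _).2 (hcp F)⟩
    exact ⟨R, (hG _).1 R.2, congrArg Subtype.val hR⟩
  have hb := cocycle_sub_coboundary hc R
  let Z := cocycleKer (fun γ => c γ - (γ • R - R)) hb
  have hZU : θ.ker ≤ Z := fun γ hγ => by
    obtain ⟨i, τ, hτ, hτU, rfl⟩ := hF γ hγ
    refine Z.mul_mem (Z.zpow_mem (sub_eq_zero.2 hR.symm) i) ?_
    change c τ - (τ • R - R) = 0
    rw [hIc0 τ hτ hτU, hIp τ hτ R hRp, sub_self, sub_zero]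
  refine ⟨R, fun γ => sub_eq_zero.1 (hU _ ?_ fun h hh => ?_)⟩
  · rw [smul_sub, hcp, smul_sub, hRp, smul_comm, hRp, smul_zero, sub_zero, sub_zero]
  · -- `h γ = γ h'` with `h'` in the kernel, where the cocycle vanishes
    have hh' : γ⁻¹ * h * γ ∈ θ.ker := by
      simpa using (inferInstance : θ.ker.Normal).conj_mem h hh γ⁻¹
    have e1 := hb h γ
    have e2 := hb γ (γ⁻¹ * h * γ)
    rw [show γ * (γ⁻¹ * h * γ) = h * γ by group, show c (γ⁻¹ * h * γ) - _ = 0 from hZU hh',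
      smul_zero, add_zero] at e2
    rw [e2, show c h - _ = 0 from hZU hh, zero_add] at e1
    exact e1.symm

end LocalTriviality

/-! ### Invariant classes and their extension -/

section Extension

variable {D : Type*} [Group D] [TopologicalSpace D] [IsTopologicalGroup D] {M : Type*}
  [AddCommGroup M] [DistribMulAction D M] {U : Subgroup D}

/-- The action of `σ ∈ D` on the continuous cocycles of a normal subgroup `U` with values in
a `D`-module: `f` goes to `h ↦ σ • f (σ⁻¹ h σ)`. -/
def conjCocycle [U.Normal] (σ : D) : contCocycles₁ U M →+ contCocycles₁ U M :=
  contCocycles₁Map (MulAut.conjNormal σ⁻¹).toMonoidHom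
    (by
      refine Continuous.subtype_mk (f := fun h : U => σ⁻¹ * (h : D) * σ⁻¹⁻¹) ?_ _
      fun_prop)
    (DistribSMul.toAddMonoidHom M σ) (by
      intro h m
      change σ • ((σ⁻¹ * (h : D) * σ⁻¹⁻¹) • m) = (h : D) • σ • m
      rw [← mul_smul, ← mul_smul]
      congr 1
      group)

theorem conjCocycle_apply [U.Normal] (σ : D) (f : contCocycles₁ U M) (h : U) (h' : U)
    (hh : (h' : D) = σ⁻¹ * h * σ) : (conjCocycle σ f).1 h = σ • f.1 h' := by
  change σ • f.1 _ = σ • f.1 h'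
  refine congrArg (fun x => σ • f.1 x) (Subtype.ext ?_)
  rw [hh]
  change σ⁻¹ * (h : D) * σ⁻¹⁻¹ = _
  rw [inv_inv]

theorem conjCocycle_mul [U.Normal] (σ τ : D) (f : contCocycles₁ U M) :
    conjCocycle σ (conjCocycle τ f) = conjCocycle (σ * τ) f := by
  ext h
  have h1 : σ⁻¹ * (h : D) * σ ∈ U := by
    simpa using (inferInstance : U.Normal).conj_mem h h.2 σ⁻¹
  have h2 : τ⁻¹ * (σ⁻¹ * (h : D) * σ) * τ ∈ U := by
    simpa using (inferInstance : U.Normal).conj_mem _ h1 τ⁻¹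
  rw [conjCocycle_apply σ _ h ⟨_, h1⟩ rfl, conjCocycle_apply τ _ _ ⟨_, h2⟩ rfl,
    conjCocycle_apply (σ * τ) _ h ⟨_, h2⟩ (by simp only; group), mul_smul]

theorem conjCocycle_coboundary [U.Normal] (σ : D) {f : contCocycles₁ U M}
    (hf : f ∈ contCoboundaries₁ U M) : conjCocycle σ f ∈ contCoboundaries₁ U M := by
  obtain ⟨m, hm⟩ := hf
  refine ⟨σ • m, fun h => ?_⟩
  have h1 : σ⁻¹ * (h : D) * σ ∈ U := by
    simpa using (inferInstance : U.Normal).conj_mem h h.2 σ⁻¹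
  rw [conjCocycle_apply σ _ h ⟨_, h1⟩ rfl, hm, smul_sub]
  change σ • (σ⁻¹ * (h : D) * σ) • m - _ = (h : D) • σ • m - _
  rw [← mul_smul, ← mul_smul]
  congr 2
  group

/-- Inner automorphisms act trivially on cohomology. -/
theorem conjCocycle_sub_mem [U.Normal] {u : D} (hu : u ∈ U) (f : contCocycles₁ U M) :
    conjCocycle u f - f ∈ contCoboundaries₁ U M := by
  refine ⟨f.1 ⟨u, hu⟩, fun h => ?_⟩
  have e := conjCocycle_apply u f h (⟨u, hu⟩⁻¹ * h * ⟨u, hu⟩) rfl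
  change (conjCocycle u f).1 h - f.1 h = _
  rw [e, f.2.2, f.2.2, cocycle_inv f.2.2]
  change u • (-(u⁻¹ • f.1 ⟨u, hu⟩) + u⁻¹ • f.1 h + (u⁻¹ * (h : D)) • f.1 ⟨u, hu⟩) - f.1 h =
    (h : D) • f.1 ⟨u, hu⟩ - f.1 ⟨u, hu⟩
  rw [smul_add, smul_add, smul_neg, smul_inv_smul, smul_inv_smul, ← mul_smul, mul_inv_cancel_left]
  abel

/-- In a nonzero stable subgroup of the cohomology of `U`, an element `σ` of `p`-power order modulo `U`
fixes some nonzero class. -/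
theorem exists_invariant_cocycle [U.Normal] {p : ℕ} (hp : p.Prime) (hM : ∀ m : M, p • m = 0) {σ : D}
    {n : ℕ} (hσ : σ ^ p ^ n ∈ U) {S : AddSubgroup (contCocycles₁ U M)}
    (hS : ∀ f ∈ S, conjCocycle σ f ∈ S) {f : contCocycles₁ U M}
    (hf : f ∈ S) (hf0 : f ∉ contCoboundaries₁ U M) :
    ∃ f' ∈ S, f' ∉ contCoboundaries₁ U M ∧ conjCocycle σ f' - f' ∈ contCoboundaries₁ U M := by
  let T : AddMonoid.End (ContH1 U M) := QuotientAddGroup.map _ _ (conjCocycle σ)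
    fun f hf => conjCocycle_coboundary σ hf
  have hT : ∀ (i : ℕ) (f : contCocycles₁ U M), (T ^ i) (QuotientAddGroup.mk f) =
      QuotientAddGroup.mk (conjCocycle (σ ^ i) f) := by
    intro i f
    induction i with
    | zero =>
      refine (QuotientAddGroup.eq.2 ?_ : (QuotientAddGroup.mk f : ContH1 U M) = _)
      rw [neg_add_eq_sub]
      exact conjCocycle_sub_mem (by simp) f
    | succ i ih =>
      rw [pow_succ', AddMonoid.End.coe_mul, Function.comp_apply, ih, pow_succ', ← conjCocycle_mul]
      rfl
  have hT1 : T ^ p ^ n = 1 := by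
    refine AddMonoidHom.ext fun f => ?_
    obtain ⟨f, rfl⟩ := QuotientAddGroup.mk_surjective f
    change (T ^ p ^ n) (QuotientAddGroup.mk f) = QuotientAddGroup.mk f
    rw [hT]
    refine (QuotientAddGroup.eq.2 ?_).symm
    rw [neg_add_eq_sub]
    exact conjCocycle_sub_mem hσ f
  obtain ⟨_, ⟨b, hb, rfl⟩, hb0, hTb⟩ := exists_fixed_ne_zero hp (A := ContH1 U M)
    (fun x => by
      obtain ⟨x, rfl⟩ := QuotientAddGroup.mk_surjective x
      rw [← QuotientAddGroup.mk_nsmul]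
      have : p • x = 0 := by
        ext h
        exact hM _
      rw [this, QuotientAddGroup.mk_zero]) T hT1 (S.map (QuotientAddGroup.mk' _)) (by
      rintro _ ⟨f, hf, rfl⟩
      exact ⟨_, hS f hf, rfl⟩) ⟨f, hf, rfl⟩ (fun h => hf0 ((QuotientAddGroup.eq_zero_iff f).1 h))
  refine ⟨b, hb, fun h => hb0 ((QuotientAddGroup.eq_zero_iff b).2 h), ?_⟩
  rw [← neg_add_eq_sub]
  exact QuotientAddGroup.eq.1 hTb.symm

/-- The surjectivity of restriction onto the invariant classes, for a normal subgroup `U` whose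
quotient is generated by `σ` and which has no nonzero invariants in `M`: since the elements `m` that
exhibit the invariance of the class are unique, they form a cocycle of the whole group. -/
theorem exists_cocycle_extension [U.Normal] (hUo : IsOpen (U : Set D))
    (hM : ∀ m : M, (∀ u ∈ U, u • m = m) → m = 0)
    {σ : D} (hσ : ∀ g : D, ∃ i : ℕ, ∃ u ∈ U, g = σ ^ i * u) {f : contCocycles₁ U M}
    (hf : conjCocycle σ f - f ∈ contCoboundaries₁ U M) :
    ∃ F : contCocycles₁ D M, ∀ u : U, F.1 u = f.1 u := by
  have huniq : ∀ {m m' : M}, (∀ h : U, (h : D) • m - m = (h : D) • m' - m') → m = m' := by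
    intro m m' h
    refine sub_eq_zero.1 (hM _ fun u hu => ?_)
    rw [smul_sub, ← sub_eq_zero]
    have := sub_eq_zero.2 (h ⟨u, hu⟩)
    rw [← this]
    simp only
    abel
  -- the equation that exhibits the invariance under `g` and `k` yields that under `g * k`
  have hmul : ∀ {g k : D} {m m' : M}, (∀ h : U, (conjCocycle g f).1 h - f.1 h = (h : D) • m - m) →
      (∀ h : U, (conjCocycle k f).1 h - f.1 h = (h : D) • m' - m') →
      ∀ h : U, (conjCocycle (g * k) f).1 h - f.1 h = (h : D) • (m + g • m') - (m + g • m') := by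
    intro g k m m' hg hk h
    have h1 : g⁻¹ * (h : D) * g ∈ U := by
      simpa using (inferInstance : U.Normal).conj_mem h h.2 g⁻¹
    rw [← conjCocycle_mul, conjCocycle_apply g _ h ⟨_, h1⟩ rfl, sub_eq_iff_eq_add.1 (hk ⟨_, h1⟩),
      smul_add, ← conjCocycle_apply g f h ⟨_, h1⟩ rfl, sub_eq_iff_eq_add.1 (hg h), smul_sub,
      smul_add, ← mul_smul, ← mul_smul]
    simp only [mul_assoc, mul_inv_cancel_left]
    abel
  have hmem : ∀ u : U, ∀ h : U, (conjCocycle (u : D) f).1 h - f.1 h =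
      (h : D) • f.1 u - f.1 u := by
    intro u h
    have e := conjCocycle_apply (u : D) f h (u⁻¹ * h * u) rfl
    rw [e, f.2.2, f.2.2, cocycle_inv f.2.2]
    change (u : D) • (-((u : D)⁻¹ • f.1 u) + (u : D)⁻¹ • f.1 h + ((u : D)⁻¹ * (h : D)) • f.1 u)
      - f.1 h = (h : D) • f.1 u - f.1 u
    rw [smul_add, smul_add, smul_neg, smul_inv_smul, smul_inv_smul, ← mul_smul, mul_inv_cancel_left]
    abel
  obtain ⟨m₀, hm₀⟩ := hf
  have hex : ∀ g : D, ∃ m : M, ∀ h : U, (conjCocycle g f).1 h - f.1 h = (h : D) • m - m := by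
    have hpow : ∀ i : ℕ, ∃ m : M, ∀ h : U,
        (conjCocycle (σ ^ i) f).1 h - f.1 h = (h : D) • m - m := by
      intro i
      induction i with
      | zero => exact ⟨_, by simpa using hmem 1⟩
      | succ i ih =>
        obtain ⟨m, hm⟩ := ih
        rw [pow_succ]
        exact ⟨_, hmul hm hm₀⟩
    intro g
    obtain ⟨i, u, hu, rfl⟩ := hσ g
    obtain ⟨m, hm⟩ := hpow i
    exact ⟨_, hmul hm (hmem ⟨u, hu⟩)⟩
  choose F hF using hex
  have hFU : ∀ u : U, F u = f.1 u := fun u => huniq fun h => by rw [← hF, hmem]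
  have hFmul : ∀ g h, F (g * h) = F g + g • F h := fun g k => huniq fun h => by
    rw [← hF, hmul (hF g) (hF k)]
  refine ⟨⟨F, ?_, hFmul⟩, hFU⟩
  -- `F` vanishes on an open subgroup of `U`, and so it is constant on its left cosets
  have hopen : IsOpen (U.subtype '' {u : U | f.1 u = 0}) :=
    hUo.isOpenMap_subtype_val _ (f.2.1.isOpen_fiber 0)
  refine (IsLocallyConstant.iff_exists_open F).2 fun g =>
    ⟨(fun x => g⁻¹ * x) ⁻¹' (U.subtype '' {u : U | f.1 u = 0}),
      hopen.preimage (by fun_prop), ⟨1, ?_, by simp⟩, ?_⟩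
  · exact cocycle_one f.2.2
  · rintro x ⟨u, hu, hux⟩
    have hx : x = g * (u : D) := by
      rw [show (u : D) = g⁻¹ * x from hux, mul_inv_cancel_left]
    rw [hx, hFmul, hFU, show f.1 u = 0 from hu, smul_zero, add_zero]

end Extension

/-! ### Inertia -/

section GaloisPlace

open IsLocalRing

variable {F Ω : Type*} [Field F] [Field Ω] [Algebra F Ω]

/-- The valuation ring `B` of the extension `Ω` of `F` lies above the valuation ring `O` of `F` and
is stable under `Gal(Ω/F)`. -/
structure IsGaloisPlace (O : ValuationSubring F) (B : ValuationSubring Ω) : Prop where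
  algebraMap_mem_iff : ∀ x : F, algebraMap F Ω x ∈ B ↔ x ∈ O
  map_mem : ∀ (σ : Gal(Ω/F)) (x : Ω), x ∈ B → σ x ∈ B

namespace IsGaloisPlace

variable {O : ValuationSubring F} {B : ValuationSubring Ω} (H : IsGaloisPlace O B)

include H in
theorem map_mem_iff (σ : Gal(Ω/F)) (x : Ω) : σ x ∈ B ↔ x ∈ B := by
  refine ⟨fun h => ?_, H.map_mem σ x⟩
  have := H.map_mem σ⁻¹ _ h
  rwa [← AlgEquiv.mul_apply, inv_mul_cancel, AlgEquiv.one_apply] at this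

/-- The inclusion of `O` into a valuation ring above it. -/
def incl : O →+* B :=
  ((algebraMap F Ω).comp O.subtype).codRestrict B.toSubring
    fun x => (H.algebraMap_mem_iff _).2 x.2

instance isLocalHom_incl : IsLocalHom H.incl where
  map_nonunit x hx := by
    have hx0 : (x : F) ≠ 0 := by
      rintro h0
      have : H.incl x = 0 := Subtype.ext ((congrArg (algebraMap F Ω) h0).trans (map_zero _))
      exact hx.ne_zero this
    obtain ⟨y, hy⟩ := isUnit_iff_exists_inv.1 hx
    have hy : algebraMap F Ω x * (y : Ω) = 1 := congrArg Subtype.val hy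
    have hmem : (x : F)⁻¹ ∈ O := by
      rw [← H.algebraMap_mem_iff, map_inv₀, ← eq_inv_of_mul_eq_one_right hy]
      exact y.2
    exact isUnit_iff_exists_inv.2 ⟨⟨_, hmem⟩, Subtype.ext (mul_inv_cancel₀ hx0)⟩

/-- The embedding of residue fields. -/
noncomputable def resMap : ResidueField O →+* ResidueField B := ResidueField.map H.incl

theorem reducesTo_algebraMap {x : F} (hx : x ∈ O) :
    ReducesTo (residue B) (algebraMap F Ω x) (H.resMap (residue O ⟨x, hx⟩)) :=
  ⟨(H.algebraMap_mem_iff x).2 hx, (ResidueField.map_residue H.incl ⟨x, hx⟩).symm⟩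

include H in
theorem mem_coeff_minpoly [Normal F Ω] {b : Ω} (hb : b ∈ B) (i : ℕ) :
    (minpoly F b).coeff i ∈ O := by
  have hmem : (minpoly F b).map (algebraMap F Ω) ∈ Polynomial.lifts B.subtype := by
    rw [(Normal.splits inferInstance b : ((minpoly F b).map (algebraMap F Ω)).Splits).eq_prod_roots_of_monic
      ((minpoly.monic (Algebra.IsIntegral.isIntegral b)).map _)]
    refine multiset_prod_mem _ fun P hP => ?_
    obtain ⟨a, ha, rfl⟩ := Multiset.mem_map.1 hP
    obtain ⟨σ, rfl⟩ := minpoly.exists_algEquiv_of_root' (Algebra.IsAlgebraic.isAlgebraic b)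
      (by simpa using (Polynomial.mem_roots'.1 ha).2)
    exact ⟨Polynomial.X - Polynomial.C ⟨σ b, H.map_mem σ b hb⟩, by simp⟩
  obtain ⟨Q, hQ⟩ := hmem
  rw [← H.algebraMap_mem_iff, ← Polynomial.coeff_map, ← hQ]
  change (Q.map B.subtype).coeff i ∈ B
  rw [Polynomial.coeff_map]
  exact (Q.coeff i).2

/-- The extension of residue fields is algebraic. -/
theorem residue_algebraic [Normal F Ω] (b : B) :
    H.resMap.IsIntegralElem (residue B b) := by
  have hlift : minpoly F (b : Ω) ∈ Polynomial.lifts O.subtype := by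
    rw [Polynomial.lifts_iff_coeff_lifts]
    exact fun i => ⟨⟨_, H.mem_coeff_minpoly b.2 i⟩, rfl⟩
  obtain ⟨P, hP, -, hPm⟩ := Polynomial.lifts_and_natDegree_eq_and_monic hlift
    (minpoly.monic (Algebra.IsIntegral.isIntegral _))
  refine ⟨P.map (residue O), hPm.map _, ?_⟩
  rw [Polynomial.eval₂_map, resMap, ResidueField.map_comp_residue, ← Polynomial.hom_eval₂]
  refine (congrArg (residue B) (Subtype.ext ?_)).trans (map_zero _)
  change B.subtype (P.eval₂ H.incl b) = 0
  rw [Polynomial.hom_eval₂]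
  have h := minpoly.aeval F (b : Ω)
  rw [← hP, Polynomial.aeval_def, Polynomial.eval₂_map] at h
  exact h

include H in
/-- The inertia group of a finite set of integral elements: it acts trivially on their residues, and
the quotient by it is cyclic since it acts faithfully on a finite extension of the residue field. -/
theorem exists_inertia [Normal F Ω] [Finite (ResidueField O)] {s : Set Ω}
    (hs : s.Finite) (hsB : ∀ x ∈ s, x ∈ B) :
    ∃ (I : Subgroup Gal(Ω/F)) (_ : I.Normal), IsCyclic (Gal(Ω/F) ⧸ I) ∧
      ∀ τ ∈ I, ∀ x ∈ s, τ x - x ∈ B.nonunits := by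
  let k := ResidueField O
  let κ := ResidueField B
  let : Algebra k κ := H.resMap.toAlgebra
  let : MulSemiringAction Gal(Ω/F) B :=
    { smul := fun σ b => ⟨σ b, H.map_mem σ b b.2⟩
      one_smul := fun b => rfl
      mul_smul := fun σ τ b => rfl
      smul_zero := fun σ => Subtype.ext (map_zero σ)
      smul_add := fun σ a b => Subtype.ext (map_add σ _ _)
      smul_one := fun σ => Subtype.ext (map_one σ)
      smul_mul := fun σ a b => Subtype.ext (map_mul σ _ _) }
  have hfix : ∀ (σ : Gal(Ω/F)) (c : k), σ • algebraMap k κ c = algebraMap k κ c := by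
    intro σ c
    obtain ⟨c, rfl⟩ := residue_surjective c
    change σ • H.resMap (residue O c) = H.resMap (residue O c)
    rw [resMap, ResidueField.map_residue, ← ResidueField.residue_smul]
    exact congrArg _ (Subtype.ext (σ.commutes c))
  have : SMulCommClass Gal(Ω/F) k κ := ⟨fun σ c x => by
    rw [Algebra.smul_def, Algebra.smul_def, smul_mul', hfix]⟩
  let s' : Set κ := residue B '' (Subtype.val ⁻¹' s)
  have hs' : s'.Finite := (hs.preimage Subtype.val_injective.injOn).image _
  let E' := IntermediateField.adjoin k s'
  have : Finite s' := hs'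
  have : FiniteDimensional k E' := IntermediateField.finiteDimensional_adjoin fun x hx => by
    obtain ⟨b, -, rfl⟩ := hx
    exact H.residue_algebraic b
  have : Finite E' := Module.finite_of_finite k
  let φ : Gal(Ω/F) →* Gal(E'/k) :=
    (AlgEquiv.restrictNormalHom E').comp (MulSemiringAction.toAlgAut Gal(Ω/F) k κ)
  refine ⟨φ.ker, inferInstance,
    isCyclic_of_injective (QuotientGroup.kerLift φ) (QuotientGroup.kerLift_injective φ),
    fun τ hτ x hx => ?_⟩
  let b : B := ⟨x, hsB x hx⟩
  have hb : residue B b ∈ E' := IntermediateField.subset_adjoin k s' ⟨b, hx, rfl⟩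
  have h1 := AlgEquiv.restrictNormal_commutes (MulSemiringAction.toAlgAut Gal(Ω/F) k κ τ) E'
    ⟨_, hb⟩
  have h2 : (MulSemiringAction.toAlgAut Gal(Ω/F) k κ τ).restrictNormal E' = 1 :=
    MonoidHom.mem_ker.1 hτ
  rw [h2] at h1
  have h3 : residue B b = residue B (τ • b) := h1
  have h4 : residue B (τ • b - b) = 0 := by rw [map_sub, ← h3, sub_self]
  exact (ValuationSubring.coe_mem_nonunits_iff (a := τ • b - b)).2 ((residue_eq_zero_iff _).1 h4)

end IsGaloisPlace

end GaloisPlace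

/-! ### Galois action and good reduction -/

section GoodReduction

open IsLocalRing WeierstrassCurve WeierstrassCurve.Affine

variable {F Ω : Type*} [Field F] [Field Ω] [Algebra F Ω] {O : ValuationSubring F}
  {B : ValuationSubring Ω}

/-- Reduction is insensitive to automorphisms that act trivially on the residues of the
coordinates. -/
theorem PointReducesTo.pointMap_of_sub_mem (H : IsGaloisPlace O B) {W : Affine Ω}
    {W' : Affine (ResidueField B)} (τ : Gal(Ω/F)) (hτ : W.map (τ : Ω →+* Ω) = W)
    {P : W.Point} {P' : W'.Point} (hP : PointReducesTo (residue B) P P')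
    (h : ∀ (x y : Ω) (hxy : W.Nonsingular x y), P = .some x y hxy → x ∈ B → y ∈ B →
      τ x - x ∈ B.nonunits ∧ τ y - y ∈ B.nonunits) :
    PointReducesTo (residue B) (pointMap (τ : Ω →+* Ω) hτ P) P' := by
  cases hP with
  | zero => exact .zero
  | infty hxy hx => exact .infty _ fun h => hx ((H.map_mem_iff τ _).1 h)
  | some hxy hxy' hx hy =>
    obtain ⟨h1, h2⟩ := h _ _ _ rfl hx.mem hy.mem
    exact .some _ _ (((ReducesTo.of_mem_nonunits h1).add hx).congr (sub_add_cancel _ _)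
      (_root_.zero_add _)) (((ReducesTo.of_mem_nonunits h2).add hy).congr (sub_add_cancel _ _)
      (_root_.zero_add _))

theorem variableChangePoint_eq_zero {K : Type*} [Field K] {C : VariableChange K}
    {W : WeierstrassCurve K} [W.IsElliptic] {P : W.toAffine.Point}
    (h : variableChangePoint C W P = 0) : P = 0 := by
  rcases P with _ | ⟨x, y, hxy⟩
  · rfl
  · cases h

variable {R : Type*} [CommRing R] [Algebra R F] [Algebra R Ω] [IsScalarTower R F Ω]
  (E : WeierstrassCurve R) (C : VariableChange F) {W₀ : WeierstrassCurve (ResidueField O)}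

theorem map_variableChange_baseChange :
    (C • (E⁄F)).map (algebraMap F Ω) = C.map (algebraMap F Ω) • (E⁄Ω) := by
  refine (map_variableChange _ _ _).symm.trans (congrArg (C.map (algebraMap F Ω) • ·) ?_)
  refine (WeierstrassCurve.map_map _ _ _).trans (congrArg E.map ?_)
  exact (IsScalarTower.algebraMap_eq R F Ω).symm

theorem map_galois_variableChange (σ : Gal(Ω/F)) :
    (C.map (algebraMap F Ω) • (E⁄Ω)).map (σ : Ω →+* Ω) = C.map (algebraMap F Ω) • (E⁄Ω) := by
  rw [← map_variableChange_baseChange]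
  refine (WeierstrassCurve.map_map _ _ _).trans (congrArg (C • (E⁄F)).map ?_)
  ext x
  exact σ.commutes x

theorem variableChangePoint_smul [(E⁄Ω).IsElliptic] (σ : Gal(Ω/F)) (P : (E⁄Ω).toAffine.Point) :
    variableChangePoint (C.map (algebraMap F Ω)) (E⁄Ω) (σ • P) =
      pointMap (σ : Ω →+* Ω) (map_galois_variableChange E C σ)
        (variableChangePoint (C.map (algebraMap F Ω)) (E⁄Ω) P) := by
  rcases P with _ | ⟨x, y, hxy⟩
  · rfl
  · have hr : ∀ c : F, σ (algebraMap F Ω c) = algebraMap F Ω c := σ.commutes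
    have hu : σ (((C.map (algebraMap F Ω)).u⁻¹ : Ωˣ) : Ω) =
        (((C.map (algebraMap F Ω)).u⁻¹ : Ωˣ) : Ω) := by
      have : (((C.map (algebraMap F Ω)).u⁻¹ : Ωˣ) : Ω) = algebraMap F Ω ((C.u⁻¹ : Fˣ) : F) := by
        simp [VariableChange.map]
      rw [this, hr]
    change Point.some _ _ _ = Point.some _ _ _
    rw [Point.some.injEq]
    constructor
    · change _ = σ (_ ^ 2 * (x - algebraMap F Ω C.r))
      rw [map_mul, map_pow, hu, map_sub, hr]
      rfl
    · change _ = σ (_ ^ 3 * (y - algebraMap F Ω C.s * (x - algebraMap F Ω C.r) -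
        algebraMap F Ω C.t))
      rw [map_mul, map_pow, hu, map_sub, map_sub, map_mul, map_sub, hr, hr, hr]
      rfl

variable {E C}

theorem CurveReducesTo.baseChange (H : IsGaloisPlace O B)
    (hC : CurveReducesTo (residue O) (C • (E⁄F)) W₀) :
    CurveReducesTo (residue B) (C.map (algebraMap F Ω) • (E⁄Ω)) (W₀.map H.resMap) := by
  have key : ∀ {x c}, ReducesTo (residue O) x c →
      ReducesTo (residue B) (algebraMap F Ω x) (H.resMap c) := by
    rintro x _ ⟨hx, rfl⟩
    exact H.reducesTo_algebraMap hx
  rw [← map_variableChange_baseChange]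
  exact ⟨key hC.a₁, key hC.a₂, key hC.a₃, key hC.a₄, key hC.a₆⟩

/-- The reduction homomorphism on the points over an extension `Ω` of a curve over `F` that acquires
good reduction after the variable change `C`. -/
noncomputable def reductionHom [(E⁄Ω).IsElliptic] [W₀.IsElliptic] (H : IsGaloisPlace O B)
    (hC : CurveReducesTo (residue O) (C • (E⁄F)) W₀) :
    (E⁄Ω).toAffine.Point →+ (W₀.map H.resMap).toAffine.Point :=
  have : (W₀.map H.resMap).IsElliptic := inferInstance
  (hC.baseChange H).redHom.comp (variableChangePoint (C.map (algebraMap F Ω)) (E⁄Ω))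

variable [(E⁄Ω).IsElliptic] [W₀.IsElliptic] (H : IsGaloisPlace O B)
    (hC : CurveReducesTo (residue O) (C • (E⁄F)) W₀)

theorem reductionHom_spec (P : (E⁄Ω).toAffine.Point) :
    PointReducesTo (residue B) (variableChangePoint (C.map (algebraMap F Ω)) (E⁄Ω) P)
      (reductionHom H hC P) :=
  have : (W₀.map H.resMap).IsElliptic := inferInstance
  (hC.baseChange H).redHom_spec _

theorem eq_zero_of_reductionHom_eq_zero {n : ℕ} (hn : (n : ResidueField O) ≠ 0)
    {P : (E⁄Ω).toAffine.Point} (hP : n • P = 0) (h : reductionHom H hC P = 0) : P = 0 := by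
  have : (W₀.map H.resMap).IsElliptic := inferInstance
  refine variableChangePoint_eq_zero ((hC.baseChange H).eq_zero_of_redHom_eq_zero (n := n) ?_ h ?_)
  · rw [← map_natCast H.resMap]
    exact (map_ne_zero _).2 hn
  · rw [← map_nsmul, hP, map_zero]

/-- The inertia group at a finite level acts trivially on the reductions of finitely many points, and
on the residues of finitely many integral elements. -/
theorem exists_inertia_reductionHom [Normal F Ω] [Finite (ResidueField O)]
    {s : Set (E⁄Ω).toAffine.Point} (hs : s.Finite) {t : Set Ω} (ht : t.Finite)
    (htB : ∀ x ∈ t, x ∈ B) :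
    ∃ (I : Subgroup Gal(Ω/F)) (_ : I.Normal), IsCyclic (Gal(Ω/F) ⧸ I) ∧
      (∀ τ ∈ I, ∀ x ∈ t, τ x - x ∈ B.nonunits) ∧
      ∀ τ ∈ I, ∀ Q ∈ s, reductionHom H hC (τ • Q) = reductionHom H hC Q := by
  let V := (C.map (algebraMap F Ω) • (E⁄Ω)).toAffine
  let coords : V.Point → Set Ω := fun P => match P with
    | .zero => ∅
    | .some x y _ => {x, y}
  have hcoords : ∀ P, (coords P).Finite := by
    rintro (_ | ⟨x, y, h⟩)
    · exact Set.finite_empty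
    · exact Set.toFinite {x, y}
  let u : Set Ω := {x | x ∈ B ∧ ∃ Q ∈ s,
    x ∈ coords (variableChangePoint (C.map (algebraMap F Ω)) (E⁄Ω) Q)}
  have hu : u.Finite := by
    refine (hs.biUnion fun Q _ => hcoords
      (variableChangePoint (C.map (algebraMap F Ω)) (E⁄Ω) Q)).subset ?_
    rintro x ⟨-, Q, hQ, hx⟩
    simp only [Set.mem_iUnion]
    exact ⟨Q, hQ, hx⟩
  obtain ⟨I, hI, hIc, hIs⟩ := H.exists_inertia (ht.union hu) (by
    rintro x (hx | hx)
    exacts [htB x hx, hx.1])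
  refine ⟨I, hI, hIc, fun τ hτ x hx => hIs τ hτ x (.inl hx), fun τ hτ Q hQ => ?_⟩
  refine (reductionHom_spec H hC (τ • Q)).unique ?_
  rw [variableChangePoint_smul]
  refine (reductionHom_spec H hC Q).pointMap_of_sub_mem H τ _ fun x y hxy e hx hy => ?_
  exact ⟨hIs τ hτ x (.inr ⟨hx, Q, hQ, by rw [e]; exact .inl rfl⟩),
    hIs τ hτ y (.inr ⟨hy, Q, hQ, by rw [e]; exact .inr rfl⟩)⟩

/-- Rational points have rational reduction. -/
theorem reductionHom_mem_range [IsGalois F Ω] {P : (E⁄Ω).toAffine.Point}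
    (hP : ∀ σ : Gal(Ω/F), σ • P = P) :
    reductionHom H hC P ∈ (pointMap (W := W₀.toAffine) H.resMap rfl).range := by
  have hfix := fun σ : Gal(Ω/F) => variableChangePoint_smul E C σ P
  have hspec := reductionHom_spec H hC P
  simp only [hP] at hfix
  generalize variableChangePoint (C.map (algebraMap F Ω)) (E⁄Ω) P = Q at hfix hspec
  generalize reductionHom H hC P = Q' at hspec
  cases hspec with
  | zero => exact zero_mem _
  | infty _ _ => exact zero_mem _
  | some hxy hxy' hx hy =>
    have hF : ∀ {z : Ω}, (∀ σ : Gal(Ω/F), σ z = z) → z ∈ Set.range (algebraMap F Ω) := fun h =>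
      (InfiniteGalois.mem_range_algebraMap_iff_fixed _).2 h
    obtain ⟨x, rfl⟩ := hF fun σ => (Point.some.inj (hfix σ)).1.symm
    obtain ⟨y, rfl⟩ := hF fun σ => (Point.some.inj (hfix σ)).2.symm
    have hx' := (H.algebraMap_mem_iff _).1 hx.mem
    have hy' := (H.algebraMap_mem_iff _).1 hy.mem
    obtain rfl := hx.unique (H.reducesTo_algebraMap hx')
    obtain rfl := hy.unique (H.reducesTo_algebraMap hy')
    exact ⟨.some _ _ ((map_nonsingular W₀.toAffine H.resMap.injective _ _).1 hxy'), rfl⟩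

theorem finite_point {k : Type*} [Field k] [Finite k] (W : Affine k) : Finite W.Point := by
  refine Finite.of_injective (β := Option (k × k)) (fun P => match P with
    | .zero => none
    | .some x y _ => some (x, y)) ?_
  rintro (_ | ⟨x, y, h⟩) (_ | ⟨x', y', h'⟩) e
  · rfl
  · cases e
  · cases e
  · simp only [Option.some.injEq, Prod.mk.injEq] at e
    obtain ⟨rfl, rfl⟩ := e
    rfl

include H hC in
/-- The rational `p`-power torsion injects into the finite set of rational points of the
reduction. -/
theorem finite_fixed_torsion [IsGalois F Ω] [Finite (ResidueField O)] {p : ℕ}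
    (hp : (p : ResidueField O) ≠ 0) :
    {P : (E⁄Ω).toAffine.Point | (∀ σ : Gal(Ω/F), σ • P = P) ∧ ∃ m, p ^ m • P = 0}.Finite := by
  have := finite_point W₀.toAffine
  refine Set.Finite.of_finite_image (f := reductionHom H hC)
    ((Set.finite_range (pointMap (W := W₀.toAffine) H.resMap rfl)).subset ?_) ?_
  · rintro _ ⟨P, hP, rfl⟩
    exact reductionHom_mem_range H hC hP.1
  · rintro P ⟨-, m, hm⟩ Q ⟨-, m', hm'⟩ e
    refine sub_eq_zero.1 (eq_zero_of_reductionHom_eq_zero H hC (n := p ^ (m + m')) ?_ ?_ ?_)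
    · rw [Nat.cast_pow]
      exact pow_ne_zero _ hp
    · rw [smul_sub, pow_add, mul_smul, mul_smul, hm', smul_comm, hm, smul_zero, smul_zero, sub_zero]
    · rw [map_sub, e, sub_self]

include H hC in
theorem eq_zero_of_fixed_torsion [IsGalois F Ω] {p : ℕ} (hp : (p : ResidueField O) ≠ 0)
    (hW₀ : ∀ P : W₀.toAffine.Point, p • P = 0 → P = 0) {P : (E⁄Ω).toAffine.Point}
    (hP : ∀ σ : Gal(Ω/F), σ • P = P) (hpP : p • P = 0) : P = 0 := by
  refine eq_zero_of_reductionHom_eq_zero H hC hp hpP ?_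
  obtain ⟨Q, hQ⟩ := reductionHom_mem_range H hC hP
  rw [← hQ, hW₀ Q (pointMap_injective H.resMap rfl ?_), map_zero]
  rw [map_nsmul, hQ, ← map_nsmul, hpP, map_zero, map_zero]

end GoodReduction

/-! ### Completions of number fields and their algebraic closures -/

section Completion

variable {K : Type*} [Field K] [NumberField K] (v : HeightOneSpectrum (𝓞 K))

instance adicCompletion_charZero : CharZero (v.adicCompletion K) :=
  charZero_of_injective_algebraMap (algebraMap K (v.adicCompletion K)).injective

/-- Every residue class of the completion is represented by an integer of `K`. -/
theorem exists_algebraMap_sub_lt (x : v.adicCompletion K) (hx : x ∈ v.adicCompletionIntegers K) :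
    ∃ r : 𝓞 K, Valued.v (x - algebraMap K (v.adicCompletion K) r) < 1 := by
  obtain ⟨k, hk⟩ := (HeightOneSpectrum.denseRange_algebraMap (K := K) v).exists_dist_lt x one_pos
  rw [dist_eq_norm] at hk
  have hk : Valued.v (x - algebraMap K (v.adicCompletion K) k) < 1 :=
    Valued.toNormedField.norm_lt_one_iff.1 hk
  have hk1 : v.valuation K k ≤ 1 := by
    rw [← v.valuedAdicCompletion_eq_valuation' k]
    have : ((k : K) : v.adicCompletion K) = x - (x - algebraMap K (v.adicCompletion K) k) := by
      rw [sub_sub_cancel]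
      rfl
    rw [this]
    exact (Valuation.map_sub _ _ _).trans (max_le hx hk.le)
  obtain ⟨r, hr⟩ := v.exists_valuation_sub_lt_of_integer hk1 1
  refine ⟨r, ?_⟩
  have hr' : Valued.v (algebraMap K (v.adicCompletion K) r - algebraMap K (v.adicCompletion K) k) <
      1 := by
    rw [← map_sub]
    exact (v.valuedAdicCompletion_eq_valuation' _).trans_lt hr
  rw [show x - algebraMap K (v.adicCompletion K) r = (x - algebraMap K (v.adicCompletion K) k) -
    (algebraMap K (v.adicCompletion K) r - algebraMap K (v.adicCompletion K) k) by ring]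
  exact (Valuation.map_sub _ _ _).trans_lt (max_lt hk hr')

theorem valued_algebraMap_lt_one_iff (r : 𝓞 K) :
    Valued.v (algebraMap K (v.adicCompletion K) r) < 1 ↔ r ∈ v.asIdeal :=
  (iff_of_eq (congrArg (· < 1) (v.valuedAdicCompletion_eq_valuation' (r : K)))).trans
    (v.valuation_lt_one_iff_mem r)

theorem algebraMap_mem_adicCompletionIntegers (r : 𝓞 K) :
    algebraMap K (v.adicCompletion K) r ∈ v.adicCompletionIntegers K :=
  v.coe_algebraMap_mem _ _ r

instance finite_residueField_adicCompletionIntegers :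
    Finite (IsLocalRing.ResidueField (v.adicCompletionIntegers K)) := by
  let φ : 𝓞 K →+* IsLocalRing.ResidueField (v.adicCompletionIntegers K) :=
    (IsLocalRing.residue _).comp
      (((algebraMap K (v.adicCompletion K)).comp (algebraMap (𝓞 K) K)).codRestrict
        (v.adicCompletionIntegers K).toSubring fun r => algebraMap_mem_adicCompletionIntegers v r)
  have hmem : ∀ x : v.adicCompletionIntegers K,
      x ∈ IsLocalRing.maximalIdeal (v.adicCompletionIntegers K) ↔
        Valued.v (x : v.adicCompletion K) < 1 := fun x =>
    Valuation.mem_maximalIdeal_iff _ (a := x)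
  have hker : ∀ r ∈ v.asIdeal, φ r = 0 := by
    intro r hr
    refine (IsLocalRing.residue_eq_zero_iff _).2 ((hmem _).2 ?_)
    exact (valued_algebraMap_lt_one_iff v r).2 hr
  have : Finite (𝓞 K ⧸ v.asIdeal) := v.asIdeal.finiteQuotientOfFreeOfNeBot v.ne_bot
  refine Finite.of_surjective (Ideal.Quotient.lift v.asIdeal φ hker)
    (Ideal.Quotient.lift_surjective_of_surjective _ _ fun x => ?_)
  obtain ⟨x, rfl⟩ := IsLocalRing.residue_surjective x
  obtain ⟨r, hr⟩ := exists_algebraMap_sub_lt v x x.2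
  refine ⟨r, ?_⟩
  rw [← sub_eq_zero, ← neg_eq_zero, neg_sub]
  change IsLocalRing.residue _ x - IsLocalRing.residue _ _ = 0
  rw [← map_sub]
  exact (IsLocalRing.residue_eq_zero_iff _).2 ((hmem _).2 hr)

/-- A homomorphism from a number field to a complete field that is bounded on the `w`-adic integers
and for which some nonzero element becomes topologically nilpotent extends to the completion. -/
theorem exists_adicCompletion_hom (w : HeightOneSpectrum (𝓞 K)) {M : Type*} [NormedField M]
    [CompleteSpace M] (g : K →+* M) (hg : ∀ x, w.valuation K x ≤ 1 → ‖g x‖ ≤ 1) {a : K} (ha : a ≠ 0)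
    (hga : ‖g a‖ < 1) :
    ∃ φ : w.adicCompletion K →+* M, ∀ x, φ (algebraMap K (w.adicCompletion K) x) = g x := by
  let f : WithVal (w.valuation K) →+* M := g.comp (WithVal.equiv (w.valuation K)).toRingHom
  have hf : Continuous f := by
    refine continuous_of_continuousAt_zero f ?_
    rw [ContinuousAt, map_zero, Metric.nhds_basis_ball.tendsto_right_iff]
    intro ε hε
    obtain ⟨m, hm⟩ := exists_pow_lt_of_lt_one hε hga
    have ha' : (WithVal.equiv (w.valuation K)).symm (a ^ m) ≠ 0 := by
      rw [Ne, EmbeddingLike.map_eq_zero_iff]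
      exact pow_ne_zero m ha
    refine (Valued.is_topological_valuation _).2 ⟨Units.mk0 (Valued.v.restrict
      ((WithVal.equiv (w.valuation K)).symm (a ^ m))) ((Valuation.ne_zero_iff _).2 ha'), ?_⟩
    intro x hx
    have hx : Valued.v.restrict x < Valued.v.restrict
      ((WithVal.equiv (w.valuation K)).symm (a ^ m)) := hx
    rw [Valuation.restrict_lt_iff] at hx
    have hx : w.valuation K (WithVal.equiv _ x) < w.valuation K (a ^ m) := hx
    have h1 : ‖g (WithVal.equiv _ x / a ^ m)‖ ≤ 1 := by
      refine hg _ ?_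
      rw [map_div₀]
      exact div_le_one_of_le₀ hx.le zero_le
    change f x ∈ Metric.ball 0 ε
    rw [mem_ball_zero_iff]
    refine lt_of_le_of_lt ?_ hm
    rw [map_div₀, norm_div, map_pow, norm_pow] at h1
    have hpos : 0 < ‖g a‖ ^ m := pow_pos (norm_pos_iff.2 ((map_ne_zero g).2 ha)) m
    exact (div_le_one hpos).1 h1
  refine ⟨(UniformSpace.Completion.extensionHom f hf).comp
    (HeightOneSpectrum.adicCompletion.equiv K w).toRingHom, fun x => ?_⟩
  exact UniformSpace.Completion.extensionHom_coe f hf ((WithVal.equiv (w.valuation K)).symm x)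

/-- The completion at `v` as a nontrivially normed field, which is what the spectral norm requires. -/
@[reducible]
noncomputable def adicCompletionNontriviallyNormedField : NontriviallyNormedField (v.adicCompletion K) :=
  { NumberField.HeightOneSpectrum.instNormedFieldValuedAdicCompletion K v with
    non_trivial := (Valued.toNontriviallyNormedField (v.adicCompletion K)
      (WithZero (Multiplicative ℤ))).non_trivial }

attribute [local instance] adicCompletionNontriviallyNormedField

/-- The valuation ring of the algebraic closure of the completion at `v`: the closed unit ball of
the spectral norm. -/
noncomputable def closureIntegers : ValuationSubring (AlgebraicClosure (v.adicCompletion K)) :=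
  let _ := spectralNorm.normedField (v.adicCompletion K) (AlgebraicClosure (v.adicCompletion K))
  have hna : IsNonarchimedean (fun x : AlgebraicClosure (v.adicCompletion K) => ‖x‖) :=
    isNonarchimedean_spectralNorm
  { carrier := {x | ‖x‖ ≤ 1}
    mul_mem' := fun {a b} ha hb => by
      change ‖a * b‖ ≤ 1
      rw [norm_mul]
      exact mul_le_one₀ ha (norm_nonneg b) hb
    one_mem' := norm_one.le
    add_mem' := fun {a b} ha hb => (hna a b).trans (max_le ha hb)
    zero_mem' := norm_zero.trans_le zero_le_one
    neg_mem' := fun {a} ha => le_of_eq_of_le (norm_neg a) ha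
    mem_or_inv_mem' := fun a => by
      rcases le_total ‖a‖ 1 with h | h
      · exact .inl h
      · right
        change ‖a⁻¹‖ ≤ 1
        rw [norm_inv]
        exact inv_le_one_of_one_le₀ h }

theorem mem_closureIntegers {x : AlgebraicClosure (v.adicCompletion K)} :
    x ∈ closureIntegers v ↔ spectralNorm (v.adicCompletion K) _ x ≤ 1 := Iff.rfl

theorem isGaloisPlace_closureIntegers :
    IsGaloisPlace (v.adicCompletionIntegers K) (closureIntegers v) where
  algebraMap_mem_iff x := by
    rw [mem_closureIntegers, spectralNorm_extends]
    exact Valued.toNormedField.norm_le_one_iff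
  map_mem σ x hx := by
    rw [mem_closureIntegers] at hx ⊢
    rwa [← spectralNorm_eq_of_equiv]

/-- An embedding of a number field `L` in the algebraic closure of `K_v` extends to the completion of
`L` at the place that it induces, with values in the compositum of `K_v` and `L`. -/
theorem exists_adicCompletion_hom_closure {L : Type*} [Field L] [NumberField L] [Algebra K L]
    (w : HeightOneSpectrum (𝓞 L)) (i : L →+* AlgebraicClosure (v.adicCompletion K))
    (hi : ∀ x : K, i (algebraMap K L x) = algebraMap (v.adicCompletion K) _
      (algebraMap K (v.adicCompletion K) x))
    (hw : ∀ x, w.valuation L x ≤ 1 → i x ∈ closureIntegers v) :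
    ∃ φ : w.adicCompletion L →+* AlgebraicClosure (v.adicCompletion K),
      (∀ x, φ (algebraMap L (w.adicCompletion L) x) = i x) ∧
      ∀ τ : Gal(AlgebraicClosure (v.adicCompletion K)/(v.adicCompletion K)),
        (∀ x, τ (i x) = i x) → ∀ y, τ (φ y) = φ y := by
  let F := v.adicCompletion K
  let Ω := AlgebraicClosure F
  -- the compositum of `K_v` and `i L`
  let b := Module.finBasis K L
  let M := IntermediateField.adjoin F (Set.range fun n => i (b n))
  have : FiniteDimensional F M := IntermediateField.finiteDimensional_adjoin fun x _ =>
    Algebra.IsIntegral.isIntegral x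
  have hM : ∀ x, i x ∈ M := by
    intro x
    rw [← b.sum_repr x, map_sum]
    refine sum_mem fun n _ => ?_
    rw [Algebra.smul_def, map_mul, hi]
    exact mul_mem (M.algebraMap_mem _) (IntermediateField.subset_adjoin F _ ⟨n, rfl⟩)
  let _ := spectralNorm.normedField F M
  have : CompleteSpace M := spectralNorm.completeSpace F M
  have hnorm : ∀ x : M, ‖x‖ = spectralNorm F Ω x := fun x => spectralNorm.eq_of_tower x
  obtain ⟨a, ha, ha0⟩ := Submodule.exists_mem_ne_zero_of_ne_bot v.ne_bot
  obtain ⟨φ, hφ⟩ := exists_adicCompletion_hom w (i.codRestrict M hM) (fun x hx => by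
    rw [hnorm]
    exact hw x hx) (a := algebraMap K L a) (by simpa using ha0) (by
    rw [hnorm]
    change spectralNorm F Ω (i (algebraMap K L a)) < 1
    rw [hi, spectralNorm_extends]
    exact Valued.toNormedField.norm_lt_one_iff.2 ((valued_algebraMap_lt_one_iff v a).2 ha))
  refine ⟨(algebraMap M Ω).comp φ, fun x => congrArg (algebraMap M Ω) (hφ x), fun τ hτ y => ?_⟩
  refine IntermediateField.adjoin_induction F (s := Set.range fun n => i (b n))
    (p := fun z _ => τ z = z) ?_ (fun x => τ.commutes x) (fun x z _ _ hx hz => ?_)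
    (fun x _ hx => ?_) (fun x z _ _ hx hz => ?_) (φ y).2
  · rintro _ ⟨n, rfl⟩
    exact hτ (b n)
  · rw [map_add, hx, hz]
  · rw [map_inv₀, hx]
  · rw [map_mul, hx, hz]

end Completion

/-! ### Decomposition and inertia groups of the global extension -/

section InducedPrime

open scoped Pointwise

variable {K : Type*} [Field K] [NumberField K] (v : HeightOneSpectrum (𝓞 K))
  {L : Type*} [Field L]
  (i : L →+* AlgebraicClosure (v.adicCompletion K))

theorem algebraMap_ringOfIntegers_mem {L F : Type*} [Field L] [Field F] (B : ValuationSubring F)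
    (i : L →+* F) (x : 𝓞 L) : i x ∈ B := by
  have hx : IsIntegral ℤ (i x) := (RingOfIntegers.isIntegral_coe x).map i.toIntAlgHom
  obtain ⟨y, hy⟩ := IsIntegrallyClosed.isIntegral_iff.1 (hx.tower_top (A := B))
  rw [← hy]
  exact y.2

theorem IsGaloisPlace.map_mem_nonunits {F Ω : Type*} [Field F] [Field Ω] [Algebra F Ω]
    {O : ValuationSubring F} {B : ValuationSubring Ω} (H : IsGaloisPlace O B) (σ : Gal(Ω/F)) {x : Ω}
    (hx : x ∈ B.nonunits) : σ x ∈ B.nonunits := by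
  rw [ValuationSubring.mem_nonunits_iff_or] at hx ⊢
  rwa [map_eq_zero_iff σ σ.injective, ← map_inv₀, H.map_mem_iff]

/-- The prime of `L` that an embedding of `L` in the algebraic closure of `K_v` induces. -/
def inducedPrime : Ideal (𝓞 L) where
  carrier := {x | (i.comp (algebraMap (𝓞 L) L)) x ∈ (closureIntegers v).nonunits}
  add_mem' {a b} ha hb := by
    change (i.comp (algebraMap (𝓞 L) L)) (a + b) ∈ (closureIntegers v).nonunits
    rw [map_add, ValuationSubring.mem_nonunits_iff]
    exact (Valuation.map_add _ _ _).trans_lt (max_lt ha hb)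
  zero_mem' := by
    change (i.comp (algebraMap (𝓞 L) L)) 0 ∈ (closureIntegers v).nonunits
    rw [map_zero, ValuationSubring.mem_nonunits_iff, map_zero]
    exact zero_lt_one
  smul_mem' c x hx := by
    change (i.comp (algebraMap (𝓞 L) L)) (c * x) ∈ (closureIntegers v).nonunits
    have hc := (ValuationSubring.valuation_le_one_iff _ _).2
      (algebraMap_ringOfIntegers_mem (closureIntegers v) i c)
    rw [map_mul, ValuationSubring.mem_nonunits_iff, map_mul]
    exact (mul_le_of_le_one_left' hc).trans_lt hx

theorem mem_inducedPrime {x : 𝓞 L} :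
    x ∈ inducedPrime v i ↔
      (i.comp (algebraMap (𝓞 L) L)) x ∈ (closureIntegers v).nonunits := Iff.rfl

instance isPrime_inducedPrime : (inducedPrime v i).IsPrime := by
  refine Ideal.isPrime_iff.2 ⟨?_, ?_⟩
  · rw [Ideal.ne_top_iff_one, mem_inducedPrime, map_one, ValuationSubring.mem_nonunits_iff,
      map_one]
    exact lt_irrefl _
  · intro x y hxy
    rw [mem_inducedPrime, mem_inducedPrime]
    rw [mem_inducedPrime] at hxy
    by_contra! h
    simp only [ValuationSubring.mem_nonunits_iff, not_lt] at *
    rw [map_mul, map_mul] at hxy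
    exact (one_le_mul h.1 h.2).not_gt hxy

variable {i} [Algebra K L]

/-- The restriction `θ` to `L` of an automorphism `τ` over `K_v` lies in the decomposition group. -/
theorem mem_stabilizer_inducedPrime {θ : Gal(L/K)}
    {τ : Gal(AlgebraicClosure (v.adicCompletion K)/(v.adicCompletion K))}
    (h : ∀ x, i (θ x) = τ (i x)) :
    θ ∈ MulAction.stabilizer Gal(L/K) (inducedPrime v i) := by
  have key : ∀ {θ : Gal(L/K)} {τ : Gal(AlgebraicClosure (v.adicCompletion K)/(v.adicCompletion K))},
      (∀ x, i (θ x) = τ (i x)) → ∀ x ∈ inducedPrime v i, θ • x ∈ inducedPrime v i := by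
    intro θ τ h x hx
    change i (θ x) ∈ (closureIntegers v).nonunits
    rw [h]
    exact (isGaloisPlace_closureIntegers v).map_mem_nonunits τ hx
  rw [MulAction.mem_stabilizer_iff]
  ext x
  rw [Ideal.mem_pointwise_smul_iff_inv_smul_mem]
  refine ⟨fun hx => ?_, fun hx => ?_⟩
  · have := key h _ hx
    rwa [smul_inv_smul] at this
  · refine key (τ := τ⁻¹) (fun y => ?_) x hx
    apply τ.injective
    rw [← h]
    change i ((θ * θ⁻¹) y) = (τ * τ⁻¹) (i y)
    rw [mul_inv_cancel, mul_inv_cancel]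
    rfl

variable (hi : ∀ x : K, i (algebraMap K L x) = algebraMap (v.adicCompletion K) _
      (algebraMap K (v.adicCompletion K) x))

include hi in
theorem under_inducedPrime : (inducedPrime v i).under (𝓞 K) = v.asIdeal := by
  ext r
  rw [Ideal.mem_comap, mem_inducedPrime]
  have h : (i.comp (algebraMap (𝓞 L) L)) (algebraMap (𝓞 K) (𝓞 L) r) = algebraMap (v.adicCompletion K) _
      (algebraMap K (v.adicCompletion K) r) := hi r
  rw [h]
  have H := isGaloisPlace_closureIntegers v
  have hmem := algebraMap_mem_adicCompletionIntegers v r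
  have hr : H.incl ⟨_, hmem⟩ ∈ nonunits (closureIntegers v) ↔ (⟨_, hmem⟩ :
      v.adicCompletionIntegers K) ∈ nonunits (v.adicCompletionIntegers K) :=
    not_congr (isUnit_map_iff H.incl _)
  refine (ValuationSubring.coe_mem_nonunits_iff (a := H.incl ⟨_, hmem⟩)).trans (hr.trans ?_)
  refine (Valuation.mem_maximalIdeal_iff _ (a := (⟨_, hmem⟩ : v.adicCompletionIntegers K))).trans ?_
  exact valued_algebraMap_lt_one_iff v r

include hi in
theorem inducedPrime_mem_primesOver : inducedPrime v i ∈ v.asIdeal.primesOver (𝓞 L) :=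
  ⟨inferInstance, ⟨(under_inducedPrime v hi).symm⟩⟩

include hi in
theorem inducedPrime_ne_bot : inducedPrime v i ≠ ⊥ := by
  intro h
  have := under_inducedPrime v hi
  rw [h, Ideal.under_bot] at this
  exact v.ne_bot this.symm

variable [NumberField L]

/-- The place of `L` that a `K`-embedding of `L` in the algebraic closure of `K_v` induces. -/
def inducedPlace : HeightOneSpectrum (𝓞 L) :=
  ⟨inducedPrime v i, inferInstance, inducedPrime_ne_bot v hi⟩

theorem mem_closureIntegers_of_valuation_le_one {x : L}
    (hx : (inducedPlace v hi).valuation L x ≤ 1) : i x ∈ closureIntegers v := by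
  obtain ⟨n, d, hnd⟩ := (inducedPlace v hi).exists_primeCompl_mul_eq_of_integer x hx
  have hd : ¬ i (d : 𝓞 L) ∈ (closureIntegers v).nonunits := d.2
  have hn := algebraMap_ringOfIntegers_mem (closureIntegers v) i n
  rw [ValuationSubring.mem_nonunits_iff, not_lt] at hd
  rw [← ValuationSubring.valuation_le_one_iff] at hn ⊢
  have h := congrArg (fun z => (closureIntegers v).valuation (i z)) hnd
  simp only [map_mul] at h
  have h' : (closureIntegers v).valuation (i x) * (closureIntegers v).valuation (i (d : 𝓞 L)) =
    (closureIntegers v).valuation (i n) := h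
  by_contra! hlt
  exact (one_lt_mul_of_lt_of_le hlt hd).not_ge (h'.trans_le hn)

include hi in
/-- An element of the decomposition group at a completely split prime is trivial. -/
theorem eq_one_of_splitsCompletelyIn [IsGalois K L] (hs : SplitsCompletelyIn L v) {θ : Gal(L/K)}
    {τ : Gal(AlgebraicClosure (v.adicCompletion K)/(v.adicCompletion K))}
    (h : ∀ x, i (θ x) = τ (i x)) : θ = 1 := by
  have hmem := inducedPrime_mem_primesOver v hi
  obtain ⟨h1, h2⟩ := hs _ hmem
  have := hmem.2
  have : Finite (𝓞 K ⧸ v.asIdeal) := v.asIdeal.finiteQuotientOfFreeOfNeBot v.ne_bot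
  have hc := Ideal.card_stabilizer_eq (G := Gal(L/K)) v.asIdeal (inducedPrime v i)
  rw [Ideal.ramificationIdxIn_eq_ramificationIdx v.asIdeal (inducedPrime v i) Gal(L/K),
    Ideal.inertiaDegIn_eq_inertiaDeg v.asIdeal (inducedPrime v i) Gal(L/K), h1, h2] at hc
  have := (Subgroup.card_eq_one (H := MulAction.stabilizer Gal(L/K) (inducedPrime v i))).1 hc
  have hθ := mem_stabilizer_inducedPrime v h
  rwa [this] at hθ

include hi in
/-- An element of the inertia group at an unramified prime is trivial. -/
theorem eq_one_of_not_ramifiesIn [IsGalois K L] (hs : ¬ RamifiesIn L v) {θ : Gal(L/K)}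
    {τ : Gal(AlgebraicClosure (v.adicCompletion K)/(v.adicCompletion K))}
    (h : ∀ x, i (θ x) = τ (i x))
    (hτ : ∀ x : 𝓞 L, τ (i x) - i x ∈ (closureIntegers v).nonunits) : θ = 1 := by
  have hmem := inducedPrime_mem_primesOver v hi
  have h1 : (inducedPrime v i).ramificationIdx (𝓞 K) = 1 := by
    by_contra h1
    exact hs ⟨_, hmem, h1⟩
  have := hmem.2
  have : Finite (𝓞 K ⧸ v.asIdeal) := v.asIdeal.finiteQuotientOfFreeOfNeBot v.ne_bot
  have hc := Ideal.card_inertia_eq_ramificationIdxIn (G := Gal(L/K)) v.asIdeal (inducedPrime v i)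
  rw [Ideal.ramificationIdxIn_eq_ramificationIdx v.asIdeal (inducedPrime v i) Gal(L/K), h1] at hc
  have := (Subgroup.card_eq_one (H := (inducedPrime v i).inertia Gal(L/K))).1 hc
  have hθ : θ ∈ (inducedPrime v i).inertia Gal(L/K) := by
    intro x
    change (i.comp (algebraMap (𝓞 L) L)) (θ • x - x) ∈ (closureIntegers v).nonunits
    rw [map_sub]
    change i (θ x) - i x ∈ (closureIntegers v).nonunits
    rw [h]
    exact hτ x
  rwa [this] at hθ

end InducedPrime

/-! ### The local condition at a place of the number field -/

section LocalCondition

open IsLocalRing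

variable {K : Type*} [Field K] [NumberField K] (v : HeightOneSpectrum (𝓞 K))

instance closure_isGalois : IsGalois (v.adicCompletion K) (AlgebraicClosure (v.adicCompletion K)) where

/-- The reduction at `v` is that of an integral model in the sense of `CurveReducesTo`. -/
theorem exists_curveReducesTo (E : WeierstrassCurve K) :
    ∃ C : WeierstrassCurve.VariableChange (v.adicCompletion K),
      CurveReducesTo (residue (v.adicCompletionIntegers K)) (C • (E⁄(v.adicCompletion K)))
        (reductionAt E v) := by
  obtain ⟨C, hC⟩ : ∃ C : WeierstrassCurve.VariableChange (v.adicCompletion K),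
      minimalAt E v = C • (E⁄(v.adicCompletion K)) := ⟨_, rfl⟩
  refine ⟨C, ?_⟩
  rw [← hC]
  have key : ∀ {x : v.adicCompletion K} {y : v.adicCompletionIntegers K},
      algebraMap (v.adicCompletionIntegers K) (v.adicCompletion K) y = x →
      ReducesTo (residue (v.adicCompletionIntegers K)) x (residue _ y) := by
    rintro _ y rfl
    exact ⟨y.2, rfl⟩
  exact ⟨key (WeierstrassCurve.integralModel_a₁_eq _ _),
    key (WeierstrassCurve.integralModel_a₂_eq _ _), key (WeierstrassCurve.integralModel_a₃_eq _ _),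
    key (WeierstrassCurve.integralModel_a₄_eq _ _), key (WeierstrassCurve.integralModel_a₆_eq _ _)⟩

theorem isElliptic_reductionAt {E : WeierstrassCurve K} (h : ¬ HasBadReductionAt E v) :
    (reductionAt E v).IsElliptic :=
  WeierstrassCurve.hasGoodReduction_iff_isElliptic_reduction _ |>.1 (not_not.1 h)

theorem natCast_residueField_ne_zero {n : ℕ} (hn : (n : 𝓞 K) ∉ v.asIdeal) :
    (n : ResidueField (v.adicCompletionIntegers K)) ≠ 0 := by
  rw [← map_natCast (residue (v.adicCompletionIntegers K)), Ne, residue_eq_zero_iff]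
  intro h
  have h := (Valuation.mem_maximalIdeal_iff _ (a := (n : v.adicCompletionIntegers K))).1 h
  refine hn ((valued_algebraMap_lt_one_iff v _).1 ?_)
  simpa using h

theorem nsmul_eq_zero_iff_mem_torsionBy {A : Type*} [AddCommGroup A] {n : ℕ} {a : A} :
    a ∈ AddSubgroup.torsionBy A (n : ℤ) ↔ n • a = 0 := by
  rw [← natCast_zsmul]
  exact Submodule.mem_torsionBy_iff (n : ℤ) a

/-- Suppose that `v` splits completely in `L` if it divides `p` or has bad reduction, and that the
reduction has no `p`-torsion if `v` ramifies in `L`. Then a cocycle of the decomposition group with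
values in the `p`-torsion that is a coboundary of `E` over the compositum of `L` and `K_v` is already
one over `K_v`. -/
theorem exists_local_coboundary {L : Type*} [Field L] [NumberField L] [Algebra K L] [IsGalois K L]
    [IsCyclic Gal(L/K)] {p : ℕ} (hp : p.Prime) (hp2 : p ≠ 2) {n : ℕ}
    (hcard : Nat.card Gal(L/K) = p ^ n) (E : WeierstrassCurve K) [E.IsElliptic]
    (habove : (p : 𝓞 K) ∈ v.asIdeal → SplitsCompletelyIn L v)
    (hbad : HasBadReductionAt E v → SplitsCompletelyIn L v)
    (hram : RamifiesIn L v →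
      AddSubgroup.torsionBy (reductionAt E v).toAffine.Point (p : ℤ) = ⊥)
    {i : L →+* AlgebraicClosure (v.adicCompletion K)}
    (hi : ∀ x : K, i (algebraMap K L x) = algebraMap (v.adicCompletion K) _
      (algebraMap K (v.adicCompletion K) x))
    (θ : Gal(AlgebraicClosure (v.adicCompletion K)/(v.adicCompletion K)) →* Gal(L/K))
    (hθ : ∀ τ x, i (θ τ x) = τ (i x))
    {c : Gal(AlgebraicClosure (v.adicCompletion K)/(v.adicCompletion K)) →
      (E⁄(AlgebraicClosure (v.adicCompletion K))).toAffine.Point}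
    (hc : ∀ g h, c (g * h) = c g + g • c h) (hcp : ∀ g, p • c g = 0)
    {Q₀ : (E⁄(AlgebraicClosure (v.adicCompletion K))).toAffine.Point}
    (hQ₀ : ∀ h ∈ θ.ker, c h = h • Q₀ - Q₀) : ∃ T, ∀ γ, c γ = γ • T - T := by
  by_cases hs : SplitsCompletelyIn L v
  · exact ⟨Q₀, fun γ => hQ₀ γ (eq_one_of_splitsCompletelyIn v hi hs (hθ γ))⟩
  have hell : (E⁄(AlgebraicClosure (v.adicCompletion K))).IsElliptic :=
    inferInstanceAs (E.map (algebraMap K (AlgebraicClosure (v.adicCompletion K)))).IsElliptic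
  have := isElliptic_reductionAt v (E := E) fun h => hs (hbad h)
  have hpv := natCast_residueField_ne_zero v (n := p) fun h => hs (habove h)
  obtain ⟨C, hC⟩ := exists_curveReducesTo v E
  have H := isGaloisPlace_closureIntegers v
  have : CharZero (AlgebraicClosure (v.adicCompletion K)) :=
    charZero_of_injective_algebraMap
      (algebraMap (v.adicCompletion K) (AlgebraicClosure (v.adicCompletion K))).injective
  have hpodd := hp.odd_of_ne_two hp2
  have hfin := finite_odd_torsion
    (E⁄(AlgebraicClosure (v.adicCompletion K))).toAffine hpodd
  by_cases hr : RamifiesIn L v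
  · refine exists_coboundary_of_no_torsion hp hfin (reductionHom H hC)
      (fun a ha h => eq_zero_of_reductionHom_eq_zero H hC hpv ha h) hcard θ ?_ ?_ hc hcp hQ₀
    · intro a ha hfix
      refine eq_zero_of_fixed_torsion H hC hpv (fun P hP => ?_) hfix ha
      have hP := nsmul_eq_zero_iff_mem_torsionBy.2 hP
      rw [hram hr] at hP
      exact hP
    · intro s hs
      obtain ⟨I, hI, hIc, -, hIs⟩ := exists_inertia_reductionHom H hC hs Set.finite_empty
        (fun x hx => hx.elim)
      exact ⟨I, hI, hIc, hIs⟩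
  · refine exists_coboundary_of_unramified hp (exists_nsmul_eq_point _ hpodd) hfin
      (reductionHom H hC) (fun a ha h => eq_zero_of_reductionHom_eq_zero H hC hpv ha h)
      (finite_fixed_torsion H hC hpv) θ.ker (fun s hs => ?_) hc hcp hQ₀
    let b := Module.finBasis ℤ (𝓞 L)
    obtain ⟨I, hI, hIc, hIt, hIs⟩ := exists_inertia_reductionHom H hC hs
      (Set.finite_range fun m => i (b m)) (by
        rintro _ ⟨m, rfl⟩
        exact algebraMap_ringOfIntegers_mem _ i (b m))
    refine ⟨I, hI, hIc, fun τ hτ => eq_one_of_not_ramifiesIn v hi hr (hθ τ) fun x => ?_, hIs⟩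
    -- it suffices to consider the elements of an integral basis
    let N : AddSubgroup (𝓞 L) :=
      { carrier := {x | τ (i x) - i x ∈ (closureIntegers v).nonunits}
        zero_mem' := by simp [ValuationSubring.mem_nonunits_iff]
        add_mem' := fun {x y} hx hy => by
          have hx : τ (i x) - i x ∈ (closureIntegers v).nonunits := hx
          have hy : τ (i y) - i y ∈ (closureIntegers v).nonunits := hy
          rw [ValuationSubring.mem_nonunits_iff] at hx hy
          change τ (i (algebraMap (𝓞 L) L (x + y))) - i (algebraMap (𝓞 L) L (x + y)) ∈
            (closureIntegers v).nonunits
          rw [map_add, map_add, map_add, add_sub_add_comm, ValuationSubring.mem_nonunits_iff]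
          exact (Valuation.map_add _ _ _).trans_lt (max_lt hx hy)
        neg_mem' := fun {x} hx => by
          have hx : τ (i x) - i x ∈ (closureIntegers v).nonunits := hx
          rw [ValuationSubring.mem_nonunits_iff] at hx
          change τ (i (algebraMap (𝓞 L) L (-x))) - i (algebraMap (𝓞 L) L (-x)) ∈
            (closureIntegers v).nonunits
          rw [map_neg, map_neg, map_neg, ← neg_sub', ValuationSubring.mem_nonunits_iff,
            Valuation.map_neg]
          exact hx }
    change x ∈ N
    rw [← b.sum_repr x]
    exact N.sum_mem fun m _ => N.zsmul_mem (hIt τ hτ _ ⟨m, rfl⟩) _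

end LocalCondition

/-! ### The absolute Galois group of `L` inside that of `K` -/

section Closures

/-- Two embeddings of a normal extension that agree on the ground field differ by an automorphism. -/
theorem exists_algEquiv_comp_eq {k E Ω : Type*} [Field k] [Field E] [Field Ω] [Algebra k E]
    [Normal k E] {κ κ₁ : E →+* Ω} (h : ∀ x : k, κ₁ (algebraMap k E x) = κ (algebraMap k E x)) :
    ∃ ρ : Gal(E/k), ∀ x, κ₁ x = κ (ρ x) := by
  let := κ.toAlgebra
  let := (κ.comp (algebraMap k E)).toAlgebra
  have : IsScalarTower k E Ω := IsScalarTower.of_algebraMap_eq fun x => rfl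
  let σ : E →ₐ[k] Ω := { κ₁ with commutes' := h }
  refine ⟨Normal.algHomEquivAut k Ω E σ, fun x => ?_⟩
  have := (Normal.algHomEquivAut k Ω E).symm_apply_apply σ
  exact (DFunLike.congr_fun this x).symm

variable (K L : Type*) [Field K] [Field L] [Algebra K L] [Algebra.IsAlgebraic K L]

theorem closureEmb_bijective : Function.Bijective (closureEmb K L) := by
  refine IsAlgClosed.ringHom_bijective_of_isIntegral (closureEmb K L).toRingHom ?_
  have : Algebra.IsIntegral K (AlgebraicClosure L) := Algebra.IsIntegral.trans L
  intro x
  obtain ⟨P, hP, hx⟩ := Algebra.IsIntegral.isIntegral (R := K) x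
  refine ⟨P.map (algebraMap K _), hP.map _, ?_⟩
  rw [Polynomial.eval₂_map]
  have : (closureEmb K L).toRingHom.comp (algebraMap K _) = algebraMap K _ :=
    (closureEmb K L).comp_algebraMap
  rw [this]
  exact hx

/-- For an algebraic extension, the chosen embedding of algebraic closures is an isomorphism. -/
noncomputable def closureEquiv : AlgebraicClosure K ≃+* AlgebraicClosure L :=
  RingEquiv.ofBijective (closureEmb K L) (closureEmb_bijective K L)

/-- The embedding of `L` in the algebraic closure of `K` that corresponds to the chosen embedding of
algebraic closures. -/
noncomputable def embClosure : L →+* AlgebraicClosure K :=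
  (closureEquiv K L).symm.toRingHom.comp (algebraMap L (AlgebraicClosure L))

variable {K L}

theorem closureEquiv_algebraMap (x : K) : closureEquiv K L (algebraMap K _ x) =
    algebraMap L (AlgebraicClosure L) (algebraMap K L x) :=
  ((closureEmb K L).commutes x).trans (IsScalarTower.algebraMap_apply K L (AlgebraicClosure L) x)

theorem closureEquiv_embClosure (x : L) :
    closureEquiv K L (embClosure K L x) = algebraMap L (AlgebraicClosure L) x :=
  (closureEquiv K L).apply_symm_apply _

theorem embClosure_algebraMap (x : K) :
    embClosure K L (algebraMap K L x) = algebraMap K (AlgebraicClosure K) x := by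
  apply (closureEquiv K L).injective
  rw [closureEquiv_embClosure, closureEquiv_algebraMap]

theorem closureEquiv_galRes (s : Gal(AlgebraicClosure L/L)) (x : AlgebraicClosure K) :
    closureEquiv K L (galRes K L s x) = s (closureEquiv K L x) := closureEmb_galRes K L s x

theorem galRes_embClosure (s : Gal(AlgebraicClosure L/L)) (x : L) :
    galRes K L s (embClosure K L x) = embClosure K L x := by
  apply (closureEquiv K L).injective
  rw [closureEquiv_galRes, closureEquiv_embClosure, s.commutes]

variable [IsGalois K L]

variable (K L) in
/-- The restriction of automorphisms of the algebraic closure of `K` to the Galois extension `L`. -/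
noncomputable def galToQuotient : Gal(AlgebraicClosure K/K) →* Gal(L/K) :=
  letI := (embClosure K L).toAlgebra
  haveI : IsScalarTower K L (AlgebraicClosure K) :=
    IsScalarTower.of_algebraMap_eq fun x => (embClosure_algebraMap x).symm
  AlgEquiv.restrictNormalHom L

theorem embClosure_galToQuotient (g : Gal(AlgebraicClosure K/K)) (x : L) :
    embClosure K L (galToQuotient K L g x) = g (embClosure K L x) := by
  let := (embClosure K L).toAlgebra
  have : IsScalarTower K L (AlgebraicClosure K) :=
    IsScalarTower.of_algebraMap_eq fun x => (embClosure_algebraMap x).symm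
  exact AlgEquiv.restrictNormal_commutes g L x

theorem galToQuotient_surjective : Function.Surjective (galToQuotient K L) := by
  let := (embClosure K L).toAlgebra
  have : IsScalarTower K L (AlgebraicClosure K) :=
    IsScalarTower.of_algebraMap_eq fun x => (embClosure_algebraMap x).symm
  exact AlgEquiv.restrictNormalHom_surjective (AlgebraicClosure K)

theorem mem_ker_galToQuotient {g : Gal(AlgebraicClosure K/K)} :
    g ∈ (galToQuotient K L).ker ↔ ∀ x : L, g (embClosure K L x) = embClosure K L x := by
  rw [MonoidHom.mem_ker]
  refine ⟨fun h x => ?_, fun h => AlgEquiv.ext fun x => (embClosure K L).injective ?_⟩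
  · rw [← embClosure_galToQuotient, h, AlgEquiv.one_apply]
  · rw [embClosure_galToQuotient, h, AlgEquiv.one_apply]

theorem isOpen_ker_galToQuotient [FiniteDimensional K L] :
    IsOpen ((galToQuotient K L).ker : Set Gal(AlgebraicClosure K/K)) := by
  let b := Module.finBasis K L
  have hopen : IsOpen (⋂ n, (MulAction.stabilizer Gal(AlgebraicClosure K/K)
      (embClosure K L (b n)) : Set Gal(AlgebraicClosure K/K))) :=
    isOpen_iInter_of_finite fun n => stabilizer_isOpen_of_isIntegral _
  convert hopen using 1
  ext g
  rw [SetLike.mem_coe, mem_ker_galToQuotient, Set.mem_iInter]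
  refine ⟨fun h n => h (b n), fun h x => ?_⟩
  rw [← b.sum_repr x, map_sum, map_sum]
  refine Finset.sum_congr rfl fun n _ => ?_
  rw [Algebra.smul_def, map_mul, map_mul, embClosure_algebraMap, g.commutes]
  exact congrArg _ (h n)

/-- The homomorphism, in fact an isomorphism, from the subgroup of `Gal(K̄/K)` that fixes `L` to the
absolute Galois group of `L`. -/
noncomputable def kerToGal : (galToQuotient K L).ker →* Gal(AlgebraicClosure L/L) where
  toFun u :=
    { ((closureEquiv K L).symm.trans (u : Gal(AlgebraicClosure K/K)).toRingEquiv).trans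
        (closureEquiv K L) with
      commutes' := fun x => by
        change closureEquiv K L ((u : Gal(AlgebraicClosure K/K)) (embClosure K L x)) = _
        rw [mem_ker_galToQuotient.1 u.2, closureEquiv_embClosure] }
  map_one' := AlgEquiv.ext fun x => (closureEquiv K L).apply_symm_apply x
  map_mul' u u' := AlgEquiv.ext fun x => by
    change closureEquiv K L ((u : Gal(AlgebraicClosure K/K)) ((u' : Gal(AlgebraicClosure K/K))
      ((closureEquiv K L).symm x))) = closureEquiv K L ((u : Gal(AlgebraicClosure K/K))
      ((closureEquiv K L).symm (closureEquiv K L ((u' : Gal(AlgebraicClosure K/K))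
      ((closureEquiv K L).symm x)))))
    rw [RingEquiv.symm_apply_apply]

theorem kerToGal_closureEquiv (u : (galToQuotient K L).ker) (x : AlgebraicClosure K) :
    kerToGal u (closureEquiv K L x) =
      closureEquiv K L ((u : Gal(AlgebraicClosure K/K)) x) := by
  change closureEquiv K L ((u : Gal(AlgebraicClosure K/K))
    ((closureEquiv K L).symm (closureEquiv K L x))) = _
  rw [RingEquiv.symm_apply_apply]

theorem closureEquiv_symm_kerToGal (u : (galToQuotient K L).ker) (x : AlgebraicClosure L) :
    (closureEquiv K L).symm (kerToGal u x) =
      (u : Gal(AlgebraicClosure K/K)) ((closureEquiv K L).symm x) :=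
  (closureEquiv K L).symm_apply_apply _

theorem galRes_mem_ker (s : Gal(AlgebraicClosure L/L)) :
    galRes K L s ∈ (galToQuotient K L).ker :=
  mem_ker_galToQuotient.2 (galRes_embClosure s)

theorem kerToGal_galRes (s : Gal(AlgebraicClosure L/L)) :
    kerToGal (⟨galRes K L s, galRes_mem_ker s⟩ : (galToQuotient K L).ker) = s := by
  refine AlgEquiv.ext fun x => ?_
  obtain ⟨x, rfl⟩ := (closureEquiv K L).surjective x
  rw [kerToGal_closureEquiv, closureEquiv_galRes]

theorem continuous_kerToGal :
    Continuous (kerToGal : (galToQuotient K L).ker →* Gal(AlgebraicClosure L/L)) := by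
  apply continuous_of_continuousAt_one _ (continuousAt_def.mpr _)
  intro s hs
  rw [map_one, krullTopology_mem_nhds_one_iff] at hs
  obtain ⟨F, hF, hFs⟩ := hs
  let b := Module.finBasis L F
  have hopen : IsOpen (⋂ i, (MulAction.stabilizer Gal(AlgebraicClosure K/K)
      ((closureEquiv K L).symm (b i)) : Set Gal(AlgebraicClosure K/K))) :=
    isOpen_iInter_of_finite fun i => stabilizer_isOpen_of_isIntegral _
  refine Filter.mem_of_superset ((hopen.preimage continuous_subtype_val).mem_nhds
    (Set.mem_iInter.2 fun i => one_mem _)) ?_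
  intro u hu
  refine hFs ((IntermediateField.mem_fixingSubgroup_iff F _).2 fun x hx => ?_)
  have hlin : (kerToGal u : AlgebraicClosure L →ₐ[L] AlgebraicClosure L).toLinearMap ∘ₗ
      F.val.toLinearMap = F.val.toLinearMap := by
    refine b.ext fun i => ?_
    apply (closureEquiv K L).symm.injective
    exact (closureEquiv_symm_kerToGal u _).trans (Set.mem_iInter.1 hu i)
  exact LinearMap.congr_fun hlin ⟨x, hx⟩

end Closures

/-! ### Torsion points and the Selmer condition on cocycles -/

section Torsion

/-- The restriction of a homomorphism to the `n`-torsion. -/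
def torsionByMap {A A' : Type*} [AddCommGroup A] [AddCommGroup A'] (n : ℤ) (φ : A →+ A') :
    AddSubgroup.torsionBy A n →+ AddSubgroup.torsionBy A' n :=
  (φ.comp (AddSubgroup.torsionBy A n).subtype).codRestrict _ fun a => by
    have ha := (Submodule.mem_torsionBy_iff n a.1).1 a.2
    refine (Submodule.mem_torsionBy_iff n _).2 ?_
    rw [AddMonoidHom.comp_apply, ← map_zsmul]
    change φ (n • a.1) = 0
    rw [ha, map_zero]

/-- A homomorphism induced by a field embedding is equivariant along compatible automorphisms. -/
theorem pointMap_smul_of_comm {k F k' F' : Type*} [Field k] [Field F] [Algebra k F] [Field k']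
    [Field F'] [Algebra k' F'] {R R' : Type*} [CommRing R] [CommRing R'] [Algebra R k] [Algebra R F]
    [IsScalarTower R k F] [Algebra R' k'] [Algebra R' F'] [IsScalarTower R' k' F']
    {E : WeierstrassCurve R} {E' : WeierstrassCurve R'} (j : F →+* F')
    (h : (E⁄F).map j = E'⁄F') {σ : Gal(F/k)} {τ : Gal(F'/k')} (hj : ∀ x, j (σ x) = τ (j x))
    (P : (E⁄F).toAffine.Point) :
    pointMap j h (σ • P) = τ • (pointMap j h P : (E'⁄F').toAffine.Point) := by
  rcases P with _ | ⟨x, y, hxy⟩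
  · rfl
  · change WeierstrassCurve.Affine.Point.some _ _ _ = WeierstrassCurve.Affine.Point.some _ _ _
    rw [WeierstrassCurve.Affine.Point.some.injEq]
    exact ⟨hj x, hj y⟩

theorem mk_mem_ellipticSelmerGroup_iff {K : Type*} [Field K] [NumberField K]
    {E : WeierstrassCurve K} {n : ℕ}
    {f : contCocycles₁ Gal(AlgebraicClosure K/K)
      (AddSubgroup.torsionBy (E⁄(AlgebraicClosure K)).toAffine.Point (n : ℤ))} :
    (QuotientAddGroup.mk f : ContH1 _ _) ∈ ellipticSelmerGroup E n ↔
      ∀ v : HeightOneSpectrum (𝓞 K), ∃ Q : (E⁄(AlgebraicClosure (v.adicCompletion K))).toAffine.Point,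
        ∀ τ : Gal(AlgebraicClosure (v.adicCompletion K)/(v.adicCompletion K)),
          torsionPointMap K (v.adicCompletion K) E n (f.1 (galRes K (v.adicCompletion K) τ)) =
            τ • Q - Q := by
  rw [ellipticSelmerGroup, AddSubgroup.mem_iInf]
  refine forall_congr' fun v => ?_
  rw [AddMonoidHom.mem_ker]
  exact QuotientAddGroup.eq_zero_iff _

end Torsion

/-! ### The Selmer group of `L` in terms of the absolute Galois group of `K` -/

section SelmerTransport

variable {K : Type*} [Field K] (E : WeierstrassCurve K)

theorem map_baseChange_eq {R : Type*} [CommRing R] (E : WeierstrassCurve R) {F F' : Type*}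
    [CommRing F] [CommRing F'] [Algebra R F] [Algebra R F'] {j : F →+* F'}
    (hj : ∀ x : R, j (algebraMap R F x) = algebraMap R F' x) : (E⁄F).map j = E⁄F' :=
  (WeierstrassCurve.map_map _ _ _).trans (congrArg E.map (RingHom.ext hj))

theorem map_baseChange_baseChange_eq {R : Type*} [CommRing R] (E : WeierstrassCurve R)
    {S F F' : Type*} [CommRing S] [CommRing F] [CommRing F'] [Algebra R S] [Algebra S F]
    [Algebra R F'] {j : F →+* F'}
    (hj : ∀ x : R, j (algebraMap S F (algebraMap R S x)) = algebraMap R F' x) :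
    ((E⁄S)⁄F).map j = E⁄F' :=
  (WeierstrassCurve.map_map _ (algebraMap S F) j).trans
    ((WeierstrassCurve.map_map _ (algebraMap R S) (j.comp (algebraMap S F))).trans
      (congrArg E.map (RingHom.ext hj)))

variable (L : Type*) [Field L] [Algebra K L] [IsGalois K L]

theorem map_closureEquiv_symm : ((E⁄L)⁄(AlgebraicClosure L)).map
    ((closureEquiv K L).symm : AlgebraicClosure L →+* AlgebraicClosure K) =
      E⁄(AlgebraicClosure K) :=
  map_baseChange_baseChange_eq E (embClosure_algebraMap (L := L))

variable (n : ℕ)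

/-- The torsion-valued cocycles of the absolute Galois group of `L`, seen as cocycles of a subgroup
of the absolute Galois group of `K`. -/
noncomputable def transportCocycle :
    contCocycles₁ Gal(AlgebraicClosure L/L)
        (AddSubgroup.torsionBy ((E⁄L)⁄(AlgebraicClosure L)).toAffine.Point (n : ℤ)) →+
      contCocycles₁ (galToQuotient K L).ker
        (AddSubgroup.torsionBy (E⁄(AlgebraicClosure K)).toAffine.Point (n : ℤ)) :=
  contCocycles₁Map kerToGal continuous_kerToGal
    (torsionByMap n (pointMap _ (map_closureEquiv_symm E L)))
    (fun u m => Subtype.ext (pointMap_smul_of_comm (E := E⁄L) (E' := E) _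
      (map_closureEquiv_symm E L) (σ := kerToGal u) (τ := (u : Gal(AlgebraicClosure K/K)))
      (fun x => closureEquiv_symm_kerToGal u x) m.1))

/-- A cocycle is a coboundary if its transport is. -/
theorem mem_coboundaries_of_transportCocycle {c : contCocycles₁ Gal(AlgebraicClosure L/L)
      (AddSubgroup.torsionBy ((E⁄L)⁄(AlgebraicClosure L)).toAffine.Point (n : ℤ))}
    (hc : transportCocycle E L n c ∈ contCoboundaries₁ _ _) : c ∈ contCoboundaries₁ _ _ := by
  obtain ⟨m, hm⟩ := hc
  have h' : (E⁄(AlgebraicClosure K)).map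
      ((closureEquiv K L) : AlgebraicClosure K →+* AlgebraicClosure L) =
        (E⁄L)⁄(AlgebraicClosure L) := by
    refine (WeierstrassCurve.map_map _ _ _).trans (Eq.trans (congrArg E.map ?_)
      (WeierstrassCurve.map_map _ _ _).symm)
    ext x
    exact closureEquiv_algebraMap x
  have hinv : ∀ P, pointMap _ (map_closureEquiv_symm E L) (pointMap _ h' P) = P := by
    rintro (_ | ⟨x, y, hxy⟩)
    · rfl
    · change WeierstrassCurve.Affine.Point.some _ _ _ = _
      rw [WeierstrassCurve.Affine.Point.some.injEq]
      exact ⟨(closureEquiv K L).symm_apply_apply x, (closureEquiv K L).symm_apply_apply y⟩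
  refine ⟨torsionByMap n (pointMap _ h') m, fun s => Subtype.ext
    (pointMap_injective _ (map_closureEquiv_symm E L) ?_)⟩
  have h1 := congrArg Subtype.val (hm ⟨galRes K L s, galRes_mem_ker s⟩)
  have h2 : ((transportCocycle E L n c).1 ⟨galRes K L s, galRes_mem_ker s⟩ :
      (E⁄(AlgebraicClosure K)).toAffine.Point) = pointMap _ (map_closureEquiv_symm E L) (c.1 s) := by
    change pointMap _ (map_closureEquiv_symm E L) (c.1 (kerToGal _)).1 = _
    rw [kerToGal_galRes]
  rw [h2] at h1
  rw [h1]
  change galRes K L s • (m : (E⁄(AlgebraicClosure K)).toAffine.Point) - m =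
    pointMap _ (map_closureEquiv_symm E L) (s • pointMap _ h' m - pointMap _ h' m)
  rw [map_sub, hinv, pointMap_smul_of_comm (E := E⁄L) (E' := E) _ (map_closureEquiv_symm E L)
    (τ := galRes K L s) (fun x => ?_), hinv]
  apply (closureEquiv K L).injective
  change closureEquiv K L ((closureEquiv K L).symm (s x)) =
    closureEquiv K L (galRes K L s ((closureEquiv K L).symm x))
  rw [closureEquiv_galRes, RingEquiv.apply_symm_apply, RingEquiv.apply_symm_apply]

variable [NumberField K]

/-- The cocycles of the absolute Galois group of `L` that become coboundaries of `E` at all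
non-archimedean places. The places of `L` above `v` are accounted for by all `K`-embeddings of the
algebraic closure of `K` in that of `K_v`, which makes this condition visibly invariant under
`Gal(K̄/K)`. -/
noncomputable def selmerCocycles : AddSubgroup (contCocycles₁ (galToQuotient K L).ker
    (AddSubgroup.torsionBy (E⁄(AlgebraicClosure K)).toAffine.Point (n : ℤ))) where
  carrier := {f | ∀ (v : HeightOneSpectrum (𝓞 K))
    (j : AlgebraicClosure K →+* AlgebraicClosure (v.adicCompletion K))
    (hj : ∀ x : K, j (algebraMap K _ x) = algebraMap K _ x),
    ∃ Q : (E⁄(AlgebraicClosure (v.adicCompletion K))).toAffine.Point,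
      ∀ (τ : Gal(AlgebraicClosure (v.adicCompletion K)/(v.adicCompletion K)))
        (u : (galToQuotient K L).ker), (∀ x, j ((u : Gal(AlgebraicClosure K/K)) x) = τ (j x)) →
        pointMap j (map_baseChange_eq E hj) (f.1 u).1 = τ • Q - Q}
  zero_mem' v j hj := ⟨0, fun τ u h => by
    rw [smul_zero, sub_zero]
    exact map_zero _⟩
  add_mem' {f g} hf hg v j hj := by
    obtain ⟨Q, hQ⟩ := hf v j hj
    obtain ⟨R, hR⟩ := hg v j hj
    refine ⟨Q + R, fun τ u h => ?_⟩
    change pointMap j (map_baseChange_eq E hj) ((f.1 u).1 + (g.1 u).1) = _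
    rw [map_add, hQ τ u h, hR τ u h, smul_add]
    abel
  neg_mem' {f} hf v j hj := by
    obtain ⟨Q, hQ⟩ := hf v j hj
    refine ⟨-Q, fun τ u h => ?_⟩
    change pointMap j (map_baseChange_eq E hj) (-(f.1 u).1) = _
    rw [map_neg, hQ τ u h, smul_neg]
    abel

variable {E L n}

theorem mem_selmerCocycles {f : contCocycles₁ (galToQuotient K L).ker
    (AddSubgroup.torsionBy (E⁄(AlgebraicClosure K)).toAffine.Point (n : ℤ))} :
    f ∈ selmerCocycles E L n ↔ ∀ (v : HeightOneSpectrum (𝓞 K))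
    (j : AlgebraicClosure K →+* AlgebraicClosure (v.adicCompletion K))
    (hj : ∀ x : K, j (algebraMap K _ x) = algebraMap K _ x),
    ∃ Q : (E⁄(AlgebraicClosure (v.adicCompletion K))).toAffine.Point,
      ∀ (τ : Gal(AlgebraicClosure (v.adicCompletion K)/(v.adicCompletion K)))
        (u : (galToQuotient K L).ker), (∀ x, j ((u : Gal(AlgebraicClosure K/K)) x) = τ (j x)) →
        pointMap j (map_baseChange_eq E hj) (f.1 u).1 = τ • Q - Q := Iff.rfl

/-- Replacing the cocycle by a conjugate amounts to changing the embedding. -/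
theorem conjCocycle_mem_selmerCocycles (σ : Gal(AlgebraicClosure K/K))
    {f : contCocycles₁ (galToQuotient K L).ker
      (AddSubgroup.torsionBy (E⁄(AlgebraicClosure K)).toAffine.Point (n : ℤ))}
    (hf : f ∈ selmerCocycles E L n) : conjCocycle σ f ∈ selmerCocycles E L n := by
  intro v j hj
  have hj' : ∀ x : K, (j.comp (σ : AlgebraicClosure K →+* AlgebraicClosure K))
      (algebraMap K _ x) = algebraMap K _ x := fun x => by
    rw [← hj]
    exact congrArg j (σ.commutes x)
  obtain ⟨Q, hQ⟩ := hf v _ hj'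
  refine ⟨Q, fun τ u h => ?_⟩
  have hu : σ⁻¹ * (u : Gal(AlgebraicClosure K/K)) * σ ∈ (galToQuotient K L).ker := by
    simpa using (inferInstance : (galToQuotient K L).ker.Normal).conj_mem u u.2 σ⁻¹
  rw [conjCocycle_apply σ f u ⟨_, hu⟩ rfl, ← hQ τ ⟨_, hu⟩ fun x => ?_]
  · generalize f.1 ⟨_, hu⟩ = P
    obtain ⟨_ | ⟨x, y, h⟩, _⟩ := P <;> rfl
  · change j ((σ * (σ⁻¹ * (u : Gal(AlgebraicClosure K/K)) * σ)) x) = τ (j (σ x))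
    rw [← h, mul_assoc, mul_inv_cancel_left]
    rfl

/-- Every `K`-embedding `j` of the algebraic closure induces a place `w` of `L` above `v`, and the
Selmer condition at `w` gives the condition that `selmerCocycles` imposes at `j`. -/
theorem transportCocycle_mem_selmerCocycles [NumberField L]
    {c : contCocycles₁ Gal(AlgebraicClosure L/L)
      (AddSubgroup.torsionBy ((E⁄L)⁄(AlgebraicClosure L)).toAffine.Point (n : ℤ))}
    (hc : (QuotientAddGroup.mk c : ContH1 _ _) ∈ ellipticSelmerGroup (E⁄L) n) :
    transportCocycle E L n c ∈ selmerCocycles E L n := by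
  intro v j hj
  let i := j.comp (embClosure K L)
  have hi : ∀ x : K, i (algebraMap K L x) = algebraMap (v.adicCompletion K) _
      (algebraMap K (v.adicCompletion K) x) := fun x => by
    change j (embClosure K L (algebraMap K L x)) = _
    rw [embClosure_algebraMap, hj]
    exact IsScalarTower.algebraMap_apply K (v.adicCompletion K) _ x
  let w := inducedPlace v hi
  obtain ⟨φ, hφ, hφτ⟩ := exists_adicCompletion_hom_closure v w i hi
    fun x => mem_closureIntegers_of_valuation_le_one v hi
  obtain ⟨Φ, hΦ⟩ : ∃ Φ : AlgebraicClosure (w.adicCompletion L) →+*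
      AlgebraicClosure (v.adicCompletion K), ∀ y, Φ (algebraMap (w.adicCompletion L) _ y) = φ y := by
    let := φ.toAlgebra
    let Φ : AlgebraicClosure (w.adicCompletion L) →ₐ[w.adicCompletion L]
      AlgebraicClosure (v.adicCompletion K) := IsAlgClosed.lift
    exact ⟨Φ, Φ.commutes⟩
  have hΦL : ∀ x : L, Φ (algebraMap L _ x) = i x := fun x => by
    rw [IsScalarTower.algebraMap_apply L (w.adicCompletion L), hΦ, hφ]
  have hΦE : ((E⁄L)⁄(AlgebraicClosure (w.adicCompletion L))).map Φ =
      E⁄(AlgebraicClosure (v.adicCompletion K)) :=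
    map_baseChange_baseChange_eq E fun x => ((hΦL (algebraMap K L x)).trans (hi x)).trans
      (IsScalarTower.algebraMap_apply K (v.adicCompletion K) _ x).symm
  -- the embedding through the completion of `L` differs from `j` by an element `ρ` that fixes `L`
  let κ : AlgebraicClosure K →+* AlgebraicClosure (v.adicCompletion K) :=
    (Φ.comp (closureEmb L (w.adicCompletion L)).toRingHom).comp (closureEquiv K L).toRingHom
  have hκ : ∀ x, κ x = Φ (closureEmb L (w.adicCompletion L) (closureEquiv K L x)) := fun x => rfl
  have hκL : ∀ x : L, κ (embClosure K L x) = i x := fun x => by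
    rw [hκ, closureEquiv_embClosure, AlgHom.commutes, hΦL]
  obtain ⟨ρ, hρ⟩ := exists_algEquiv_comp_eq (k := K) (κ := j) (κ₁ := κ) fun x => by
    rw [← embClosure_algebraMap (L := L), hκL]
    rfl
  have hρL : ρ ∈ (galToQuotient K L).ker := mem_ker_galToQuotient.2 fun x =>
    j.injective ((hρ _).symm.trans (hκL x))
  obtain ⟨Q, hQ⟩ := mk_mem_ellipticSelmerGroup_iff.1 hc w
  refine ⟨pointMap Φ hΦE Q - pointMap j (map_baseChange_eq E hj)
    ((transportCocycle E L n c).1 ⟨ρ, hρL⟩).1, fun τ u h => ?_⟩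
  have hτi : ∀ x, τ (i x) = i x := fun x => by
    change τ (j (embClosure K L x)) = j (embClosure K L x)
    rw [← h, mem_ker_galToQuotient.1 u.2]
  obtain ⟨τ', hτ'⟩ := exists_algEquiv_comp_eq (k := w.adicCompletion L) (κ := Φ)
    (κ₁ := (τ : AlgebraicClosure (v.adicCompletion K) →+* _).comp Φ) fun y => by
      change τ (Φ _) = _
      rw [hΦ, hφτ τ hτi]
  have hτ' : ∀ x, τ (Φ x) = Φ (τ' x) := hτ'
  let s := galRes L (w.adicCompletion L) τ'
  let s' : (galToQuotient K L).ker := ⟨galRes K L s, galRes_mem_ker s⟩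
  have hs : ∀ x, κ ((s' : Gal(AlgebraicClosure K/K)) x) = τ (κ x) := fun x => by
    change κ (galRes K L s x) = _
    rw [hκ, closureEquiv_galRes, closureEmb_galRes, ← hτ', ← hκ]
  have hconj : (⟨ρ, hρL⟩ : (galToQuotient K L).ker) * s' = u * ⟨ρ, hρL⟩ := by
    refine Subtype.ext (AlgEquiv.ext fun x => j.injective ?_)
    change j (ρ ((s' : Gal(AlgebraicClosure K/K)) x)) = j ((u : Gal(AlgebraicClosure K/K)) (ρ x))
    rw [← hρ, hs, hρ, h]
  have hcoc := congrArg (fun z => pointMap j (map_baseChange_eq E hj)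
    ((transportCocycle E L n c).1 z).1) hconj
  simp only [(transportCocycle E L n c).2.2] at hcoc
  have hcoc : pointMap j (map_baseChange_eq E hj) (((transportCocycle E L n c).1 ⟨ρ, hρL⟩).1 +
      ρ • ((transportCocycle E L n c).1 s').1) = pointMap j (map_baseChange_eq E hj)
      (((transportCocycle E L n c).1 u).1 + (u : Gal(AlgebraicClosure K/K)) •
        ((transportCocycle E L n c).1 ⟨ρ, hρL⟩).1) := hcoc
  rw [map_add, map_add, pointMap_smul_of_comm (E := E) (E' := E) j (map_baseChange_eq E hj) h]
    at hcoc
  have hκs : pointMap j (map_baseChange_eq E hj) (ρ • ((transportCocycle E L n c).1 s').1) =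
      pointMap Φ hΦE (torsionPointMap L (w.adicCompletion L) (E⁄L) n (c.1 s)) := by
    have : ((transportCocycle E L n c).1 s').1 =
        pointMap _ (map_closureEquiv_symm E L) (c.1 s).1 := by
      change pointMap _ (map_closureEquiv_symm E L) (c.1 (kerToGal s')).1 = _
      rw [kerToGal_galRes]
    rw [this]
    generalize c.1 s = P
    obtain ⟨_ | ⟨x, y, hxy⟩, hP⟩ := P
    · rfl
    · change WeierstrassCurve.Affine.Point.some _ _ _ = WeierstrassCurve.Affine.Point.some _ _ _
      rw [WeierstrassCurve.Affine.Point.some.injEq]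
      have hx : ∀ x, j (ρ ((closureEquiv K L).symm x)) =
          Φ (closureEmb L (w.adicCompletion L) x) := fun x => by
        rw [← hρ, hκ, RingEquiv.apply_symm_apply]
      exact ⟨hx x, hx y⟩
  rw [hκs, hQ τ', map_sub, pointMap_smul_of_comm (E := E⁄L) (E' := E) Φ hΦE (τ := τ)
    fun x => (hτ' x).symm] at hcoc
  rw [smul_sub, ← sub_eq_iff_eq_add.2 hcoc]
  abel

end SelmerTransport

/-! ### A place of good reduction -/

section GoodPlace

variable {K : Type*} [Field K] [NumberField K]

/-- Euclid's theorem for the primes of a number field. -/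
theorem exists_heightOneSpectrum_notMem {S : Set (HeightOneSpectrum (𝓞 K))} (hS : S.Finite) :
    ∃ v, v ∉ S := by
  by_contra! hall
  obtain ⟨N, hN⟩ : ∃ N : ℕ, N ≠ 0 ∧ ∀ v : HeightOneSpectrum (𝓞 K), Ideal.absNorm v.asIdeal ∣ N :=
    ⟨∏ v ∈ hS.toFinset, Ideal.absNorm v.asIdeal, Finset.prod_ne_zero_iff.2 fun v _ =>
      (Ideal.absNorm_eq_zero_iff.not).2 v.ne_bot, fun v =>
      Finset.dvd_prod_of_mem (fun v : HeightOneSpectrum (𝓞 K) => Ideal.absNorm v.asIdeal)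
        (hS.mem_toFinset.2 (hall v))⟩
  have hunit : ¬ IsUnit (((N + 1 : ℕ) : 𝓞 K)) := by
    rw [NumberField.isUnit_iff_norm, RingOfIntegers.coe_norm]
    have : ((((N + 1 : ℕ) : 𝓞 K) : K)) = algebraMap ℚ K ((N + 1 : ℕ) : ℚ) :=
      (map_natCast (algebraMap (𝓞 K) K) _).trans (map_natCast (algebraMap ℚ K) _).symm
    rw [this, Algebra.norm_algebraMap, abs_pow, Nat.abs_cast, pow_eq_one_iff_of_nonneg
      (Nat.cast_nonneg _) Module.finrank_pos.ne', Nat.cast_eq_one]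
    exact fun h => hN.1 (Nat.succ_injective h)
  obtain ⟨m, hm, hNm⟩ := exists_max_ideal_of_mem_nonunits hunit
  have hbot : m ≠ ⊥ := by
    rintro rfl
    exact Nat.succ_ne_zero N (Nat.cast_eq_zero.1 (Ideal.mem_bot.1 hNm))
  have hmem : (N : 𝓞 K) ∈ m :=
    m.mem_of_dvd (Nat.cast_dvd_cast (hN.2 ⟨m, hm.isPrime, hbot⟩)) (Ideal.absNorm_mem m)
  rw [Nat.cast_add, Nat.cast_one] at hNm
  exact (Ideal.ne_top_iff_one m).1 hm.ne_top ((Ideal.add_mem_iff_right m hmem).1 hNm)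

/-- A Weierstrass equation that is integral with unit discriminant at `v` forces the discriminant of
the minimal equation to be a unit. -/
theorem not_hasBadReductionAt {E : WeierstrassCurve K} {v : HeightOneSpectrum (𝓞 K)}
    (h₁ : v.valuation K E.a₁ ≤ 1) (h₂ : v.valuation K E.a₂ ≤ 1) (h₃ : v.valuation K E.a₃ ≤ 1)
    (h₄ : v.valuation K E.a₄ ≤ 1) (h₆ : v.valuation K E.a₆ ≤ 1) (hΔ : v.valuation K E.Δ = 1) :
    ¬ HasBadReductionAt E v := by
  have hlift : ∀ a : K, v.valuation K a ≤ 1 → ∃ r : v.adicCompletionIntegers K,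
      algebraMap _ (v.adicCompletion K) r = algebraMap K (v.adicCompletion K) a := fun a ha =>
    ⟨⟨algebraMap K (v.adicCompletion K) a,
      (v.valuedAdicCompletion_eq_valuation' a).trans_le ha⟩, rfl⟩
  have hint : (E⁄(v.adicCompletion K)).IsIntegral (v.adicCompletionIntegers K) :=
    WeierstrassCurve.isIntegral_of_exists_lift _ (hlift _ h₁) (hlift _ h₂) (hlift _ h₃)
      (hlift _ h₄) (hlift _ h₆)
  have hval : ((E⁄(v.adicCompletion K)).valuation_Δ_aux (v.adicCompletionIntegers K)).1 = 1 := by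
    rw [WeierstrassCurve.valuation_Δ_aux_eq_of_isIntegral, WeierstrassCurve.baseChange,
      WeierstrassCurve.map_Δ]
    obtain ⟨r, hr⟩ := hlift E.Δ hΔ.le
    obtain ⟨s, hs⟩ := hlift E.Δ⁻¹ (by rw [map_inv₀, hΔ, inv_one])
    have hrs : r * s = 1 := by
      apply FaithfulSMul.algebraMap_injective (v.adicCompletionIntegers K) (v.adicCompletion K)
      rw [map_mul, hr, hs, ← map_mul, mul_inv_cancel₀, map_one, map_one]
      intro h0
      rw [h0, map_zero] at hΔ
      exact zero_ne_one hΔ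
    rw [← hr]
    refine le_antisymm (HeightOneSpectrum.valuation_le_one _ _) (not_lt.1 fun h => ?_)
    rw [HeightOneSpectrum.valuation_lt_one_iff_mem] at h
    exact (IsLocalRing.mem_maximalIdeal _).1 h (IsUnit.of_mul_eq_one s hrs)
  obtain ⟨C, hC⟩ : ∃ C : WeierstrassCurve.VariableChange (v.adicCompletion K),
      minimalAt E v = C • (E⁄(v.adicCompletion K)) := ⟨_, rfl⟩
  have hmin := (inferInstance :
    (minimalAt E v).IsMinimal (v.adicCompletionIntegers K)).val_Δ_maximal
  have hC' : C⁻¹ • minimalAt E v = E⁄(v.adicCompletion K) := by rw [hC, inv_smul_smul]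
  refine not_not.2 ⟨?_⟩
  rw [← WeierstrassCurve.valuation_Δ_aux_eq_of_isIntegral]
  refine le_antisymm (WeierstrassCurve.valuation_Δ_aux _ _).2 ?_
  have h := hmin.2 (j := C⁻¹)
    (show (C⁻¹ • minimalAt E v).IsIntegral (v.adicCompletionIntegers K) by rwa [hC'])
  simp only [hC', one_smul] at h
  exact hval.ge.trans ((le_total _ _).elim (fun h' => h h') fun h' => h')

theorem exists_good_place (E : WeierstrassCurve K) [E.IsElliptic] {p : ℕ} (hp : p ≠ 0) :
    ∃ v : HeightOneSpectrum (𝓞 K), (p : 𝓞 K) ∉ v.asIdeal ∧ ¬ HasBadReductionAt E v := by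
  let S := fun a : K => HeightOneSpectrum.Support (𝓞 K) a
  have hS : ∀ a, (S a).Finite := HeightOneSpectrum.Support.finite (𝓞 K)
  obtain ⟨v, hv⟩ := exists_heightOneSpectrum_notMem (((hS E.a₁).union ((hS E.a₂).union
    ((hS E.a₃).union ((hS E.a₄).union (hS E.a₆))))).union
    (((hS E.Δ).union (hS E.Δ⁻¹)).union (hS (p : K)⁻¹)))
  simp only [Set.mem_union, not_or, S, HeightOneSpectrum.Support, Set.mem_ofPred_eq, not_lt] at hv
  obtain ⟨⟨h₁, h₂, h₃, h₄, h₆⟩, ⟨hΔ, hΔ'⟩, hpv⟩ := hv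
  have hone : ∀ x : K, x ≠ 0 → v.valuation K x⁻¹ ≤ 1 → 1 ≤ v.valuation K x := fun x hx h => by
    rw [map_inv₀] at h
    exact (inv_le_one₀ (zero_lt_iff.2 ((Valuation.ne_zero_iff _).2 hx))).1 h
  refine ⟨v, fun h => ?_, not_hasBadReductionAt h₁ h₂ h₃ h₄ h₆
    (hΔ.antisymm (hone _ E.isUnit_Δ.ne_zero hΔ'))⟩
  have h := (v.valuation_lt_one_iff_mem (K := K) _).2 h
  exact absurd (hone _ (Nat.cast_ne_zero.2 hp) hpv)
    (by rwa [← map_natCast (algebraMap (𝓞 K) K) p, not_le])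

end GoodPlace

/-! ### Rational torsion when the Selmer group is trivial -/

section GlobalTorsion

theorem torsionPointMap_eq_pointMap {k k' : Type*} [Field k] [Field k'] [Algebra k k']
    (E : WeierstrassCurve k) (n : ℤ)
    (h : (E⁄(AlgebraicClosure k)).map (closureEmb k k' : AlgebraicClosure k →+* AlgebraicClosure k') =
      E⁄(AlgebraicClosure k'))
    (m : AddSubgroup.torsionBy (E⁄(AlgebraicClosure k)).toAffine.Point n) :
    torsionPointMap k k' E n m = pointMap _ h m.1 := by
  obtain ⟨_ | ⟨x, y, hxy⟩, hm⟩ := m <;> rfl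

theorem isLocallyConstant_smul_point {k F : Type*} [Field k] [Field F] [Algebra k F]
    [Algebra.IsAlgebraic k F] (E : WeierstrassCurve k) (P : (E⁄F).toAffine.Point) :
    IsLocallyConstant fun g : Gal(F/k) => g • P := by
  rw [IsLocallyConstant.iff_exists_open]
  intro g
  rcases P with _ | ⟨x, y, h⟩
  · exact ⟨Set.univ, isOpen_univ, trivial, fun _ _ => rfl⟩
  · have hopen : ∀ z : F, IsOpen {g' : Gal(F/k) | g' z = g z} := fun z => by
      have : {g' : Gal(F/k) | g' z = g z} = (fun g' => g⁻¹ * g') ⁻¹'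
          (MulAction.stabilizer Gal(F/k) z : Set Gal(F/k)) := by
        ext g'
        exact (AlgEquiv.symm_apply_eq g).symm
      rw [this]
      exact (stabilizer_isOpen_of_isIntegral z).preimage (continuous_const_mul _)
    refine ⟨_, (hopen x).inter (hopen y), ⟨rfl, rfl⟩, fun g' hg' => ?_⟩
    change WeierstrassCurve.Affine.Point.some _ _ _ = WeierstrassCurve.Affine.Point.some _ _ _
    rw [WeierstrassCurve.Affine.Point.some.injEq]
    exact hg'

variable {K : Type*} [Field K] [NumberField K]

instance isElliptic_closure (E : WeierstrassCurve K) [E.IsElliptic] :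
    (E⁄(AlgebraicClosure K)).IsElliptic :=
  inferInstanceAs (E.map (algebraMap K (AlgebraicClosure K))).IsElliptic

instance charZero_closure : CharZero (AlgebraicClosure K) :=
  charZero_of_injective_algebraMap (algebraMap K (AlgebraicClosure K)).injective

/-- The Kummer sequence: if the Selmer group is trivial, so is `E(K) / p`. -/
theorem exists_nsmul_eq_of_fixed {E : WeierstrassCurve K} [E.IsElliptic] {p : ℕ} (hp : Odd p)
    (hSel : ellipticSelmerGroup E p = ⊥) {P : (E⁄(AlgebraicClosure K)).toAffine.Point}
    (hP : ∀ g : Gal(AlgebraicClosure K/K), g • P = P) :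
    ∃ R : (E⁄(AlgebraicClosure K)).toAffine.Point,
      (∀ g : Gal(AlgebraicClosure K/K), g • R = R) ∧ p • R = P := by
  obtain ⟨Q, hQ⟩ := exists_nsmul_eq_point (E⁄(AlgebraicClosure K)).toAffine hp P
  let c : contCocycles₁ Gal(AlgebraicClosure K/K)
      (AddSubgroup.torsionBy (E⁄(AlgebraicClosure K)).toAffine.Point (p : ℤ)) :=
    ⟨fun g => ⟨g • Q - Q, nsmul_eq_zero_iff_mem_torsionBy.2 (by
      rw [nsmul_sub, smul_comm, hQ, hP, sub_self])⟩, by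
      rw [IsLocallyConstant.iff_exists_open]
      intro g
      obtain ⟨U, hU, hg, h⟩ := (IsLocallyConstant.iff_exists_open _).1
        (isLocallyConstant_smul_point E Q) g
      exact ⟨U, hU, hg, fun g' hg' => Subtype.ext (congrArg (· - Q) (h g' hg'))⟩, fun g h => by
      apply Subtype.ext
      change (g * h) • Q - Q = g • Q - Q + g • (h • Q - Q)
      rw [smul_sub, mul_smul]
      abel⟩
  have hc : (QuotientAddGroup.mk c : ContH1 _ _) ∈ ellipticSelmerGroup E p := by
    refine mk_mem_ellipticSelmerGroup_iff.2 fun v => ?_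
    have h : (E⁄(AlgebraicClosure K)).map (closureEmb K (v.adicCompletion K) :
        AlgebraicClosure K →+* AlgebraicClosure (v.adicCompletion K)) =
          E⁄(AlgebraicClosure (v.adicCompletion K)) :=
      map_baseChange_eq E (closureEmb K (v.adicCompletion K)).commutes
    refine ⟨pointMap _ h Q, fun τ => ?_⟩
    rw [torsionPointMap_eq_pointMap _ _ h]
    change pointMap _ h (galRes K (v.adicCompletion K) τ • Q - Q) = _
    rw [map_sub, pointMap_smul_of_comm (E := E) (E' := E) _ h (closureEmb_galRes K _ τ)]
  rw [hSel, AddSubgroup.mem_bot, QuotientAddGroup.eq_zero_iff] at hc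
  obtain ⟨m, hm⟩ := hc
  refine ⟨Q - m, fun g => ?_, ?_⟩
  · have h : g • Q - Q = g • (m : (E⁄(AlgebraicClosure K)).toAffine.Point) - m :=
      congrArg Subtype.val (hm g)
    rw [smul_sub, sub_eq_sub_iff_sub_eq_sub]
    exact h
  · rw [nsmul_sub, hQ, nsmul_eq_zero_iff_mem_torsionBy.1 m.2, sub_zero]

theorem finite_fixed_torsion_closure (E : WeierstrassCurve K) [E.IsElliptic] {p : ℕ} (hp : p ≠ 0) :
    {P : (E⁄(AlgebraicClosure K)).toAffine.Point |
      (∀ g : Gal(AlgebraicClosure K/K), g • P = P) ∧ ∃ m, p ^ m • P = 0}.Finite := by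
  obtain ⟨v, hpv, hv⟩ := exists_good_place E hp
  have := isElliptic_reductionAt v hv
  have hell : (E⁄(AlgebraicClosure (v.adicCompletion K))).IsElliptic :=
    inferInstanceAs (E.map (algebraMap K (AlgebraicClosure (v.adicCompletion K)))).IsElliptic
  obtain ⟨C, hC⟩ := exists_curveReducesTo v E
  have h : (E⁄(AlgebraicClosure K)).map (closureEmb K (v.adicCompletion K) :
      AlgebraicClosure K →+* AlgebraicClosure (v.adicCompletion K)) =
        E⁄(AlgebraicClosure (v.adicCompletion K)) :=
    map_baseChange_eq E (closureEmb K (v.adicCompletion K)).commutes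
  refine ((finite_fixed_torsion (isGaloisPlace_closureIntegers v) hC
    (natCast_residueField_ne_zero v hpv)).preimage (f := pointMap _ h)
      (pointMap_injective _ h).injOn).subset ?_
  rintro P ⟨hP, m, hm⟩
  refine ⟨fun τ => ?_, m, ?_⟩
  · rw [← pointMap_smul_of_comm (E := E) (E' := E) _ h (closureEmb_galRes K _ τ), hP]
  · rw [← map_nsmul, hm, map_zero]

/-- If the Selmer group is trivial then the finite `p`-primary part of `E(K)` is `p`-divisible, and
therefore trivial. -/
theorem eq_zero_of_fixed_of_selmer {E : WeierstrassCurve K} [E.IsElliptic] {p : ℕ} (hp : Odd p)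
    (hSel : ellipticSelmerGroup E p = ⊥) {P : (E⁄(AlgebraicClosure K)).toAffine.Point}
    (hpP : p • P = 0) (hP : ∀ g : Gal(AlgebraicClosure K/K), g • P = P) : P = 0 := by
  let B := {P : (E⁄(AlgebraicClosure K)).toAffine.Point //
    (∀ g : Gal(AlgebraicClosure K/K), g • P = P) ∧ ∃ m, p ^ m • P = 0}
  have : Finite B := (finite_fixed_torsion_closure E hp.pos.ne').to_subtype
  let μ : B → B := fun P => ⟨p • P.1, fun g => by rw [smul_comm, P.2.1], by
    obtain ⟨m, hm⟩ := P.2.2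
    exact ⟨m, by rw [smul_comm, hm, nsmul_zero]⟩⟩
  have hμ : Function.Surjective μ := by
    rintro ⟨P, hP, m, hm⟩
    obtain ⟨R, hR, rfl⟩ := exists_nsmul_eq_of_fixed hp hSel hP
    exact ⟨⟨R, hR, m + 1, by rw [pow_succ, mul_smul, hm]⟩, rfl⟩
  have h : μ ⟨P, hP, 1, by rw [pow_one, hpP]⟩ = μ ⟨0, fun g => smul_zero g, 0, nsmul_zero _⟩ :=
    Subtype.ext (hpP.trans (nsmul_zero p).symm)
  exact congrArg Subtype.val (Finite.injective_iff_surjective.2 hμ h)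

end GlobalTorsion

theorem proposition2p6 {K L : Type*} [Field K] [NumberField K] [Field L] [NumberField L]
    [Algebra K L] [IsGalois K L] [IsCyclic Gal(L/K)]
    (p : ℕ) [Fact p.Prime] (hp : p ≠ 2)
    (n : ℕ) (hn : 1 ≤ n) (hcard : Nat.card Gal(L/K) = p ^ n)
    (E : WeierstrassCurve K) [E.IsElliptic]
    (hSel : ellipticSelmerGroup E p = ⊥)
    (habove : ∀ v : HeightOneSpectrum (𝓞 K), (p : 𝓞 K) ∈ v.asIdeal → SplitsCompletelyIn L v)
    (hbad : ∀ v : HeightOneSpectrum (𝓞 K), HasBadReductionAt E v → SplitsCompletelyIn L v)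
    (hram : ∀ v : HeightOneSpectrum (𝓞 K), RamifiesIn L v →
      AddSubgroup.torsionBy (reductionAt E v).toAffine.Point (p : ℤ) = ⊥) :
    ellipticSelmerGroup (E⁄L) p = ⊥ := by
  have hpp : p.Prime := Fact.out
  have hodd := hpp.odd_of_ne_two hp
  have hM : ∀ m : AddSubgroup.torsionBy (E⁄(AlgebraicClosure K)).toAffine.Point (p : ℤ),
      p • m = 0 := fun m => Subtype.ext (nsmul_eq_zero_iff_mem_torsionBy.1 m.2)
  obtain ⟨g₀, hg₀⟩ := IsCyclic.exists_generator (α := Gal(L/K))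
  obtain ⟨σ, rfl⟩ := galToQuotient_surjective g₀
  have hσU : σ ^ p ^ n ∈ (galToQuotient K L).ker := by
    rw [MonoidHom.mem_ker, map_pow, ← hcard, pow_card_eq_one']
  have hσ : ∀ g, ∃ i : ℕ, ∃ u ∈ (galToQuotient K L).ker, g = σ ^ i * u := fun g => by
    obtain ⟨i, hi⟩ := mem_powers_iff_mem_zpowers.2 (hg₀ (galToQuotient K L g))
    have hi : galToQuotient K L σ ^ i = galToQuotient K L g := hi
    refine ⟨i, (σ ^ i)⁻¹ * g, ?_, (mul_inv_cancel_left _ _).symm⟩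
    rw [MonoidHom.mem_ker, map_mul, map_inv, map_pow, hi, inv_mul_cancel]
  have hinv : ∀ m : AddSubgroup.torsionBy (E⁄(AlgebraicClosure K)).toAffine.Point (p : ℤ),
      (∀ u ∈ (galToQuotient K L).ker, u • m = m) → m = 0 := fun m hm =>
    Subtype.ext (eq_zero_of_fixed_of_isCyclic hpp hcard (galToQuotient K L)
      (fun P hpP hP => eq_zero_of_fixed_of_selmer hodd hSel hpP hP)
      (nsmul_eq_zero_iff_mem_torsionBy.1 m.2) fun u hu => congrArg Subtype.val (hm u hu))
  rw [AddSubgroup.eq_bot_iff_forall]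
  intro x hx
  obtain ⟨c, rfl⟩ := QuotientAddGroup.mk_surjective x
  rw [QuotientAddGroup.eq_zero_iff]
  by_contra hc
  obtain ⟨f, hfS, hf0, hfσ⟩ := exists_invariant_cocycle hpp hM hσU
    (fun f hf => conjCocycle_mem_selmerCocycles σ hf) (transportCocycle_mem_selmerCocycles hx)
    fun h => hc (mem_coboundaries_of_transportCocycle E L p h)
  -- the invariant class extends to `K`, and the local results put it in the Selmer group of `K`
  obtain ⟨F, hF⟩ := exists_cocycle_extension isOpen_ker_galToQuotient hinv hσ hfσ
  have hFS : (QuotientAddGroup.mk F : ContH1 _ _) ∈ ellipticSelmerGroup E p := by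
    refine mk_mem_ellipticSelmerGroup_iff.2 fun v => ?_
    let j : AlgebraicClosure K →+* AlgebraicClosure (v.adicCompletion K) :=
      closureEmb K (v.adicCompletion K)
    have hj : ∀ x : K, j (algebraMap K _ x) = algebraMap K _ x :=
      (closureEmb K (v.adicCompletion K)).commutes
    obtain ⟨Q, hQ⟩ := mem_selmerCocycles.1 hfS v j hj
    refine exists_local_coboundary v hpp hp hcard E (habove v) (hbad v) (hram v)
      (i := j.comp (embClosure K L)) (fun x => ?_)
      ((galToQuotient K L).comp (galRes K (v.adicCompletion K))) (fun τ x => ?_)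
      (c := fun τ => torsionPointMap K (v.adicCompletion K) E p
        (F.1 (galRes K (v.adicCompletion K) τ))) (fun g h => ?_) (fun g => ?_) (Q₀ := Q)
      fun τ hτ => ?_
    · change j (embClosure K L (algebraMap K L x)) = _
      rw [embClosure_algebraMap, hj]
      exact IsScalarTower.algebraMap_apply K (v.adicCompletion K) _ x
    · change j (embClosure K L (galToQuotient K L _ x)) = τ (j (embClosure K L x))
      rw [embClosure_galToQuotient]
      exact closureEmb_galRes K _ τ _
    · rw [map_mul, F.2.2, map_add, torsionPointMap_smul]
    · rw [← map_nsmul, hM, map_zero]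
    · rw [torsionPointMap_eq_pointMap _ _ (map_baseChange_eq E hj),
        ← hQ τ ⟨galRes K (v.adicCompletion K) τ, hτ⟩ (closureEmb_galRes K _ τ), ← hF]
  rw [hSel, AddSubgroup.mem_bot, QuotientAddGroup.eq_zero_iff] at hFS
  obtain ⟨m, hm⟩ := hFS
  exact hf0 ⟨m, fun u => (hF u).symm.trans (hm u)⟩
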